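/- Let $\nu$ be a probability measure on $\mathbb C$, invariant under rotations about $0$, with $\int_{\mathbb C} |\log|z||\,d\nu(z)<\infty$ (in particular $\nu(\{0\})=0$), and let $V^\nu(z)=\int_{\mathbb C}\log|z-w|\,d\nu(w)$. Let $(a_k)_{k\ge 0}$ be i.i.d. complex random variables such that $a_0\neq 0$ almost surely, $a_0$ is not almost surely constant, and $\mathbb E\log(1+|a_0|)<\infty$. For $n\ge 1$ let \[ P_n(z)=\sum_{k=0}^n a_k\,\frac{z^k}{\sqrt{\langle X^k,X^k\rangle_{n,\nu}}},\qquad \langle P,Q\rangle_{n,\nu}=\int_{\mathbb C}P(z)\overline{Q(z)}\,e^{-2nV^\nu(z)}\,d\nu(z), \] and let $z_1,\dots,z_n$ be the zeros of $P_n$ counted with multiplicity. For $\alpha,\lambda>0$ let \[ f_{\alpha,\lambda}(z)=\sum_{k=0}^\infty \frac{a_k}{\Gamma(1+\frac{2k}{\alpha})^{1/2}}\left(\frac{2\lambda}{\alpha}\right)^{k/\alpha}z^k , \] which is almost surely an entire function. Point processes on $X$ are random elements of the space of locally finite integer-valued measures on $X$ with the vague topology (tested on continuous compactly supported functions), zeros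 are counted with multiplicity, and $D_r$ is the open disk of radius $r$ centred at $0$. (i) At the origin. If $\lim_{r\to0^+}\nu(D_r)/r^\alpha=\lambda$, then the point process $\{n^{1/\alpha}z_1,\dots,n^{1/\alpha}z_n\}$ on $\mathbb C$ converges almost surely, as $n\to\infty$, to the point process of the zeros of $f_{\alpha,\lambda}$. (ii) At infinity. If $\lim_{r\to\infty}r^\alpha\,\nu(\mathbb C\setminus D_r)=\lambda$, then the point process $\{n^{-1/\alpha}z_1,\dots,n^{-1/\alpha}z_n\}$, seen on $\mathbb C\setminus\{0\}$, converges in law to the point process of the inverses of the zeros of $f_{\alpha,\lambda}$. (iii) Maximum. Under the hypothesis of (ii), the maximum $\max\{|z| : z\in\mathbb C\setminus\{0\},\ f_{\alpha,\lambda}(1/z)=0\}$ almost surely exists, and \[ \frac1{n^{1/\alpha}}\max_{1\le k\le n}|z_k|\ \longrightarrow\ \max\{|z| : z\in\mathbb C\setminus\{0\},\ f_{\alpha,\lambda}(1/z)=0\}\quad\text{in law.} \] -/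

import Mathlib

open MeasureTheory ProbabilityTheory Filter Topology

noncomputable section

/-! ### Point configurations and the vague topology -/

/-- Locally finite measures all of whose values are non-negative integers or infinity. -/
def IsPointMeasure {X : Type*} [TopologicalSpace X] [MeasurableSpace X] (μ : Measure X) : Prop :=
  IsLocallyFiniteMeasure μ ∧ ∀ A : Set X, MeasurableSet A → ∃ m : ℕ∞, μ A = (m : ENNReal)

/-- The space of point configurations (with multiplicities) on `X`. -/
structure PointConfig (X : Type*) [TopologicalSpace X] [MeasurableSpace X] where
  toMeasure : Measure X
  isPointMeasure : IsPointMeasure toMeasure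

/-- The vague topology: the smallest one making `P ↦ ∫ f dP` continuous for every continuous
compactly supported `f : X → ℝ`. -/
instance PointConfig.instTopologicalSpace (X : Type*) [TopologicalSpace X] [MeasurableSpace X] :
    TopologicalSpace (PointConfig X) :=
  TopologicalSpace.induced
    (fun (P : PointConfig X) (f : CompactlySupportedContinuousMap X ℝ) => ∫ x, f x ∂P.1)
    inferInstance

instance PointConfig.instMeasurableSpace (X : Type*) [TopologicalSpace X] [MeasurableSpace X] :
    MeasurableSpace (PointConfig X) := borel _

instance PointConfig.instBorelSpace (X : Type*) [TopologicalSpace X] [MeasurableSpace X] :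
    BorelSpace (PointConfig X) := ⟨rfl⟩

theorem isPointMeasure_zero {X : Type*} [TopologicalSpace X] [MeasurableSpace X] :
    IsPointMeasure (0 : Measure X) :=
  ⟨inferInstance, fun A _ => ⟨0, by simp⟩⟩

/-! ### Configurations given by finitely many points -/

/-- `∑ δ_x` over the points `x` of a multiset. -/
def multisetMeasure (s : Multiset ℂ) : Measure ℂ := (s.map Measure.dirac).sum

theorem isPointMeasure_multisetMeasure (s : Multiset ℂ) : IsPointMeasure (multisetMeasure s) := by
  induction s using Multiset.induction with
  | empty => simpa [multisetMeasure] using isPointMeasure_zero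
  | cons a s ih =>
    have h : multisetMeasure (a ::ₘ s) = Measure.dirac a + multisetMeasure s := by
      simp [multisetMeasure]
    rw [h]
    obtain ⟨h1, h2⟩ := ih
    refine ⟨⟨fun x => ?_⟩, fun A hA => ?_⟩
    · obtain ⟨U, hU, hU'⟩ := h1.finiteAtNhds x
      refine ⟨U, hU, ?_⟩
      rw [Measure.add_apply]
      exact ENNReal.add_lt_top.mpr ⟨measure_lt_top _ _, hU'⟩
    · obtain ⟨m, hm⟩ := h2 A hA
      by_cases ha : a ∈ A
      · exact ⟨1 + m, by simp [hm, Measure.dirac_apply' a hA, ha]⟩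
      · exact ⟨m, by simp [hm, Measure.dirac_apply' a hA, ha]⟩

/-- The configuration formed by the points of a finite multiset. -/
def PointConfig.ofMultiset (s : Multiset ℂ) : PointConfig ℂ :=
  ⟨multisetMeasure s, isPointMeasure_multisetMeasure s⟩

/-! ### Zeros of an entire function -/

/-- `∑ δ_z` over the zeros `z` of `f`, repeated according to multiplicity. -/
def zeroMeasure (f : ℂ → ℂ) : Measure ℂ :=
  Measure.sum fun z : ℂ => analyticOrderNatAt f z • Measure.dirac z

theorem exists_enat_tsum {ι : Type*} (g : ι → ENNReal) (hg : ∀ i, ∃ m : ℕ, g i = m) :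
    ∃ m : ℕ∞, ∑' i, g i = (m : ENNReal) := by
  classical
  choose m hm using hg
  by_cases h : (Function.support m).Finite
  · refine ⟨((∑ i ∈ h.toFinset, m i : ℕ) : ℕ∞), ?_⟩
    rw [tsum_eq_sum (s := h.toFinset)]
    · rw [ENat.toENNReal_coe, Nat.cast_sum]
      exact Finset.sum_congr rfl fun i _ => hm i
    · intro i hi
      have : m i = 0 := by simpa using hi
      simp [hm, this]
  · refine ⟨⊤, ?_⟩
    have hinf : Infinite (Function.support m) := Set.infinite_coe_iff.mpr h
    rw [ENat.toENNReal_top, eq_top_iff]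
    calc (⊤ : ENNReal) = ∑' _ : Function.support m, (1 : ENNReal) :=
          (ENNReal.tsum_const_eq_top_of_ne_zero one_ne_zero).symm
      _ ≤ ∑' i : Function.support m, g i := by
          refine ENNReal.tsum_le_tsum fun i => ?_
          rw [hm]
          exact_mod_cast Nat.one_le_iff_ne_zero.mpr i.2
      _ ≤ ∑' i, g i := ENNReal.tsum_comp_le_tsum_of_injective Subtype.val_injective g

theorem isPointMeasure_zeroMeasure {f : ℂ → ℂ} (hf : Differentiable ℂ f) :
    IsPointMeasure (zeroMeasure f) := by
  have han : ∀ z, AnalyticAt ℂ f z := fun z => hf.analyticAt z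
  have key : ∀ A, MeasurableSet A → zeroMeasure f A =
      ∑' z, (analyticOrderNatAt f z : ENNReal) * A.indicator 1 z := by
    intro A hA
    simp [zeroMeasure, Measure.sum_apply _ hA, Measure.dirac_apply' _ hA, nsmul_eq_mul]
  refine ⟨⟨fun x => ?_⟩, fun A hA => ?_⟩
  · rcases (han x).eventually_eq_zero_or_eventually_ne_zero with h | h
    · refine ⟨Set.univ, univ_mem, ?_⟩
      have h0 : f = 0 := by
        have := AnalyticOnNhd.eq_of_eventuallyEq (f := f) (g := 0) (z₀ := x)
          (fun z _ => han z) (fun z _ => analyticAt_const) h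
        exact this
      have : ∀ z, analyticOrderNatAt f z = 0 := by
        intro z
        have : analyticOrderAt f z = ⊤ := by
          rw [analyticOrderAt_eq_top, h0]; simp
        simp [analyticOrderNatAt, this]
      simp [key _ MeasurableSet.univ, this]
    · obtain ⟨U, hU, hUo, hx⟩ := eventually_nhds_iff.mp (eventually_nhdsWithin_iff.mp h)
      refine ⟨U, hUo.mem_nhds hx, ?_⟩
      rw [key U hUo.measurableSet, tsum_eq_single x]
      · simp [hx]
      · intro z hz
        by_cases hzU : z ∈ U
        · have : f z ≠ 0 := hU z hzU hz
          have h0 : analyticOrderAt f z = 0 := (han z).analyticOrderAt_eq_zero.mpr this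
          simp [analyticOrderNatAt, h0]
        · simp [hzU]
  · rw [key A hA]
    refine exists_enat_tsum _ fun z => ?_
    by_cases hz : z ∈ A
    · exact ⟨analyticOrderNatAt f z, by simp [hz]⟩
    · exact ⟨0, by simp [hz]⟩

open Classical in
/-- The configuration of the zeros of the entire function `f`, with multiplicity
(the empty configuration when `f` is not entire). -/
def PointConfig.zeros (f : ℂ → ℂ) : PointConfig ℂ :=
  if hf : Differentiable ℂ f then ⟨zeroMeasure f, isPointMeasure_zeroMeasure hf⟩
  else ⟨0, isPointMeasure_zero⟩

/-! ### Configurations in the punctured plane -/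

/-- The punctured plane. -/
abbrev PuncturedPlane : Type := {z : ℂ // z ≠ 0}

/-- Inversion `z ↦ 1 / z` of the punctured plane. -/
def PuncturedPlane.inversion : PuncturedPlane ≃ₜ PuncturedPlane where
  toFun z := ⟨z.1⁻¹, inv_ne_zero z.2⟩
  invFun z := ⟨z.1⁻¹, inv_ne_zero z.2⟩
  left_inv z := by simp
  right_inv z := by simp
  continuous_toFun :=
    (continuous_subtype_val.inv₀ fun z : PuncturedPlane => z.2).subtype_mk _
  continuous_invFun :=
    (continuous_subtype_val.inv₀ fun z : PuncturedPlane => z.2).subtype_mk _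

theorem isPointMeasure_comap_punctured {μ : Measure ℂ} (hμ : IsPointMeasure μ) :
    IsPointMeasure (μ.comap (Subtype.val : PuncturedPlane → ℂ)) := by
  have he : MeasurableEmbedding (Subtype.val : PuncturedPlane → ℂ) :=
    MeasurableEmbedding.subtype_coe (measurableSet_singleton (0 : ℂ)).compl
  obtain ⟨h1, h2⟩ := hμ
  refine ⟨⟨fun x => ?_⟩, fun A hA => ?_⟩
  · obtain ⟨U, hU, hU'⟩ := h1.finiteAtNhds x.1
    refine ⟨Subtype.val ⁻¹' U, continuous_subtype_val.continuousAt.preimage_mem_nhds hU, ?_⟩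
    rw [he.comap_apply]
    exact (measure_mono (Set.image_preimage_subset _ _)).trans_lt hU'
  · rw [he.comap_apply]
    exact h2 _ (he.measurableSet_image.mpr hA)

/-- The restriction of a configuration to the punctured plane. -/
def PointConfig.punctured (P : PointConfig ℂ) : PointConfig PuncturedPlane :=
  ⟨P.1.comap Subtype.val, isPointMeasure_comap_punctured P.2⟩

theorem isPointMeasure_map_inversion {μ : Measure PuncturedPlane} (hμ : IsPointMeasure μ) :
    IsPointMeasure (μ.map PuncturedPlane.inversion) := by
  have hm : Measurable PuncturedPlane.inversion := PuncturedPlane.inversion.continuous.measurable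
  obtain ⟨h1, h2⟩ := hμ
  refine ⟨⟨fun x => ?_⟩, fun A hA => ?_⟩
  · obtain ⟨U, hU, hUo, hUf⟩ := Measure.exists_isOpen_measure_lt_top μ
      (PuncturedPlane.inversion.symm x)
    refine ⟨PuncturedPlane.inversion.symm ⁻¹' U,
      (hUo.preimage PuncturedPlane.inversion.symm.continuous).mem_nhds hU, ?_⟩
    rw [Measure.map_apply hm
      (hUo.preimage PuncturedPlane.inversion.symm.continuous).measurableSet]
    simpa [← Set.preimage_comp] using hUf
  · rw [Measure.map_apply hm hA]
    exact h2 _ (hm hA)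

/-- The configuration of the inverses `1 / z` of the points `z` of a configuration. -/
def PointConfig.inverted (P : PointConfig PuncturedPlane) : PointConfig PuncturedPlane :=
  ⟨P.1.map PuncturedPlane.inversion, isPointMeasure_map_inversion P.2⟩

/-! ### The model -/

/-- A rotationally invariant measure with `∫ |log |z|| dν < ∞`. As `Real.log 0 = 0`, the fact
that the integrand is infinite at the origin is recorded by `ν {0} = 0`. -/
structure IsAdmissibleBackground (ν : Measure ℂ) : Prop where
  rotation_invariant : ∀ c : ℂ, ‖c‖ = 1 → ν.map (fun z => c * z) = ν
  no_atom_zero : ν {0} = 0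
  integrable_log : Integrable (fun z : ℂ => Real.log ‖z‖) ν

/-- The logarithmic potential `V^ν`. -/
def logPotential (ν : Measure ℂ) (z : ℂ) : ℝ := ∫ w, Real.log ‖z - w‖ ∂ν

/-- The inner product `⟨P, Q⟩ = ∫ P \overline{Q} e^{-2nV^ν} dν`. -/
def weightedInner (ν : Measure ℂ) (n : ℕ) (P Q : Polynomial ℂ) : ℂ :=
  ∫ z, P.eval z * (starRingEnd ℂ) (Q.eval z)
    * (Real.exp (-2 * (n : ℝ) * logPotential ν z) : ℂ) ∂ν

/-- The normalized monomial `z^k / √⟨X^k, X^k⟩`. -/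
def normalizedMonomial (ν : Measure ℂ) (n k : ℕ) : Polynomial ℂ :=
  Polynomial.C
      (((Real.sqrt (weightedInner ν n (Polynomial.X ^ k) (Polynomial.X ^ k)).re)⁻¹ : ℝ) : ℂ)
    * Polynomial.X ^ k

/-- The polynomial `∑_{k ≤ n} a_k R_{k,n}`. -/
def randomPoly (ν : Measure ℂ) (a : ℕ → ℂ) (n : ℕ) : Polynomial ℂ :=
  ∑ k ∈ Finset.range (n + 1), Polynomial.C (a k) * normalizedMonomial ν n k

/-- The sequence `a` is i.i.d., `a_0 ≠ 0` almost surely, `a_0` is not deterministic, and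
`E log (1 + |a_0|) < ∞`. -/
structure IsAdmissibleCoefficients {Ω : Type*} [MeasurableSpace Ω] (μ : Measure Ω)
    (a : ℕ → Ω → ℂ) : Prop where
  measurable : ∀ k, Measurable (a k)
  indep : iIndepFun a μ
  identDistrib : ∀ k, IdentDistrib (a k) (a 0) μ μ
  ne_zero : ∀ᵐ ω ∂μ, a 0 ω ≠ 0
  not_deterministic : ¬ ∃ c : ℂ, ∀ᵐ ω ∂μ, a 0 ω = c
  integrable_log : Integrable (fun ω => Real.log (1 + ‖a 0 ω‖)) μ

/-- The `k`-th term of the series defining the Mittag-Leffler random function. -/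
def mittagLefflerTerm (α lam : ℝ) (a : ℕ → ℂ) (z : ℂ) (k : ℕ) : ℂ :=
  a k / (Real.sqrt (Real.Gamma (1 + 2 * (k : ℝ) / α)) : ℂ)
    * (((2 * lam / α) ^ ((k : ℝ) / α) : ℝ) : ℂ) * z ^ k

/-- The function `z ↦ ∑_k a_k (2λ/α)^{k/α} z^k / Γ(1 + 2k/α)^{1/2}`. -/
def mittagLefflerFun (α lam : ℝ) (a : ℕ → ℂ) (z : ℂ) : ℂ :=
  ∑' k : ℕ, mittagLefflerTerm α lam a z k

/-- The maximum modulus of the points of a finite multiset. -/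
def maxModulus (s : Multiset ℂ) : ℝ := sSup ((fun z : ℂ => ‖z‖) '' {z | z ∈ s})

/-- The set of the moduli `|z|` of the `z ≠ 0` such that `f (1/z) = 0`. -/
def invZeroModuli (f : ℂ → ℂ) : Set ℝ := (fun z : ℂ => ‖z‖) '' {z | z ≠ 0 ∧ f z⁻¹ = 0}

end

noncomputable section

/-! ### Zeros of entire functions -/

/-! Rotation invariance reduces everything to the law `m` of `|z|`. Averaging the potential over
circles gives `V = U(|z|) + const` with `U(r) = ∫ log⁺(r/s) dm(s)`
(`IsAdmissibleBackground.logPotential_eq`), so the squared norms of the monomials are, up to a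
factor independent of `k`, the moments `∫ r^(2k) e^(-2nU(r)) dm(r)`. Parametrize `m` by its quantile
function `Q` and put `W = U ∘ Q`. If `m` gives mass `~ λ r^α` to small disks, then `Q(p) ~
(p/λ)^(1/α)` and `W(p) ~ p/α`. Zooming at `p = q/n` turns the moments into Gamma integrals
(`IsRadialProfile.tendsto_profileMoment`), which are the Mittag-Leffler weights; a lower bound
uniform in `k ≤ n` (`IsRadialProfile.exists_profileMoment_ge`) controls the whole triangular array.

By Borel–Cantelli the logarithmic moment gives `|a_k| ≤ C e^k` almost surely
(`IsAdmissibleCoefficients.ae_hasExpGrowth`). Hence the rescaled polynomials converge uniformly on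
disks to the random entire function (`IsWeightArray.tendstoOnDisks`), and Hurwitz's theorem
(`TendstoOnDisks.tendsto_integral_zeroMeasure`) carries the zeros along.

At infinity, the inversion `r ↦ 1/r` exchanges the moments of degrees `j` and `n - j`
(`IsRadialLaw.radialMoment_inv`). The reversed polynomial `z^n P_n(1/z)` is therefore of the kind
treated at the origin, with coefficients read backwards. Reversal preserves the law of an i.i.d.
sequence but changes with `n`, so almost sure convergence becomes convergence in law
(`IsAdmissibleCoefficients.tendstoInDistribution_of_reverse`).

The maximum is the inverse of the smallest modulus of a zero, which is continuous in the function as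
long as the limit has a zero. A zero-free function of finite order is the exponential of a
polynomial, so the high Taylor coefficients of `f'/f` vanish; each such equation determines
`a_(k+1)` from its predecessors, and infinitely many of them have probability zero
(`measure_forall_logDerivCoeff_eq_zero`). -/

theorem zeroMeasure_apply (f : ℂ → ℂ) {A : Set ℂ} (hA : MeasurableSet A) :
    zeroMeasure f A = ∑' z, (analyticOrderNatAt f z : ENNReal) * A.indicator 1 z := by
  simp [zeroMeasure, Measure.sum_apply _ hA, Measure.dirac_apply' _ hA, nsmul_eq_mul]

theorem isLocallyFiniteMeasure_zeroMeasure {f : ℂ → ℂ} (hf : Differentiable ℂ f) :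
    IsLocallyFiniteMeasure (zeroMeasure f) := (isPointMeasure_zeroMeasure hf).1

theorem analyticOrderAt_ne_top_of_entire {f : ℂ → ℂ} (hf : Differentiable ℂ f) (h0 : f ≠ 0)
    (z : ℂ) : analyticOrderAt f z ≠ ⊤ := fun h =>
  h0 ((AnalyticOnNhd.analyticOrderAt_eq_top_iff_eq_zero z fun w => hf.analyticAt w).mp h)

/-- Orders of vanishing add under products, provided they are finite; this is where `g ≠ 0` enters.
The lemma lets inductions remove one zero at a time. -/
theorem zeroMeasure_linear_mul {g : ℂ → ℂ} (hg : Differentiable ℂ g) (h0 : g ≠ 0) (z₀ : ℂ) :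
    zeroMeasure (fun z => (z - z₀) * g z) = Measure.dirac z₀ + zeroMeasure g := by
  have hord : ∀ z, analyticOrderNatAt (fun z => (z - z₀) * g z) z
      = (if z = z₀ then 1 else 0) + analyticOrderNatAt g z := by
    intro z
    have h1 : analyticOrderAt (fun w : ℂ => w - z₀) z = ((if z = z₀ then 1 else 0 : ℕ) : ℕ∞) := by
      split_ifs with h
      · subst h; simp
      · simp [h]
    have := analyticOrderNatAt_mul (f := fun w : ℂ => w - z₀) (g := g) (z₀ := z) (by fun_prop)
      (hg.analyticAt z) (by rw [h1]; exact ENat.natCast_ne_top _)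
      (analyticOrderAt_ne_top_of_entire hg h0 z)
    rw [show (fun z => (z - z₀) * g z) = (fun w : ℂ => w - z₀) * g from rfl, this]
    congr 1
    rw [analyticOrderNatAt, h1, ENat.toNat_natCast]
  ext A hA
  rw [Measure.add_apply, zeroMeasure_apply _ hA, zeroMeasure_apply _ hA, Measure.dirac_apply' _ hA]
  simp_rw [hord, Nat.cast_add, add_mul]
  rw [ENNReal.tsum_add]
  congr 1
  rw [tsum_eq_single z₀]
  · simp
  · intro z hz; simp [hz]

/-- The zero function must be excluded: its infinite orders are truncated to `0`, so its zero
measure is null. -/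
theorem zeroMeasure_eq_zero_iff {f : ℂ → ℂ} (hf : Differentiable ℂ f) (h0 : f ≠ 0) {A : Set ℂ}
    (hA : MeasurableSet A) : zeroMeasure f A = 0 ↔ ∀ z ∈ A, f z ≠ 0 := by
  rw [zeroMeasure_apply f hA, ENNReal.tsum_eq_zero]
  refine forall_congr' fun z => ?_
  by_cases hz : z ∈ A
  · simp only [hz, Set.indicator_of_mem, Pi.one_apply, mul_one, Nat.cast_eq_zero, true_imp_iff]
    rw [← (hf.analyticAt z).analyticOrderAt_eq_zero,
      ← Nat.cast_analyticOrderNatAt (analyticOrderAt_ne_top_of_entire hf h0 z)]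
    simp
  · simp [hz]

/-- Uniform convergence on every disk centred at the origin. -/
def TendstoOnDisks {ι : Type*} (F : ι → ℂ → ℂ) (f : ℂ → ℂ) (l : Filter ι) : Prop :=
  ∀ R : ℝ, TendstoUniformlyOn F f l (Metric.closedBall 0 R)

theorem TendstoOnDisks.eventually_norm_sub_lt {ι : Type*} {F : ι → ℂ → ℂ} {f : ℂ → ℂ}
    {l : Filter ι} (h : TendstoOnDisks F f l) (R : ℝ) {ε : ℝ} (hε : 0 < ε) :
    ∀ᶠ n in l, ∀ z, ‖z‖ ≤ R → ‖F n z - f z‖ < ε := by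
  filter_upwards [Metric.tendstoUniformlyOn_iff.mp (h R) ε hε] with n hn z hz
  rw [← dist_eq_norm, dist_comm]
  exact hn z (by simpa using hz)

theorem TendstoOnDisks.eventually_ne_zero {ι : Type*} {F : ι → ℂ → ℂ} {f : ℂ → ℂ}
    {l : Filter ι} (h : TendstoOnDisks F f l) (hf : Continuous f) {R : ℝ}
    (h0 : ∀ z, ‖z‖ ≤ R → f z ≠ 0) : ∀ᶠ n in l, ∀ z, ‖z‖ ≤ R → F n z ≠ 0 := by
  rcases (Metric.closedBall (0 : ℂ) R).eq_empty_or_nonempty with he | hne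
  · refine Eventually.of_forall fun n z hz => ?_
    have : z ∈ Metric.closedBall (0 : ℂ) R := by simpa using hz
    simp [he] at this
  obtain ⟨w, hw, hmin⟩ := (isCompact_closedBall (0 : ℂ) R).exists_isMinOn hne
    (hf.norm.continuousOn)
  have hpos : 0 < ‖f w‖ := norm_pos_iff.mpr (h0 w (by simpa using hw))
  filter_upwards [h.eventually_norm_sub_lt R hpos] with n hn z hz h1
  have h2 := hn z hz
  rw [h1, zero_sub, norm_neg] at h2
  exact absurd (hmin (show z ∈ Metric.closedBall (0 : ℂ) R by simpa using hz)) (not_le.mpr h2)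

theorem TendstoOnDisks.eventually_ne {ι : Type*} {F : ι → ℂ → ℂ} {f : ℂ → ℂ}
    {l : Filter ι} (h : TendstoOnDisks F f l) (h0 : f ≠ 0) : ∀ᶠ n in l, F n ≠ 0 := by
  obtain ⟨z, hz⟩ := Function.ne_iff.mp h0
  filter_upwards [h.eventually_norm_sub_lt ‖z‖ (norm_pos_iff.mpr hz)] with n hn h1
  have := hn z le_rfl
  simp [h1] at this

/-- Without a zero in the disk, `1/F` would be holomorphic there and the maximum principle would
give `|1/F(z₀)| ≤ 1/δ`. -/
theorem exists_zero_of_norm_lt_sphere {F : ℂ → ℂ} (hF : Differentiable ℂ F) {z₀ : ℂ} {r δ : ℝ}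
    (hr : 0 < r) (h1 : ∀ z ∈ Metric.sphere z₀ r, δ ≤ ‖F z‖) (h2 : ‖F z₀‖ < δ) :
    ∃ z ∈ Metric.closedBall z₀ r, F z = 0 := by
  by_contra! hcon
  have hδ : 0 < δ := (norm_nonneg _).trans_lt h2
  have hd : DiffContOnCl ℂ (fun z => (F z)⁻¹) (Metric.ball z₀ r) := by
    apply DifferentiableOn.diffContOnCl
    rw [closure_ball z₀ hr.ne']
    exact hF.differentiableOn.inv hcon
  have := Complex.norm_le_of_forall_mem_frontier_norm_le Metric.isBounded_ball hd (C := δ⁻¹)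
    (fun z hz => by
      rw [frontier_ball z₀ hr.ne'] at hz
      rw [norm_inv]
      exact inv_anti₀ hδ (h1 z hz)) (subset_closure (Metric.mem_ball_self hr))
  rw [norm_inv] at this
  have hpos : 0 < ‖F z₀‖ := norm_pos_iff.mpr (hcon z₀ (Metric.mem_closedBall_self hr.le))
  exact absurd ((inv_le_inv₀ hpos hδ).mp this) (not_le.mpr h2)

theorem exists_small_circle_ne_zero {f : ℂ → ℂ} (hf : Differentiable ℂ f) (h0 : f ≠ 0) (z₀ : ℂ)
    {ε : ℝ} (hε : 0 < ε) : ∃ r, 0 < r ∧ r < ε ∧ ∀ z ∈ Metric.sphere z₀ r, f z ≠ 0 := by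
  rcases (hf.analyticAt z₀).eventually_eq_zero_or_eventually_ne_zero with h | h
  · exact absurd (analyticOrderAt_eq_top.mpr h) (analyticOrderAt_ne_top_of_entire hf h0 z₀)
  · obtain ⟨s, hs, hs'⟩ := Metric.eventually_nhds_iff.mp (eventually_nhdsWithin_iff.mp h)
    have hp : 0 < min s ε / 2 := by positivity
    refine ⟨min s ε / 2, hp, ?_, fun z hz => ?_⟩
    · linarith [min_le_right s ε]
    · rw [Metric.mem_sphere] at hz
      refine hs' ?_ ?_
      · rw [hz]; linarith [min_le_left s ε]
      · rintro rfl
        simp at hz; linarith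

/-- Zeros of a limit attract zeros of the approximating functions. -/
theorem TendstoOnDisks.exists_zeros {ι : Type*} {F : ι → ℂ → ℂ} {f : ℂ → ℂ} {l : Filter ι}
    (h : TendstoOnDisks F f l) (hF : ∀ n, Differentiable ℂ (F n)) (hf : Differentiable ℂ f)
    (h0 : f ≠ 0) {z₀ : ℂ} (hz₀ : f z₀ = 0) :
    ∃ z : ι → ℂ, Tendsto z l (𝓝 z₀) ∧ ∀ᶠ n in l, F n (z n) = 0 := by
  -- On a small circle `|f|` has a positive minimum. Once `F n` is within half of it, `|F n|` is at
  -- least that half on the circle and smaller at the centre, where `f` vanishes.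
  have key : ∀ ε > 0, ∀ᶠ n in l, ∃ z ∈ Metric.ball z₀ ε, F n z = 0 := by
    intro ε hε
    obtain ⟨r, hr, hrε, hsph⟩ := exists_small_circle_ne_zero hf h0 z₀ hε
    obtain ⟨w, hw, hmin⟩ := (isCompact_sphere z₀ r).exists_isMinOn
      (NormedSpace.sphere_nonempty.mpr hr.le) hf.continuous.norm.continuousOn
    have hpos : 0 < ‖f w‖ := norm_pos_iff.mpr (hsph w hw)
    filter_upwards [h.eventually_norm_sub_lt (‖z₀‖ + r) (half_pos hpos)] with n hn
    obtain ⟨z, hz, hz0⟩ := exists_zero_of_norm_lt_sphere (hF n) hr (z₀ := z₀) (δ := ‖f w‖ / 2)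
      (fun z hz => by
        have h1 : ‖z‖ ≤ ‖z₀‖ + r := by
          have : ‖z - z₀‖ = r := by simpa [dist_eq_norm] using hz
          linarith [norm_le_norm_add_norm_sub' z z₀]
        have h2 := hn z h1
        have h3 : ‖f w‖ ≤ ‖f z‖ := hmin hz
        have h4 := norm_sub_norm_le (f z) (F n z)
        rw [norm_sub_rev] at h4
        linarith)
      (by simpa [hz₀] using hn z₀ (by linarith))
    exact ⟨z, Metric.closedBall_subset_ball hrε hz, hz0⟩
  -- Taking the zero nearest to `z₀` produces a single family that works for all `ε` at once.
  have hsel : ∀ n, ∃ z, (∃ y, F n y = 0) → F n z = 0 ∧ Metric.infDist z₀ {y | F n y = 0}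
      = dist z₀ z := by
    intro n
    by_cases hex : ∃ y, F n y = 0
    · obtain ⟨z, hz, hd⟩ := (isClosed_eq (hF n).continuous continuous_const :
        IsClosed {y | F n y = 0}).exists_infDist_eq_dist hex z₀
      exact ⟨z, fun _ => ⟨hz, hd⟩⟩
    · exact ⟨0, fun h => absurd h hex⟩
  choose z hz using hsel
  refine ⟨z, Metric.tendsto_nhds.mpr fun ε hε => ?_, ?_⟩
  · filter_upwards [key ε hε] with n hn
    obtain ⟨y, hy, hy0⟩ := hn
    have h1 := (hz n ⟨y, hy0⟩).2
    rw [dist_comm, ← h1]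
    refine (Metric.infDist_le_dist_of_mem (show y ∈ {y | F n y = 0} from hy0)).trans_lt ?_
    rw [dist_comm]; exact hy
  · filter_upwards [key 1 one_pos] with n hn
    obtain ⟨y, _, hy0⟩ := hn
    exact (hz n ⟨y, hy0⟩).1

/-! ### Dividing out one zero, and Hurwitz's theorem -/

theorem differentiable_dslope {f : ℂ → ℂ} (hf : Differentiable ℂ f) (c : ℂ) :
    Differentiable ℂ (dslope f c) :=
  differentiableOn_univ.mp ((Complex.differentiableOn_dslope univ_mem).mpr hf.differentiableOn)

theorem linear_mul_dslope {f : ℂ → ℂ} {c : ℂ} (hc : f c = 0) :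
    f = fun z => (z - c) * dslope f c z := by
  ext z
  have := sub_smul_dslope f c z
  rw [smul_eq_mul, hc, sub_zero] at this
  exact this.symm

/-- Division by a convergent linear factor preserves convergence on disks. -/
theorem TendstoOnDisks.dslope {ι : Type*} {F : ι → ℂ → ℂ} {f : ℂ → ℂ} {l : Filter ι}
    (h : TendstoOnDisks F f l) (hF : ∀ n, Differentiable ℂ (F n)) (hf : Differentiable ℂ f)
    {z : ι → ℂ} {z₀ : ℂ} (hz : Tendsto z l (𝓝 z₀)) (hz₀ : f z₀ = 0)
    (hz0 : ∀ᶠ n in l, F n (z n) = 0) :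
    TendstoOnDisks (fun n => dslope (F n) (z n)) (dslope f z₀) l := by
  intro R
  -- Since `z n` ends up within `1` of `z₀`, the circle of radius `R'` stays at distance at least
  -- `1` from it, so division by `w - z n` does not enlarge the error there.
  set R' := max R 0 + ‖z₀‖ + 2 with hR'
  have hR'0 : 0 < R' := by positivity
  have hRR : R ≤ R' := by linarith [le_max_left R 0, norm_nonneg z₀]
  obtain ⟨B, hB⟩ : ∃ B, ∀ w ∈ Metric.closedBall (0 : ℂ) R', ‖_root_.dslope f z₀ w‖ ≤ B :=
    (isCompact_closedBall (0 : ℂ) R').exists_bound_of_continuousOn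
      (differentiable_dslope hf z₀).continuous.continuousOn
  have hB0 : 0 ≤ B := (norm_nonneg _).trans (hB 0 (by simp [hR'0.le]))
  rw [Metric.tendstoUniformlyOn_iff]
  intro ε hε
  -- The displacement of the zero then costs at most `B/(B+1)` times `ε/2`, which keeps the total
  -- strictly below `ε`.
  have hη : 0 < min 1 (ε / (2 * (B + 1))) := by positivity
  filter_upwards [hz0, h.eventually_norm_sub_lt R' (half_pos hε),
    Metric.tendsto_nhds.mp hz _ hη] with n hn0 hn hzn w hw
  rw [dist_eq_norm] at hzn
  have hzn1 : ‖z n - z₀‖ < 1 := hzn.trans_le (min_le_left _ _)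
  have hzn2 : ‖z n - z₀‖ < ε / (2 * (B + 1)) := hzn.trans_le (min_le_right _ _)
  have hd : Differentiable ℂ (fun w => _root_.dslope f z₀ w - _root_.dslope (F n) (z n) w) :=
    (differentiable_dslope hf z₀).sub (differentiable_dslope (hF n) (z n))
  have hbound : ∀ w ∈ frontier (Metric.ball (0 : ℂ) R'),
      ‖_root_.dslope f z₀ w - _root_.dslope (F n) (z n) w‖ ≤ ε / 2 + (B + 1)⁻¹ * B * (ε / 2) := by
    intro w hw
    rw [frontier_ball _ hR'0.ne'] at hw
    have hwn : ‖w‖ = R' := by simpa using hw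
    have hge : 1 ≤ ‖w - z n‖ := by
      have h1 := norm_sub_norm_le w (z n)
      have h2 : ‖z n‖ ≤ ‖z₀‖ + 1 := by linarith [norm_le_norm_add_norm_sub' (z n) z₀]
      have h3 : 0 ≤ max R 0 := le_max_right _ _
      linarith
    have e1 := congrFun (linear_mul_dslope hz₀) w
    have e2 := congrFun (linear_mul_dslope hn0) w
    have e3 : (w - z n) * (_root_.dslope f z₀ w - _root_.dslope (F n) (z n) w)
        = (f w - F n w) + (z₀ - z n) * _root_.dslope f z₀ w := by
      linear_combination -e1 + e2
    have e4 : ‖_root_.dslope f z₀ w - _root_.dslope (F n) (z n) w‖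
        ≤ ‖(w - z n) * (_root_.dslope f z₀ w - _root_.dslope (F n) (z n) w)‖ := by
      rw [norm_mul]; exact le_mul_of_one_le_left (norm_nonneg _) hge
    refine e4.trans ?_
    rw [e3]
    refine (norm_add_le _ _).trans ?_
    rw [norm_mul]
    have e5 : ‖f w - F n w‖ ≤ ε / 2 := by
      rw [norm_sub_rev]; exact (hn w hwn.le).le
    have e6 : ‖_root_.dslope f z₀ w‖ ≤ B := hB w (by simp [hwn])
    have e7 : ‖z₀ - z n‖ * ‖_root_.dslope f z₀ w‖ ≤ ε / (2 * (B + 1)) * B := by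
      rw [norm_sub_rev]; gcongr
    have e8 : ε / (2 * (B + 1)) * B = (B + 1)⁻¹ * B * (ε / 2) := by field_simp
    linarith
  -- The difference of the quotients is entire, so the estimate passes from the circle to the disk,
  -- including the neighbourhood of the removed zeros.
  have hle := Complex.norm_le_of_forall_mem_frontier_norm_le Metric.isBounded_ball
    hd.diffContOnCl hbound (z := w) (by
      rw [closure_ball _ hR'0.ne']
      exact Metric.closedBall_subset_closedBall hRR hw)
  rw [dist_eq_norm]
  refine hle.trans_lt ?_
  have : (B + 1)⁻¹ * B < 1 := by
    rw [inv_mul_lt_iff₀ (by linarith)]; linarith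
  nlinarith

theorem integral_eq_zero_of_ne_zero {f : ℂ → ℂ} (hf : Differentiable ℂ f) (h0 : f ≠ 0) {R : ℝ}
    (hR : ∀ z, ‖z‖ ≤ R → f z ≠ 0) {χ : ℂ → ℝ} (hχ : ∀ z, R < ‖z‖ → χ z = 0) :
    ∫ z, χ z ∂(zeroMeasure f) = 0 := by
  apply integral_eq_zero_of_ae
  have h1 : zeroMeasure f (Metric.closedBall 0 R) = 0 :=
    (zeroMeasure_eq_zero_iff hf h0 Metric.isClosed_closedBall.measurableSet).mpr
      fun z hz => hR z (by simpa using hz)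
  filter_upwards [compl_mem_ae_iff.mpr h1] with z hz
  exact hχ z (by simpa using hz)

theorem integral_zeroMeasure_of_zero {f : ℂ → ℂ} (hf : Differentiable ℂ f) (h0 : f ≠ 0) {c : ℂ}
    (hc : f c = 0) {χ : ℂ → ℝ} (hχ : Continuous χ) (hχc : HasCompactSupport χ) :
    ∫ z, χ z ∂(zeroMeasure f) = χ c + ∫ z, χ z ∂(zeroMeasure (dslope f c)) := by
  have hd := differentiable_dslope hf c
  have hd0 : dslope f c ≠ 0 := by
    intro h
    apply h0
    rw [linear_mul_dslope hc, h]
    ext z; simp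
  have hm := zeroMeasure_linear_mul hd hd0 c
  rw [← linear_mul_dslope hc] at hm
  have := isLocallyFiniteMeasure_zeroMeasure hd
  rw [hm, integral_add_measure (hχ.integrable_of_hasCompactSupport hχc)
    (hχ.integrable_of_hasCompactSupport hχc), integral_dirac]

/-- **Hurwitz's theorem**: the zeros depend continuously on the function. -/
theorem TendstoOnDisks.tendsto_integral_zeroMeasure {ι : Type*} {F : ι → ℂ → ℂ} {f : ℂ → ℂ}
    {l : Filter ι} (h : TendstoOnDisks F f l) (hF : ∀ n, Differentiable ℂ (F n))
    (hf : Differentiable ℂ f) (h0 : f ≠ 0) {χ : ℂ → ℝ} (hχ : Continuous χ)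
    (hχc : HasCompactSupport χ) :
    Tendsto (fun n => ∫ z, χ z ∂(zeroMeasure (F n))) l (𝓝 (∫ z, χ z ∂(zeroMeasure f))) := by
  obtain ⟨R, hR⟩ := hχc.isCompact.isBounded.subset_closedBall (0 : ℂ)
  have hχR : ∀ z, R < ‖z‖ → χ z = 0 := by
    intro z hz
    by_contra hne
    have := hR (subset_tsupport χ hne)
    simp at this
    linarith
  have := isLocallyFiniteMeasure_zeroMeasure hf
  have hfin : zeroMeasure f (Metric.closedBall 0 R) < ⊤ :=
    (isCompact_closedBall 0 R).measure_lt_top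
  obtain ⟨m, hm⟩ := (isPointMeasure_zeroMeasure hf).2 _
    (Metric.isClosed_closedBall (x := (0 : ℂ)) (ε := R)).measurableSet
  induction m using ENat.recTopCoe with
  | top => simp [hm] at hfin
  | coe M =>
  simp only [ENat.toENNReal_coe] at hm
  clear hfin this
  -- Induction on the number of zeros of the limit in the disk supporting the test function: a zero
  -- `c` of `f` and a zero `z n → c` of `F n` are divided out simultaneously, contributing `χ (z n)
  -- → χ c`.
  induction M generalizing F f with
  | zero =>
    have hne : ∀ z, ‖z‖ ≤ R → f z ≠ 0 := fun z hz =>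
      (zeroMeasure_eq_zero_iff hf h0 Metric.isClosed_closedBall.measurableSet).mp
        (by simpa using hm) z (by simpa using hz)
    rw [integral_eq_zero_of_ne_zero hf h0 hne hχR]
    refine tendsto_const_nhds.congr' ?_
    filter_upwards [h.eventually_ne_zero hf.continuous hne, h.eventually_ne h0] with n hn hn0
    rw [integral_eq_zero_of_ne_zero (hF n) hn0 hn hχR]
  | succ M ih =>
    obtain ⟨c, hc, hfc⟩ : ∃ z ∈ Metric.closedBall (0 : ℂ) R, f z = 0 := by
      by_contra! hcon
      have := (zeroMeasure_eq_zero_iff hf h0 Metric.isClosed_closedBall.measurableSet).mpr hcon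
      rw [this] at hm
      exact absurd hm.symm (by simp)
    obtain ⟨z, hz, hz0⟩ := h.exists_zeros hF hf h0 hfc
    have hd0 : _root_.dslope f c ≠ 0 := by
      intro h'
      apply h0
      rw [linear_mul_dslope hfc, h']
      ext z; simp
    have hmd := zeroMeasure_linear_mul (differentiable_dslope hf c) hd0 c
    rw [← linear_mul_dslope hfc] at hmd
    have hM : zeroMeasure (_root_.dslope f c) (Metric.closedBall 0 R) = M := by
      have h2 := congrArg (fun ρ => ρ (Metric.closedBall 0 R)) hmd
      simp only [Measure.add_apply, hm, Measure.dirac_apply' _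
        Metric.isClosed_closedBall.measurableSet, Set.indicator_of_mem hc, Pi.one_apply] at h2
      rw [Nat.cast_succ, add_comm] at h2
      exact ((ENNReal.add_right_inj ENNReal.one_ne_top).mp h2).symm
    have hlim := ih (h.dslope hF hf hz hfc hz0) (fun n => differentiable_dslope (hF n) (z n))
      (differentiable_dslope hf c) hd0 hM
    rw [integral_zeroMeasure_of_zero hf h0 hfc hχ hχc]
    refine (((hχ.tendsto c).comp hz).add hlim).congr' ?_
    filter_upwards [hz0, h.eventually_ne h0] with n hn hn0
    rw [integral_zeroMeasure_of_zero (hF n) hn0 hn hχ hχc]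
    rfl

/-- The smallest modulus of a zero. -/
def minZeroModulus (f : ℂ → ℂ) : ℝ := sInf ((fun z : ℂ => ‖z‖) '' {z | f z = 0})

theorem minZeroModulus_le {f : ℂ → ℂ} {z : ℂ} (hz : f z = 0) : minZeroModulus f ≤ ‖z‖ :=
  csInf_le ⟨0, by rintro _ ⟨w, _, rfl⟩; exact norm_nonneg w⟩ ⟨z, hz, rfl⟩

theorem exists_minZeroModulus_eq {f : ℂ → ℂ} (hf : Continuous f) (hz : ∃ z, f z = 0) :
    ∃ z, f z = 0 ∧ minZeroModulus f = ‖z‖ := by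
  obtain ⟨z, hz0, hd⟩ := (isClosed_eq hf continuous_const :
    IsClosed {y | f y = 0}).exists_infDist_eq_dist hz 0
  refine ⟨z, hz0, le_antisymm (minZeroModulus_le hz0) (le_csInf ⟨_, z, hz0, rfl⟩ ?_)⟩
  rintro _ ⟨w, hw, rfl⟩
  have := Metric.infDist_le_dist_of_mem (x := (0 : ℂ)) (show w ∈ {y | f y = 0} from hw)
  rw [hd] at this
  simpa using this

theorem minZeroModulus_pos {f : ℂ → ℂ} (hf : Continuous f) (hz : ∃ z, f z = 0) (h0 : f 0 ≠ 0) :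
    0 < minZeroModulus f := by
  obtain ⟨z, hz0, hd⟩ := exists_minZeroModulus_eq hf hz
  rw [hd, norm_pos_iff]
  rintro rfl
  exact h0 hz0

/-- A smaller disk free of zeros of `f` is eventually free of zeros of `F n`, and a zero of `f` of
least modulus attracts zeros of `F n`. The latter also keeps the infimum over a nonempty set; an
empty one would give `0`. -/
theorem TendstoOnDisks.tendsto_minZeroModulus {ι : Type*} {F : ι → ℂ → ℂ} {f : ℂ → ℂ}
    {l : Filter ι} (h : TendstoOnDisks F f l) (hF : ∀ n, Differentiable ℂ (F n))
    (hf : Differentiable ℂ f) (h0 : f ≠ 0) (hz : ∃ z, f z = 0) :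
    Tendsto (fun n => minZeroModulus (F n)) l (𝓝 (minZeroModulus f)) := by
  obtain ⟨z₀, hz₀, hmin⟩ := exists_minZeroModulus_eq hf.continuous hz
  obtain ⟨z, hzlim, hz0⟩ := h.exists_zeros hF hf h0 hz₀
  rw [tendsto_order]
  constructor
  · intro ρ hρ
    obtain ⟨ρ', h1, h2⟩ := exists_between hρ
    have hne : ∀ w, ‖w‖ ≤ ρ' → f w ≠ 0 := fun w hw hfw =>
      absurd (minZeroModulus_le hfw) (not_le.mpr (hw.trans_lt h2))
    filter_upwards [h.eventually_ne_zero hf.continuous hne, hz0] with n hn hn0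
    refine h1.trans_le (le_csInf ⟨_, z n, hn0, rfl⟩ ?_)
    rintro _ ⟨w, hw, rfl⟩
    by_contra! hlt
    exact hn w hlt.le hw
  · intro ρ hρ
    rw [hmin] at hρ
    filter_upwards [hz0, hzlim.norm.eventually (gt_mem_nhds hρ)] with n hn hlt
    exact (minZeroModulus_le hn).trans_lt hlt

/-- The zeros of a product of linear factors. -/
theorem zeroMeasure_multiset_prod (s : Multiset ℂ) {c : ℂ} (hc : c ≠ 0) :
    zeroMeasure (fun z => c * (s.map fun w => z - w).prod) = multisetMeasure s := by
  have hdiff : ∀ t : Multiset ℂ, Differentiable ℂ (fun z => c * (t.map fun w => z - w).prod) ∧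
      (fun z => c * (t.map fun w => z - w).prod) ≠ 0 := by
    intro t
    induction t using Multiset.induction with
    | empty =>
      refine ⟨by simp, fun h => hc ?_⟩
      simpa using congrFun h 0
    | cons a t ih =>
      have e : (fun z => c * ((a ::ₘ t).map fun w => z - w).prod)
          = fun z => (z - a) * (c * (t.map fun w => z - w).prod) := by
        ext z; simp; ring
      rw [e]
      refine ⟨(differentiable_id.sub_const a).mul ih.1, fun h => ?_⟩
      have h2 : (fun z => c * (t.map fun w => z - w).prod) =ᶠ[𝓝[≠] a] 0 := by
        filter_upwards [self_mem_nhdsWithin] with z hz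
        have := congrFun h z
        simp only [Pi.zero_apply] at this ⊢
        exact (mul_eq_zero.mp this).resolve_left (sub_ne_zero.mpr hz)
      apply ih.2
      have := AnalyticOnNhd.eqOn_zero_of_preconnected_of_frequently_eq_zero
        (fun z _ => ih.1.analyticAt z) isPreconnected_univ (Set.mem_univ a) h2.frequently
      ext z; exact this (Set.mem_univ z)
  induction s using Multiset.induction with
  | empty =>
    simp only [Multiset.map_zero, Multiset.prod_zero, mul_one, multisetMeasure, Multiset.sum_zero]
    have h1 := (zeroMeasure_eq_zero_iff (f := fun _ => c) (by fun_prop)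
      (fun h => hc (congrFun h 0)) MeasurableSet.univ).mpr (fun _ _ => hc)
    exact Measure.measure_univ_eq_zero.mp h1
  | cons a s ih =>
    have e : (fun z => c * ((a ::ₘ s).map fun w => z - w).prod)
        = fun z => (z - a) * (c * (s.map fun w => z - w).prod) := by
      ext z; simp; ring
    rw [e, zeroMeasure_linear_mul (hdiff s).1 (hdiff s).2, ih]
    simp [multisetMeasure]


/-! ### The vague topology -/

theorem PointConfig.isInducing_integral (X : Type*) [TopologicalSpace X] [MeasurableSpace X] :
    IsInducing (fun (P : PointConfig X) (f : CompactlySupportedContinuousMap X ℝ) =>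
      ∫ x, f x ∂P.1) := ⟨rfl⟩

theorem PointConfig.tendsto_iff {X ι : Type*} [TopologicalSpace X] [MeasurableSpace X]
    {l : Filter ι} {P : ι → PointConfig X} {Q : PointConfig X} :
    Tendsto P l (𝓝 Q) ↔ ∀ f : CompactlySupportedContinuousMap X ℝ,
      Tendsto (fun i => ∫ x, f x ∂(P i).1) l (𝓝 (∫ x, f x ∂Q.1)) := by
  rw [(PointConfig.isInducing_integral X).tendsto_nhds_iff, tendsto_pi_nhds]
  rfl

theorem PointConfig.continuous_integral {X : Type*} [TopologicalSpace X] [MeasurableSpace X]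
    (f : CompactlySupportedContinuousMap X ℝ) :
    Continuous (fun P : PointConfig X => ∫ x, f x ∂P.1) :=
  continuous_iff_continuousAt.mpr fun _ => (PointConfig.tendsto_iff.mp tendsto_id) f

theorem PointConfig.continuous_of_integral {X Y : Type*} [TopologicalSpace X] [MeasurableSpace X]
    [TopologicalSpace Y] {T : Y → PointConfig X}
    (h : ∀ f : CompactlySupportedContinuousMap X ℝ, Continuous (fun y => ∫ x, f x ∂(T y).1)) :
    Continuous T :=
  continuous_iff_continuousAt.mpr fun _ =>
    PointConfig.tendsto_iff.mpr fun f => (h f).continuousAt.tendsto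

theorem PointConfig.integrable (P : PointConfig ℂ) (f : CompactlySupportedContinuousMap ℂ ℝ) :
    Integrable f P.1 := by
  have := P.2.1
  exact f.continuous.integrable_of_hasCompactSupport f.hasCompactSupport

/-- Continuous functions vanishing outside a disk. -/
def diskFunctions (m : ℕ) : Set C(ℂ, ℝ) := {f | ∀ z, (m : ℝ) < ‖z‖ → f z = 0}

theorem zero_mem_diskFunctions (m : ℕ) : (0 : C(ℂ, ℝ)) ∈ diskFunctions m := fun _ _ => rfl

instance (m : ℕ) : Nonempty (diskFunctions m) := ⟨⟨0, zero_mem_diskFunctions m⟩⟩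

theorem hasCompactSupport_of_norm {f : ℂ → ℝ} {R : ℝ} (h : ∀ z, R < ‖z‖ → f z = 0) :
    HasCompactSupport f :=
  HasCompactSupport.intro (isCompact_closedBall (0 : ℂ) R) fun z hz => h z (by simpa using hz)

/-- A continuous function vanishing outside a disk, as a compactly supported function. -/
def diskFunctions.toCompactlySupported {m : ℕ} (f : diskFunctions m) :
    CompactlySupportedContinuousMap ℂ ℝ where
  toContinuousMap := f.1
  hasCompactSupport' := hasCompactSupport_of_norm (R := m) fun z hz => f.2 z hz

/-- A cutoff function equal to one on a disk. -/
def diskCutoff (m : ℕ) : CompactlySupportedContinuousMap ℂ ℝ where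
  toFun z := max 0 (min 1 ((m : ℝ) + 1 - ‖z‖))
  continuous_toFun := by fun_prop
  hasCompactSupport' := hasCompactSupport_of_norm (R := (m : ℝ) + 1) fun z hz => by
    apply max_eq_left
    exact (min_le_right _ _).trans (by linarith)

theorem diskCutoff_nonneg (m : ℕ) (z : ℂ) : 0 ≤ diskCutoff m z := le_max_left _ _

theorem diskCutoff_eq_one {m : ℕ} {z : ℂ} (hz : ‖z‖ ≤ m) : diskCutoff m z = 1 := by
  change max 0 (min 1 ((m : ℝ) + 1 - ‖z‖)) = 1
  rw [min_eq_left (by linarith)]; simp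

/-- A countable family of test functions generating the vague topology. -/
def vagueTestFamily : (ℕ × ℕ) ⊕ ℕ → CompactlySupportedContinuousMap ℂ ℝ :=
  Sum.elim (fun p => diskFunctions.toCompactlySupported
      (TopologicalSpace.denseSeq (diskFunctions p.1) p.2))
    diskCutoff

/-- Continuous functions supported in a fixed disk form a separable space. The radius `m` is chosen
before `δ`, so the mass measured by the cutoff stays fixed as `δ` shrinks. -/
theorem exists_vagueTestFamily_close (f : CompactlySupportedContinuousMap ℂ ℝ) :
    ∃ m : ℕ, ∀ δ > 0, ∃ i : ℕ, ∀ z,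
      |f z - vagueTestFamily (Sum.inl (m, i)) z| ≤ δ * diskCutoff m z := by
  obtain ⟨R, hR⟩ := f.hasCompactSupport.isCompact.isBounded.subset_closedBall (0 : ℂ)
  obtain ⟨m, hm⟩ := exists_nat_ge R
  have hfm : f.toContinuousMap ∈ diskFunctions m := by
    intro z hz
    by_contra hne
    have := hR (subset_tsupport _ hne)
    simp at this
    linarith
  refine ⟨m, fun δ hδ => ?_⟩
  have h1 := ContinuousMap.tendsto_iff_forall_isCompact_tendstoUniformlyOn.mp
    (tendsto_id (x := 𝓝 f.toContinuousMap)) (Metric.closedBall 0 m) (isCompact_closedBall _ _)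
  have h2 := Metric.tendstoUniformlyOn_iff.mp h1 δ hδ
  have h3 := (continuous_subtype_val (p := (· ∈ diskFunctions m))).continuousAt
    (x := ⟨f.toContinuousMap, hfm⟩) |>.eventually h2
  obtain ⟨i, hi⟩ := (TopologicalSpace.denseRange_denseSeq (diskFunctions m)).mem_nhds h3
  refine ⟨i, fun z => ?_⟩
  rcases le_or_gt ‖z‖ m with hz | hz
  · rw [diskCutoff_eq_one hz, mul_one]
    exact (hi z (by simpa using hz)).le
  · have e1 : f z = 0 := hfm z hz
    have e2 : vagueTestFamily (Sum.inl (m, i)) z = 0 :=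
      (TopologicalSpace.denseSeq (diskFunctions m) i).2 z hz
    rw [e1, e2]
    simpa using mul_nonneg hδ.le (diskCutoff_nonneg m z)

/-- Countably many test integrals already generate the vague topology, which is therefore
pseudometrizable. This is needed for almost everywhere limits of measurable random configurations to
be measurable. -/
theorem isInducing_vagueTestFamily :
    IsInducing (fun (P : PointConfig ℂ) (i : (ℕ × ℕ) ⊕ ℕ) => ∫ x, vagueTestFamily i x ∂P.1) := by
  rw [isInducing_iff_nhds]
  intro P
  apply le_antisymm
  · rw [← tendsto_iff_comap, tendsto_pi_nhds]
    exact fun i => (PointConfig.continuous_integral (X := ℂ) (vagueTestFamily i)).continuousAt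
  · have hL := tendsto_pi_nhds.mp (tendsto_comap (x := 𝓝 fun i => ∫ x, vagueTestFamily i x ∂P.1)
      (f := fun (P : PointConfig ℂ) (i : (ℕ × ℕ) ⊕ ℕ) => ∫ x, vagueTestFamily i x ∂P.1))
    refine tendsto_id'.mp ((PointConfig.tendsto_iff (X := ℂ) (P := id)).mpr fun f => ?_)
    obtain ⟨m, hm⟩ := exists_vagueTestFamily_close f
    have hcut := hL (Sum.inr m)
    rw [Metric.tendsto_nhds]
    intro ε hε
    set A := ∫ x, diskCutoff m x ∂P.1 with hA
    have hA0 : 0 ≤ A := integral_nonneg (diskCutoff_nonneg m)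
    -- Configurations near `P` give the cutoff an integral below `A + 1`, so each of the two
    -- replacements of `f` costs at most `ε/4`.
    have hδ : 0 < ε / (4 * (A + 1)) := by positivity
    obtain ⟨i, hi⟩ := hm _ hδ
    have hclose : ∀ Q : PointConfig ℂ,
        |∫ x, f x ∂Q.1 - ∫ x, vagueTestFamily (Sum.inl (m, i)) x ∂Q.1|
          ≤ ε / (4 * (A + 1)) * ∫ x, diskCutoff m x ∂Q.1 := by
      intro Q
      rw [← integral_sub (Q.integrable _) (Q.integrable _), ← integral_const_mul]
      refine (abs_integral_le_integral_abs).trans (integral_mono_of_nonneg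
        (Eventually.of_forall fun _ => abs_nonneg _) ((Q.integrable _).const_mul _)
        (Eventually.of_forall hi))
    filter_upwards [Metric.tendsto_nhds.mp (hL (Sum.inl (m, i))) (ε / 4) (by positivity),
      hcut.eventually (gt_mem_nhds (show A < A + 1 by linarith))] with Q hQ1 hQ2
    have c1 := hclose Q
    have c2 := hclose P
    have d1 : ε / (4 * (A + 1)) * ∫ x, diskCutoff m x ∂Q.1 ≤ ε / (4 * (A + 1)) * (A + 1) := by
      gcongr; exact hQ2.le
    have d2 : ε / (4 * (A + 1)) * A ≤ ε / (4 * (A + 1)) * (A + 1) := by gcongr; linarith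
    have d3 : ε / (4 * (A + 1)) * (A + 1) = ε / 4 := by field_simp
    rw [Real.dist_eq] at hQ1 ⊢
    rw [abs_le] at c1 c2
    rw [abs_lt] at hQ1 ⊢
    simp only [id] at *
    constructor <;> linarith [c1.1, c1.2, c2.1, c2.2, hQ1.1, hQ1.2]

instance : TopologicalSpace.PseudoMetrizableSpace (PointConfig ℂ) :=
  isInducing_vagueTestFamily.pseudoMetrizableSpace

/-- Extension by zero from the punctured plane. -/
def extendPunctured (f : CompactlySupportedContinuousMap PuncturedPlane ℝ) :
    CompactlySupportedContinuousMap ℂ ℝ where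
  toFun := Function.extend Subtype.val f 0
  continuous_toFun := HasCompactSupport.continuous_extend_zero (U := {z : ℂ | z ≠ 0})
    isOpen_ne f.continuous f.hasCompactSupport
  hasCompactSupport' := f.hasCompactSupport.extend_zero continuous_subtype_val

theorem PointConfig.integral_punctured (P : PointConfig ℂ)
    (f : CompactlySupportedContinuousMap PuncturedPlane ℝ) :
    ∫ x, f x ∂P.punctured.1 = ∫ z, extendPunctured f z ∂P.1 := by
  have hext : ∀ x : PuncturedPlane, f x = extendPunctured f x.1 := fun x =>
    (Subtype.val_injective.extend_apply f 0 x).symm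
  have hm : MeasurableSet {z : ℂ | z ≠ 0} := isOpen_ne.measurableSet
  calc ∫ x, f x ∂P.punctured.1
      = ∫ x : {z : ℂ | z ≠ 0}, extendPunctured f x ∂(P.1.comap Subtype.val) := by
        simp_rw [hext]; rfl
    _ = ∫ z in {z : ℂ | z ≠ 0}, extendPunctured f z ∂P.1 := integral_subtype_comap hm _
    _ = ∫ z, extendPunctured f z ∂P.1 := by
        apply setIntegral_eq_integral_of_forall_compl_eq_zero
        intro z hz
        exact Function.extend_apply' _ _ _ (by rintro ⟨w, rfl⟩; exact hz w.2)

theorem PointConfig.continuous_punctured : Continuous PointConfig.punctured :=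
  PointConfig.continuous_of_integral fun f => by
    simp_rw [PointConfig.integral_punctured]
    exact PointConfig.continuous_integral _

theorem PointConfig.continuous_inverted : Continuous PointConfig.inverted :=
  PointConfig.continuous_of_integral fun f => by
    have h : ∀ P : PointConfig PuncturedPlane, ∫ x, f x ∂P.inverted.1
        = ∫ x, f (PuncturedPlane.inversion x) ∂P.1 := fun P =>
      integral_map PuncturedPlane.inversion.continuous.measurable.aemeasurable
        f.continuous.aestronglyMeasurable
    simp_rw [h]
    exact PointConfig.continuous_integral (X := PuncturedPlane)
      ⟨⟨fun x => f (PuncturedPlane.inversion x),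
        f.continuous.comp PuncturedPlane.inversion.continuous⟩,
        f.hasCompactSupport.comp_homeomorph PuncturedPlane.inversion⟩

/-- Configurations of zeros depend continuously on the function. -/
theorem TendstoOnDisks.tendsto_zeros {ι : Type*} {F : ι → ℂ → ℂ} {f : ℂ → ℂ} {l : Filter ι}
    (h : TendstoOnDisks F f l) (hF : ∀ n, Differentiable ℂ (F n)) (hf : Differentiable ℂ f)
    (h0 : f ≠ 0) : Tendsto (fun n => PointConfig.zeros (F n)) l (𝓝 (PointConfig.zeros f)) := by
  refine PointConfig.tendsto_iff.mpr fun χ => ?_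
  simp only [PointConfig.zeros, hF, hf, dif_pos]
  exact h.tendsto_integral_zeroMeasure hF hf h0 χ.continuous χ.hasCompactSupport

theorem PointConfig.ext {X : Type*} [TopologicalSpace X] [MeasurableSpace X]
    {P Q : PointConfig X} (h : P.1 = Q.1) : P = Q := by
  cases P; cases Q; cases h; rfl


/-! ### Quantile functions -/

/-- The quantile function of a measure on the line. -/
def quantile (m : Measure ℝ) (p : ℝ) : ℝ := sInf {r | p ≤ cdf m r}

section Quantile

variable (m : Measure ℝ)

/-- Right continuity of the distribution function puts the infimum in the set. For `0 < p < 1` that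
set is nonempty and bounded below. -/
theorem quantile_le_iff {p : ℝ} (hp : p ∈ Set.Ioo (0 : ℝ) 1) (r : ℝ) :
    quantile m p ≤ r ↔ p ≤ cdf m r := by
  have hne : {r | p ≤ cdf m r}.Nonempty := by
    obtain ⟨r, hr⟩ := ((tendsto_cdf_atTop m).eventually (lt_mem_nhds hp.2)).exists
    exact ⟨r, hr.le⟩
  have hbdd : BddBelow {r | p ≤ cdf m r} := by
    obtain ⟨r, hr⟩ := ((tendsto_cdf_atBot m).eventually (gt_mem_nhds hp.1)).exists
    refine ⟨r, fun s hs => ?_⟩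
    by_contra! hlt
    exact absurd (hs.trans (monotone_cdf m hlt.le)) (not_le.mpr hr)
  refine ⟨fun h => ?_, fun h => csInf_le hbdd h⟩
  have hmem : ∀ s, quantile m p < s → p ≤ cdf m s := by
    intro s hs
    obtain ⟨t, ht, hts⟩ := exists_lt_of_csInf_lt hne hs
    exact (show p ≤ cdf m t from ht).trans (monotone_cdf m hts.le)
  have h1 : Tendsto (cdf m) (𝓝[>] (quantile m p)) (𝓝 (cdf m (quantile m p))) :=
    ((cdf m).right_continuous (quantile m p)).mono Set.Ioi_subset_Ici_self
  have h2 : p ≤ cdf m (quantile m p) :=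
    ge_of_tendsto h1 (by filter_upwards [self_mem_nhdsWithin] with s hs using hmem s hs)
  exact h2.trans (monotone_cdf m h)

theorem monotoneOn_quantile : MonotoneOn (quantile m) (Set.Ioo 0 1) := by
  intro p hp q hq hpq
  rw [quantile_le_iff m hp]
  exact hpq.trans ((quantile_le_iff m hq _).mp le_rfl)

theorem aemeasurable_quantile :
    AEMeasurable (quantile m) (volume.restrict (Set.Ioo 0 1)) :=
  aemeasurable_restrict_of_monotoneOn measurableSet_Ioo (monotoneOn_quantile m)

theorem map_quantile [IsProbabilityMeasure m] :
    (volume.restrict (Set.Ioo (0 : ℝ) 1)).map (quantile m) = m := by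
  refine Measure.ext_of_Iic _ _ fun r => ?_
  rw [Measure.map_apply_of_aemeasurable (aemeasurable_quantile m) measurableSet_Iic,
    Measure.restrict_apply' measurableSet_Ioo, ← ofReal_cdf]
  have h : quantile m ⁻¹' Set.Iic r ∩ Set.Ioo 0 1 = Set.Iic (cdf m r) ∩ Set.Ioo 0 1 := by
    ext p
    simp only [Set.mem_inter_iff, Set.mem_preimage, Set.mem_Iic]
    exact and_congr_left fun hp => quantile_le_iff m hp r
  rw [h]
  have h1 : Set.Ioo 0 (cdf m r) ⊆ Set.Iic (cdf m r) ∩ Set.Ioo 0 1 := fun p hp =>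
    ⟨hp.2.le, hp.1, hp.2.trans_le (cdf_le_one m r)⟩
  have h2 : Set.Iic (cdf m r) ∩ Set.Ioo 0 1 ⊆ Set.Ioc 0 (cdf m r) := fun p hp =>
    ⟨hp.2.1, hp.1⟩
  refine le_antisymm ((measure_mono h2).trans (by simp)) (le_trans (by simp) (measure_mono h1))

theorem integral_quantile [IsProbabilityMeasure m] {g : ℝ → ℝ} (hg : Measurable g) :
    ∫ r, g r ∂m = ∫ p in Set.Ioo (0 : ℝ) 1, g (quantile m p) := by
  conv_lhs => rw [← map_quantile m]
  exact integral_map (aemeasurable_quantile m) hg.aestronglyMeasurable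

theorem quantile_pos [IsProbabilityMeasure m] (h0 : m (Set.Iic 0) = 0) {p : ℝ}
    (hp : p ∈ Set.Ioo (0 : ℝ) 1) : 0 < quantile m p := by
  by_contra! h
  rw [quantile_le_iff m hp, cdf_eq_real, measureReal_def, h0] at h
  simp at h
  exact absurd hp.1 (not_lt.mpr h)

/-- Comparing `Q(p)` with `c p^(1/α)` amounts to comparing `p` with `F(c p^(1/α)) ~ λ c^α p`; the
threshold `λ c^α = 1` is `c = λ^(-1/α)`. -/
theorem tendsto_quantile_div_rpow [IsProbabilityMeasure m] (h0 : m (Set.Iic 0) = 0) {α lam : ℝ}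
    (hα : 0 < α) (hlam : 0 < lam)
    (hF : Tendsto (fun r : ℝ => cdf m r / r ^ α) (𝓝[>] 0) (𝓝 lam)) :
    Tendsto (fun p => quantile m p / p ^ (1 / α)) (𝓝[>] 0) (𝓝 (lam ^ (-(1 / α)))) := by
  have hIoo : ∀ᶠ p in 𝓝[>] (0 : ℝ), p ∈ Set.Ioo (0 : ℝ) 1 := Ioo_mem_nhdsGT one_pos
  have hscale : ∀ c : ℝ, 0 < c →
      Tendsto (fun p : ℝ => cdf m (c * p ^ (1 / α)) / p) (𝓝[>] 0) (𝓝 (lam * c ^ α)) := by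
    intro c hc
    have h1 : Tendsto (fun p : ℝ => c * p ^ (1 / α)) (𝓝[>] 0) (𝓝[>] 0) := by
      refine tendsto_nhdsWithin_iff.mpr ⟨?_, ?_⟩
      · have : Tendsto (fun p : ℝ => c * p ^ (1 / α)) (𝓝 0) (𝓝 (c * 0 ^ (1 / α))) :=
          ((Real.continuousAt_rpow_const 0 (1 / α) (Or.inr (by positivity))).tendsto).const_mul c
        rw [Real.zero_rpow (by positivity), mul_zero] at this
        exact this.mono_left nhdsWithin_le_nhds
      · filter_upwards [self_mem_nhdsWithin] with p hp
        have : (0 : ℝ) < p := hp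
        exact mul_pos hc (Real.rpow_pos_of_pos this _)
    refine ((hF.comp h1).mul_const (c ^ α)).congr' ?_
    filter_upwards [self_mem_nhdsWithin] with p hp
    have hp' : (0 : ℝ) < p := hp
    have : (c * p ^ (1 / α)) ^ α = c ^ α * p := by
      rw [Real.mul_rpow hc.le (by positivity), ← Real.rpow_mul hp'.le, one_div_mul_cancel hα.ne',
        Real.rpow_one]
    have hcα : 0 < c ^ α := by positivity
    simp only [Function.comp_apply, this]
    field_simp
  have hlamα : lam * (lam ^ (-(1 / α))) ^ α = 1 := by
    rw [← Real.rpow_mul hlam.le, neg_mul, one_div_mul_cancel hα.ne', Real.rpow_neg_one,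
      mul_inv_cancel₀ hlam.ne']
  have hbase : 0 < lam ^ (-(1 / α)) := by positivity
  rw [tendsto_order]
  constructor
  · intro c hc
    rcases le_or_gt c 0 with hc0 | hc0
    · filter_upwards [hIoo] with p hp
      exact hc0.trans_lt (div_pos (quantile_pos m h0 hp) (Real.rpow_pos_of_pos hp.1 _))
    · have hlt : lam * c ^ α < 1 := by
        rw [← hlamα]
        exact mul_lt_mul_of_pos_left (Real.rpow_lt_rpow hc0.le hc hα) hlam
      filter_upwards [hIoo, (hscale c hc0).eventually (gt_mem_nhds hlt)] with p hp h1
      rw [div_lt_one hp.1] at h1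
      rw [lt_div_iff₀ (Real.rpow_pos_of_pos hp.1 _)]
      by_contra! hle
      exact absurd ((quantile_le_iff m hp _).mp hle) (not_le.mpr h1)
  · intro c hc
    obtain ⟨c', hc1, hc2⟩ := exists_between hc
    have hc0 : 0 < c' := hbase.trans hc1
    have hgt : 1 < lam * c' ^ α := by
      rw [← hlamα]
      exact mul_lt_mul_of_pos_left (Real.rpow_lt_rpow hbase.le hc1 hα) hlam
    filter_upwards [hIoo, (hscale c' hc0).eventually (lt_mem_nhds hgt)] with p hp h1
    rw [one_lt_div hp.1] at h1
    refine lt_of_le_of_lt ?_ hc2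
    rw [div_le_iff₀ (Real.rpow_pos_of_pos hp.1 _)]
    exact (quantile_le_iff m hp _).mpr h1.le

end Quantile

/-! ### Radial potentials and moments -/

/-- The potential of a radial measure, normalized to vanish at the origin. -/
def radialPotential (m : Measure ℝ) (r : ℝ) : ℝ := ∫ s, Real.posLog (r / s) ∂m

/-- The weighted moments of a radial measure. -/
def radialMoment (m : Measure ℝ) (k n : ℕ) : ℝ :=
  ∫ r, r ^ (2 * k) * Real.exp (-2 * (n : ℝ) * radialPotential m r) ∂m

/-- A measure on the half-line with integrable logarithm. -/
structure IsRadialLaw (m : Measure ℝ) : Prop where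
  isProbabilityMeasure : IsProbabilityMeasure m
  Iic_zero : m (Set.Iic 0) = 0
  integrable_log : Integrable Real.log m

section RadialPotential

variable {m : Measure ℝ}

theorem IsRadialLaw.ae_pos (hm : IsRadialLaw m) : ∀ᵐ s ∂m, 0 < s := by
  filter_upwards [compl_mem_ae_iff.mpr hm.Iic_zero] with s hs
  simpa using hs

theorem IsRadialLaw.integrable_posLog (hm : IsRadialLaw m) {r : ℝ} (hr : 0 < r) :
    Integrable (fun s => Real.posLog (r / s)) m := by
  have := hm.isProbabilityMeasure
  have h1 : Integrable (fun s => |Real.log r - Real.log s|) m :=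
    ((integrable_const _).sub hm.integrable_log).abs
  refine h1.mono' ?_ ?_
  · exact (Real.continuous_posLog.measurable.comp
      (measurable_const.div measurable_id)).aestronglyMeasurable
  · filter_upwards [hm.ae_pos] with s hs
    rw [Real.norm_of_nonneg Real.posLog_nonneg, Real.posLog_apply,
      Real.log_div hr.ne' hs.ne']
    exact max_le (abs_nonneg _) (le_abs_self _)

theorem IsRadialLaw.radialPotential_mono (hm : IsRadialLaw m) {r r' : ℝ} (hr : 0 < r) (hrr : r ≤ r') :
    radialPotential m r ≤ radialPotential m r' := by
  refine integral_mono_ae (hm.integrable_posLog hr) (hm.integrable_posLog (hr.trans_le hrr)) ?_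
  filter_upwards [hm.ae_pos] with s hs
  exact Real.posLog_le_posLog (by positivity) (by gcongr)

/-- Integrating `log ≤ log⁺` bounds `r e^(-U(r))` by a constant; this tames the quantile function
far from the origin. -/
theorem IsRadialLaw.log_le_radialPotential (hm : IsRadialLaw m) {r : ℝ} (hr : 0 < r) :
    Real.log r ≤ radialPotential m r + ∫ s, Real.log s ∂m := by
  have := hm.isProbabilityMeasure
  rw [radialPotential, ← integral_add (hm.integrable_posLog hr) hm.integrable_log]
  have h : ∫ _, Real.log r ∂m = Real.log r := by simp
  rw [← h]
  refine integral_mono_ae (integrable_const _)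
    ((hm.integrable_posLog hr).add hm.integrable_log) ?_
  filter_upwards [hm.ae_pos] with s hs
  have := le_max_right 0 (Real.log (r / s))
  rw [← Real.posLog_apply, Real.log_div hr.ne' hs.ne'] at this
  linarith

theorem radialPotential_nonneg (m : Measure ℝ) (r : ℝ) : 0 ≤ radialPotential m r :=
  integral_nonneg fun _ => Real.posLog_nonneg

theorem measurable_radialPotential (m : Measure ℝ) [SFinite m] :
    Measurable (radialPotential m) := by
  have h : StronglyMeasurable (Function.uncurry fun r s : ℝ => Real.posLog (r / s)) :=
    (Real.continuous_posLog.measurable.comp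
      (measurable_fst.div measurable_snd)).stronglyMeasurable
  exact h.integral_prod_right.measurable

theorem IsRadialLaw.measurable_moment_integrand (hm : IsRadialLaw m) (k n : ℕ) : Measurable
    (fun r : ℝ => r ^ (2 * k) * Real.exp (-2 * (n : ℝ) * radialPotential m r)) := by
  have := hm.isProbabilityMeasure
  have := measurable_radialPotential m
  fun_prop

theorem IsRadialLaw.radialMoment_eq (hm : IsRadialLaw m) (k n : ℕ) :
    radialMoment m k n = ∫ p in Set.Ioo (0 : ℝ) 1, quantile m p ^ (2 * k)
      * Real.exp (-2 * (n : ℝ) * radialPotential m (quantile m p)) := by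
  have := hm.isProbabilityMeasure
  exact integral_quantile m (hm.measurable_moment_integrand k n)

/-- Only `q < p` contributes, because `log⁺(Q(p)/Q(q))` vanishes for `q ≥ p`; then substitute `q =
pt`. -/
theorem IsRadialLaw.radialPotential_quantile (hm : IsRadialLaw m) {p : ℝ} (hp : p ∈ Set.Ioo (0 : ℝ) 1) :
    radialPotential m (quantile m p) / p
      = ∫ t in Set.Ioo (0 : ℝ) 1, Real.posLog (quantile m p / quantile m (p * t)) := by
  have := hm.isProbabilityMeasure
  have hmeas : Measurable fun s : ℝ => Real.posLog (quantile m p / s) :=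
    Real.continuous_posLog.measurable.comp (measurable_const.div measurable_id)
  have h1 : ∫ t in (0 : ℝ)..1, Real.posLog (quantile m p / quantile m (p * t))
      = p⁻¹ * ∫ q in (0 : ℝ)..p, Real.posLog (quantile m p / quantile m q) := by
    have := intervalIntegral.integral_comp_mul_left (a := 0) (b := 1)
      (fun q => Real.posLog (quantile m p / quantile m q)) hp.1.ne'
    simpa using this
  rw [← integral_Ioc_eq_integral_Ioo, ← intervalIntegral.integral_of_le zero_le_one, h1,
    radialPotential, integral_quantile m hmeas, intervalIntegral.integral_of_le hp.1.le,
    div_eq_inv_mul]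
  congr 1
  refine setIntegral_eq_of_subset_of_forall_sdiff_eq_zero measurableSet_Ioo
    (fun q (hq : q ∈ Set.Ioc 0 p) => ⟨hq.1, hq.2.trans_lt hp.2⟩) ?_
  intro q hq
  have hpq : p < q := by
    by_contra! h
    exact hq.2 ⟨hq.1.1, h⟩
  have h2 : quantile m p ≤ quantile m q := monotoneOn_quantile m hp hq.1 hpq.le
  have h3 := quantile_pos m hm.Iic_zero hp
  have h4 := quantile_pos m hm.Iic_zero hq.1
  rw [Real.posLog_eq_zero_iff, abs_of_pos (by positivity)]
  exact (div_le_one h4).mpr h2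

end RadialPotential

/-- Growth conditions satisfied by the quantile function and by the potential along it. -/
structure IsRadialProfile (Q W : ℝ → ℝ) (α lam : ℝ) : Prop where
  monotoneOn_quantile : MonotoneOn Q (Set.Ioo 0 1)
  monotoneOn_potential : MonotoneOn W (Set.Ioo 0 1)
  tendsto_quantile : Tendsto (fun p => Q p / p ^ (1 / α)) (𝓝[>] 0) (𝓝 (lam ^ (-(1 / α))))
  tendsto_potential : Tendsto (fun p => W p / p) (𝓝[>] 0) (𝓝 (1 / α))
  quantile_lower : ∃ c > 0, ∀ p ∈ Set.Ioo (0 : ℝ) 1, c * p ^ (1 / α) ≤ Q p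
  potential_lower : ∃ c > 0, ∀ p ∈ Set.Ioo (0 : ℝ) 1, c * p ≤ W p
  upper : ∃ C > 0, ∀ p ∈ Set.Ioo (0 : ℝ) 1, Q p * Real.exp (-W p) ≤ C * p ^ (1 / α)

/-- For fixed `t` the ratio `Q(p)/Q(pt)` tends to `t^(-1/α)`, whose logarithm has integral `1/α`
over `(0,1)`; dominated convergence does the rest. -/
theorem IsRadialLaw.tendsto_potential_quantile {m : Measure ℝ} (hm : IsRadialLaw m) {α lam : ℝ}
    (hα : 0 < α) (hlam : 0 < lam)
    (hQ : Tendsto (fun p => quantile m p / p ^ (1 / α)) (𝓝[>] 0) (𝓝 (lam ^ (-(1 / α))))) :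
    Tendsto (fun p => radialPotential m (quantile m p) / p) (𝓝[>] 0) (𝓝 (1 / α)) := by
  have := hm.isProbabilityMeasure
  have hIoo : ∀ᶠ p in 𝓝[>] (0 : ℝ), p ∈ Set.Ioo (0 : ℝ) 1 := Ioo_mem_nhdsGT one_pos
  set L := lam ^ (-(1 / α)) with hL
  have hLpos : 0 < L := by positivity
  -- Knowing `Q` up to a factor `2` on each side bounds the ratio by `4 t^(-1/α)`, whence the
  -- dominating function `log 4 + |log t|/α`.
  obtain ⟨p₀, hp₀, hbd⟩ : ∃ p₀ > 0, ∀ p, 0 < p → p < p₀ →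
      p ∈ Set.Ioo (0 : ℝ) 1 ∧ L / 2 * p ^ (1 / α) ≤ quantile m p ∧
        quantile m p ≤ 2 * L * p ^ (1 / α) := by
    have h := (hQ.eventually (lt_mem_nhds (show L / 2 < L by linarith))).and
      ((hQ.eventually (gt_mem_nhds (show L < 2 * L by linarith))).and hIoo)
    obtain ⟨p₀, hp₀, h⟩ := mem_nhdsGT_iff_exists_Ioo_subset.mp h
    refine ⟨p₀, hp₀, fun p h1 h2 => ?_⟩
    obtain ⟨h3, h4, h5⟩ := h ⟨h1, h2⟩
    have hpp := Real.rpow_pos_of_pos h1 (1 / α)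
    exact ⟨h5, ((lt_div_iff₀ hpp).mp h3).le, ((div_lt_iff₀ hpp).mp h4).le⟩
  have hval : ∫ t in Set.Ioo (0 : ℝ) 1, -(1 / α) * Real.log t = 1 / α := by
    rw [integral_const_mul, ← integral_Ioc_eq_integral_Ioo,
      ← intervalIntegral.integral_of_le zero_le_one, integral_log_from_zero_of_pos one_pos]
    simp
  have hlogint : IntegrableOn Real.log (Set.Ioo (0 : ℝ) 1) :=
    (intervalIntegral.intervalIntegrable_log' (a := 0) (b := 1)).1.mono_set Set.Ioo_subset_Ioc_self
  have hmain : Tendsto (fun p => ∫ t in Set.Ioo (0 : ℝ) 1,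
      Real.posLog (quantile m p / quantile m (p * t))) (𝓝[>] 0)
      (𝓝 (∫ t in Set.Ioo (0 : ℝ) 1, -(1 / α) * Real.log t)) := by
    refine tendsto_integral_filter_of_dominated_convergence
      (fun t => Real.log 4 + (1 / α) * |Real.log t|) ?_ ?_ ?_ ?_
    · filter_upwards [hIoo] with p hp
      have h1 : MonotoneOn (fun t => quantile m (p * t)) (Set.Ioo 0 1) := by
        intro s hs t ht hst
        refine monotoneOn_quantile m ⟨mul_pos hp.1 hs.1, ?_⟩ ⟨mul_pos hp.1 ht.1, ?_⟩ ?_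
        · nlinarith [hp.1, hp.2, hs.1, hs.2]
        · nlinarith [hp.1, hp.2, ht.1, ht.2]
        · exact mul_le_mul_of_nonneg_left hst hp.1.le
      have h2 : AEMeasurable (fun t => quantile m (p * t)) (volume.restrict (Set.Ioo 0 1)) :=
        aemeasurable_restrict_of_monotoneOn measurableSet_Ioo h1
      exact (Real.continuous_posLog.measurable.comp_aemeasurable
        (aemeasurable_const.div h2)).aestronglyMeasurable
    · filter_upwards [Ioo_mem_nhdsGT hp₀] with p hp
      refine (ae_restrict_iff' measurableSet_Ioo).mpr (Eventually.of_forall fun t ht => ?_)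
      have hpt : 0 < p * t := mul_pos hp.1 ht.1
      obtain ⟨-, -, a1⟩ := hbd p hp.1 hp.2
      obtain ⟨-, a2, -⟩ := hbd (p * t) hpt (by nlinarith [hp.1, hp.2, ht.1, ht.2])
      have hptr := Real.rpow_pos_of_pos hpt (1 / α)
      have hpr := Real.rpow_pos_of_pos hp.1 (1 / α)
      have htr := Real.rpow_pos_of_pos ht.1 (1 / α)
      have hq0 : 0 < quantile m (p * t) := lt_of_lt_of_le (by positivity) a2
      have hqp : 0 < quantile m p := quantile_pos m hm.Iic_zero (hbd p hp.1 hp.2).1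
      rw [Real.norm_of_nonneg Real.posLog_nonneg, Real.posLog_apply]
      refine max_le (add_nonneg (Real.log_nonneg (by norm_num)) (by positivity)) ?_
      have h4 : quantile m p / quantile m (p * t) ≤ 4 * t ^ (-(1 / α)) := by
        rw [div_le_iff₀ hq0]
        calc quantile m p ≤ 2 * L * p ^ (1 / α) := a1
          _ = 4 * t ^ (-(1 / α)) * (L / 2 * (p * t) ^ (1 / α)) := by
              rw [Real.mul_rpow hp.1.le ht.1.le, Real.rpow_neg ht.1.le]
              field_simp; ring
          _ ≤ _ := mul_le_mul_of_nonneg_left a2 (by have := ht.1; positivity)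
      have h5 := Real.log_le_log (div_pos hqp hq0) h4
      rw [Real.log_mul (by norm_num) (Real.rpow_pos_of_pos ht.1 _).ne', Real.log_rpow ht.1] at h5
      have h6 := mul_le_mul_of_nonneg_left (neg_le_abs (Real.log t)) (show 0 ≤ 1 / α by positivity)
      linarith
    · exact (integrable_const _).add (hlogint.abs.const_mul _)
    · refine (ae_restrict_iff' measurableSet_Ioo).mpr (Eventually.of_forall fun t ht => ?_)
      have htr : 1 ≤ t ^ (-(1 / α)) :=
        Real.one_le_rpow_of_pos_of_le_one_of_nonpos ht.1 ht.2.le (by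
          have : 0 < 1 / α := by positivity
          linarith)
      have hlim : -(1 / α) * Real.log t = Real.posLog (L / L * t ^ (-(1 / α))) := by
        rw [div_self hLpos.ne', one_mul, Real.posLog_eq_log (by rwa [abs_of_pos (by positivity)]),
          Real.log_rpow ht.1]
      rw [hlim]
      refine (Real.continuous_posLog.tendsto _).comp ?_
      have hpt : Tendsto (fun p : ℝ => p * t) (𝓝[>] 0) (𝓝[>] 0) := by
        refine tendsto_nhdsWithin_iff.mpr ⟨?_, ?_⟩
        · have : Tendsto (fun p : ℝ => p * t) (𝓝 0) (𝓝 (0 * t)) := tendsto_id.mul_const t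
          rw [zero_mul] at this
          exact this.mono_left nhdsWithin_le_nhds
        · filter_upwards [self_mem_nhdsWithin] with p hp
          exact mul_pos hp ht.1
      refine ((hQ.div (hQ.comp hpt) hLpos.ne').mul_const (t ^ (-(1 / α)))).congr' ?_
      filter_upwards [self_mem_nhdsWithin] with p hp
      have hp' : (0 : ℝ) < p := hp
      have h1 := Real.rpow_pos_of_pos hp' (1 / α)
      have h2 := Real.rpow_pos_of_pos ht.1 (1 / α)
      simp only [Function.comp_apply, Pi.div_apply]
      rw [Real.mul_rpow hp'.le ht.1.le, Real.rpow_neg ht.1.le]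
      field_simp
  rw [hval] at hmain
  refine hmain.congr' ?_
  filter_upwards [hIoo] with p hp
  exact (hm.radialPotential_quantile hp).symm


/-- The asymptotics give all bounds near `0`. Monotonicity extends the lower bounds to `(0,1)` at
the cost of constants, and `IsRadialLaw.log_le_radialPotential` supplies the upper bound away from
`0`. -/
theorem IsRadialLaw.isRadialProfile {m : Measure ℝ} (hm : IsRadialLaw m) {α lam : ℝ}
    (hα : 0 < α) (hlam : 0 < lam)
    (hF : Tendsto (fun r : ℝ => cdf m r / r ^ α) (𝓝[>] 0) (𝓝 lam)) :
    IsRadialProfile (quantile m) (fun p => radialPotential m (quantile m p)) α lam := by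
  have := hm.isProbabilityMeasure
  have hQ := tendsto_quantile_div_rpow m hm.Iic_zero hα hlam hF
  have hW := hm.tendsto_potential_quantile hα hlam hQ
  have hL : 0 < lam ^ (-(1 / α)) := by positivity
  have hα' : 0 < 1 / α := by positivity
  obtain ⟨p₀, ⟨hp₀, hp₁⟩, hbd⟩ : ∃ p₀ ∈ Set.Ioo (0 : ℝ) 1, ∀ p, 0 < p → p ≤ p₀ →
      lam ^ (-(1 / α)) / 2 * p ^ (1 / α) ≤ quantile m p ∧
      quantile m p ≤ 2 * lam ^ (-(1 / α)) * p ^ (1 / α) ∧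
      1 / α / 2 * p ≤ radialPotential m (quantile m p) := by
    have h := (hQ.eventually (lt_mem_nhds (half_lt_self hL))).and
      ((hQ.eventually (gt_mem_nhds (show lam ^ (-(1 / α)) < 2 * lam ^ (-(1 / α)) by linarith))).and
        (hW.eventually (lt_mem_nhds (half_lt_self hα'))))
    obtain ⟨p₁, hp₁, h⟩ := mem_nhdsGT_iff_exists_Ioo_subset.mp h
    have hp₁' : (0 : ℝ) < p₁ := hp₁
    refine ⟨min p₁ 1 / 2, ⟨by positivity, ?_⟩, fun p h1 h2 => ?_⟩
    · linarith [min_le_right p₁ 1]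
    obtain ⟨h3, h4, h5⟩ := h ⟨h1, show p < p₁ by
      have : 0 < min p₁ 1 := by positivity
      linarith [min_le_left p₁ 1]⟩
    have hpp := Real.rpow_pos_of_pos h1 (1 / α)
    exact ⟨((lt_div_iff₀ hpp).mp h3).le, ((div_lt_iff₀ hpp).mp h4).le,
      ((lt_div_iff₀ h1).mp h5).le⟩
  have hp₀mem : p₀ ∈ Set.Ioo (0 : ℝ) 1 := ⟨hp₀, hp₁⟩
  have hp₀r := Real.rpow_pos_of_pos hp₀ (1 / α)
  have hle1 : ∀ p ∈ Set.Ioo (0 : ℝ) 1, p ^ (1 / α) ≤ 1 := fun p hp =>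
    Real.rpow_le_one hp.1.le hp.2.le hα'.le
  refine ⟨monotoneOn_quantile m, fun p hp q hq hpq => hm.radialPotential_mono
    (quantile_pos m hm.Iic_zero hp) (monotoneOn_quantile m hp hq hpq), hQ, hW,
    ⟨lam ^ (-(1 / α)) / 2 * p₀ ^ (1 / α), by positivity, fun p hp => ?_⟩,
    ⟨1 / α / 2 * p₀, by positivity, fun p hp => ?_⟩, ?_⟩
  · have hpr := Real.rpow_pos_of_pos hp.1 (1 / α)
    rcases le_total p p₀ with h | h
    · refine le_trans ?_ (hbd p hp.1 h).1
      have := hle1 p₀ hp₀mem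
      gcongr
      exact mul_le_of_le_one_right (by positivity) this
    · refine le_trans ?_ ((hbd p₀ hp₀ le_rfl).1.trans (monotoneOn_quantile m hp₀mem hp h))
      exact mul_le_of_le_one_right (by positivity) (hle1 p hp)
  · rcases le_total p p₀ with h | h
    · refine le_trans ?_ (hbd p hp.1 h).2.2
      have := hp.1
      gcongr
      exact mul_le_of_le_one_right (by positivity) hp₁.le
    · refine le_trans ?_ ((hbd p₀ hp₀ le_rfl).2.2.trans (hm.radialPotential_mono
        (quantile_pos m hm.Iic_zero hp₀mem) (monotoneOn_quantile m hp₀mem hp h)))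
      exact mul_le_of_le_one_right (by positivity) hp.2.le
  · set B := Real.exp (∫ s, Real.log s ∂m) with hB
    have hB0 : 0 < B := Real.exp_pos _
    refine ⟨2 * lam ^ (-(1 / α)) + B / p₀ ^ (1 / α), by positivity, fun p hp => ?_⟩
    have hpr := Real.rpow_pos_of_pos hp.1 (1 / α)
    have hq := quantile_pos m hm.Iic_zero hp
    rcases le_total p p₀ with h | h
    · have h1 : Real.exp (-radialPotential m (quantile m p)) ≤ 1 :=
        Real.exp_le_one_iff.mpr (by linarith [radialPotential_nonneg m (quantile m p)])
      calc _ ≤ quantile m p * 1 := by gcongr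
        _ ≤ 2 * lam ^ (-(1 / α)) * p ^ (1 / α) := by rw [mul_one]; exact (hbd p hp.1 h).2.1
        _ ≤ _ := by
          have : 0 < B / p₀ ^ (1 / α) := by positivity
          gcongr; linarith
    · have h1 : quantile m p * Real.exp (-radialPotential m (quantile m p)) ≤ B := by
        rw [hB, ← Real.log_le_log_iff (by positivity) (Real.exp_pos _), Real.log_mul hq.ne'
          (Real.exp_pos _).ne', Real.log_exp, Real.log_exp]
        linarith [hm.log_le_radialPotential hq]
      have h2 : B ≤ B / p₀ ^ (1 / α) * p ^ (1 / α) := by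
        rw [div_mul_eq_mul_div, le_div_iff₀ hp₀r]
        exact mul_le_mul_of_nonneg_left (Real.rpow_le_rpow hp₀.le h hα'.le) hB0.le
      have : 0 < lam ^ (-(1 / α)) * p ^ (1 / α) := by positivity
      linarith

/-! ### Laplace asymptotics and uniform lower bounds for the moments -/

section Profile

variable {Q W : ℝ → ℝ} {α lam : ℝ}

/-- The moments along a radial profile. -/
def profileMoment (Q W : ℝ → ℝ) (k n : ℕ) : ℝ :=
  ∫ p in Set.Ioo (0 : ℝ) 1, Q p ^ (2 * k) * Real.exp (-2 * (n : ℝ) * W p)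

theorem IsRadialProfile.quantile_pos (h : IsRadialProfile Q W α lam) {p : ℝ}
    (hp : p ∈ Set.Ioo (0 : ℝ) 1) : 0 < Q p := by
  obtain ⟨c, hc, h1⟩ := h.quantile_lower
  exact lt_of_lt_of_le (mul_pos hc (Real.rpow_pos_of_pos hp.1 _)) (h1 p hp)

theorem IsRadialProfile.aemeasurable_integrand (h : IsRadialProfile Q W α lam) (k n : ℕ) :
    AEMeasurable (fun p => Q p ^ (2 * k) * Real.exp (-2 * (n : ℝ) * W p))
      (volume.restrict (Set.Ioo 0 1)) :=
  ((aemeasurable_restrict_of_monotoneOn measurableSet_Ioo h.monotoneOn_quantile).pow_const _).mul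
    (Real.measurable_exp.comp_aemeasurable ((aemeasurable_restrict_of_monotoneOn
      measurableSet_Ioo h.monotoneOn_potential).const_mul _))

/-- Split `e^(-2nW)`: `2k` factors `e^(-W)` are spent on compensating the growth of `Q^(2k)`, and
the remaining `2(n - k)` give exponential decay through `W ≥ c p`. -/
theorem IsRadialProfile.exists_integrand_le (h : IsRadialProfile Q W α lam) :
    ∃ c > 0, ∃ C > 0, ∀ k n : ℕ, k ≤ n → ∀ p ∈ Set.Ioo (0 : ℝ) 1,
      Q p ^ (2 * k) * Real.exp (-2 * (n : ℝ) * W p)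
        ≤ (C * p ^ (1 / α)) ^ (2 * k) * Real.exp (-2 * c * (n - k) * p) := by
  obtain ⟨c, hc, h1⟩ := h.potential_lower
  obtain ⟨C, hC, h2⟩ := h.upper
  refine ⟨c, hc, C, hC, fun k n hkn p hp => ?_⟩
  have hq := h.quantile_pos hp
  have e : Q p ^ (2 * k) * Real.exp (-2 * (n : ℝ) * W p)
      = (Q p * Real.exp (-W p)) ^ (2 * k) * Real.exp (-2 * ((n : ℝ) - k) * W p) := by
    rw [mul_pow, ← Real.exp_nat_mul, mul_assoc (Q p ^ (2 * k)), ← Real.exp_add]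
    congr 2
    push_cast; ring
  rw [e]
  have hkn' : (0 : ℝ) ≤ n - k := sub_nonneg.mpr (by exact_mod_cast hkn)
  have hp0 := hp.1
  refine mul_le_mul (pow_le_pow_left₀ (by positivity) (h2 p hp) _) (Real.exp_le_exp.mpr ?_)
    (Real.exp_pos _).le (by positivity)
  have := mul_le_mul_of_nonneg_left (h1 p hp) hkn'
  linarith

theorem IsRadialProfile.integrableOn_integrand (h : IsRadialProfile Q W α lam) (hα : 0 < α)
    {k n : ℕ} (hkn : k ≤ n) :
    IntegrableOn (fun p => Q p ^ (2 * k) * Real.exp (-2 * (n : ℝ) * W p)) (Set.Ioo 0 1) := by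
  obtain ⟨c, hc, C, hC, hle⟩ := h.exists_integrand_le
  refine Integrable.mono' (g := fun _ => C ^ (2 * k)) (integrable_const _)
    (h.aemeasurable_integrand k n).aestronglyMeasurable
    ((ae_restrict_iff' measurableSet_Ioo).mpr (Eventually.of_forall fun p hp => ?_))
  have hkn' : (0 : ℝ) ≤ n - k := sub_nonneg.mpr (by exact_mod_cast hkn)
  have hp0 := hp.1
  rw [Real.norm_of_nonneg (mul_nonneg (pow_nonneg (h.quantile_pos hp).le _) (Real.exp_pos _).le)]
  refine (hle k n hkn p hp).trans ?_
  have h1 : Real.exp (-2 * c * (n - k) * p) ≤ 1 := Real.exp_le_one_iff.mpr (by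
    have : 0 ≤ c * (n - k) * p := by positivity
    linarith)
  have h2 : C * p ^ (1 / α) ≤ C :=
    mul_le_of_le_one_right hC.le (Real.rpow_le_one hp.1.le hp.2.le (by positivity))
  calc _ ≤ (C * p ^ (1 / α)) ^ (2 * k) * 1 := by gcongr
    _ ≤ C ^ (2 * k) := by rw [mul_one]; gcongr

theorem IsRadialProfile.profileMoment_pos (h : IsRadialProfile Q W α lam) (hα : 0 < α)
    {k n : ℕ} (hkn : k ≤ n) : 0 < profileMoment Q W k n := by
  have hpos : ∀ p ∈ Set.Ioo (0 : ℝ) 1, 0 < Q p ^ (2 * k) * Real.exp (-2 * (n : ℝ) * W p) :=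
    fun p hp => mul_pos (pow_pos (h.quantile_pos hp) _) (Real.exp_pos _)
  refine (setIntegral_pos_iff_support_of_nonneg_ae
    ((ae_restrict_iff' measurableSet_Ioo).mpr (Eventually.of_forall fun p hp => (hpos p hp).le))
    (h.integrableOn_integrand hα hkn)).mpr ?_
  have : Set.Ioo (0 : ℝ) 1 ⊆ Function.support
      (fun p => Q p ^ (2 * k) * Real.exp (-2 * (n : ℝ) * W p)) ∩ Set.Ioo 0 1 :=
    fun p hp => ⟨(hpos p hp).ne', hp⟩
  exact lt_of_lt_of_le (by simp) (measure_mono this)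

/-- The zoom `p = q/n`; the indicator places all `n` on one half-line, as dominated convergence
requires. -/
theorem natCast_mul_profileMoment {n : ℕ} (hn : 0 < n) (k : ℕ) :
    (n : ℝ) * profileMoment Q W k n = ∫ q in Set.Ioi (0 : ℝ), (Set.Ioo (0 : ℝ) n).indicator
      (fun q => Q (q / n) ^ (2 * k) * Real.exp (-2 * (n : ℝ) * W (q / n))) q := by
  have hn' : (0 : ℝ) < n := by exact_mod_cast hn
  rw [setIntegral_indicator measurableSet_Ioo, Set.inter_eq_right.mpr
    (show Set.Ioo (0 : ℝ) n ⊆ Set.Ioi 0 from fun q hq => hq.1), ← integral_Ioc_eq_integral_Ioo,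
    ← intervalIntegral.integral_of_le hn'.le, intervalIntegral.integral_comp_div
    (fun p => Q p ^ (2 * k) * Real.exp (-2 * (n : ℝ) * W p)) hn'.ne', zero_div,
    div_self hn'.ne', smul_eq_mul, intervalIntegral.integral_of_le zero_le_one,
    integral_Ioc_eq_integral_Ioo, profileMoment]

theorem rpow_one_div_pow {x : ℝ} (hx : 0 ≤ x) (α : ℝ) (k : ℕ) :
    (x ^ (1 / α)) ^ (2 * k) = x ^ (2 * (k : ℝ) / α) := by
  rw [← Real.rpow_natCast, ← Real.rpow_mul hx]
  congr 1
  push_cast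
  ring

/-- The limit of the rescaled moments. -/
def momentLimit (α lam : ℝ) (k : ℕ) : ℝ :=
  α / 2 * (Real.Gamma (1 + 2 * (k : ℝ) / α) / ((2 * lam / α) ^ (2 * (k : ℝ) / α)))

theorem momentLimit_eq_integral (hα : 0 < α) (hlam : 0 < lam) (k : ℕ) :
    ∫ q in Set.Ioi (0 : ℝ), (lam ^ (-(1 / α)) * q ^ (1 / α)) ^ (2 * k) * Real.exp (-(2 / α * q))
      = momentLimit α lam k := by
  have h1 : ∀ q ∈ Set.Ioi (0 : ℝ),
      (lam ^ (-(1 / α)) * q ^ (1 / α)) ^ (2 * k) * Real.exp (-(2 / α * q))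
      = (lam ^ (2 * (k : ℝ) / α))⁻¹ *
        (q ^ ((1 + 2 * (k : ℝ) / α) - 1) * Real.exp (-(2 / α * q))) := by
    intro q hq
    rw [mul_pow, rpow_one_div_pow (le_of_lt hq), Real.rpow_neg hlam.le, inv_pow,
      rpow_one_div_pow hlam.le, add_sub_cancel_left, mul_assoc]
  rw [setIntegral_congr_fun measurableSet_Ioi h1, integral_const_mul,
    Real.integral_rpow_mul_exp_neg_mul_Ioi (by positivity) (by positivity), momentLimit,
    one_div_div, Real.rpow_add (by positivity), Real.rpow_one, Real.div_rpow (by positivity)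
    (by positivity), Real.div_rpow (by positivity) (by positivity),
    Real.mul_rpow (by positivity) (by positivity)]
  have := Real.rpow_pos_of_pos hα (2 * (k : ℝ) / α)
  have := Real.rpow_pos_of_pos hlam (2 * (k : ℝ) / α)
  have := Real.rpow_pos_of_pos (two_pos : (0 : ℝ) < 2) (2 * (k : ℝ) / α)
  field_simp

/-- After zooming, `n^(1/α) Q(q/n) → (q/λ)^(1/α)` and `n W(q/n) → q/α`, so the integrand tends to
that of a Gamma integral with rate `2/α`. -/
theorem IsRadialProfile.tendsto_profileMoment (h : IsRadialProfile Q W α lam) (hα : 0 < α)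
    (hlam : 0 < lam) (k : ℕ) :
    Tendsto (fun n : ℕ => (n : ℝ) ^ (1 + 2 * (k : ℝ) / α) * profileMoment Q W k n) atTop
      (𝓝 (momentLimit α lam k)) := by
  obtain ⟨c, hc, C, hC, hle⟩ := h.exists_integrand_le
  rw [← momentLimit_eq_integral hα hlam]
  -- This ensures `(n - k)/n ≥ 1/(2k+1)`, so the exponential rate of the dominating function does
  -- not depend on `n`.
  have hev : ∀ᶠ n : ℕ in atTop, 2 * k + 1 ≤ n := eventually_ge_atTop _
  have hrew : ∀ᶠ n : ℕ in atTop, ∫ q in Set.Ioi (0 : ℝ), (Set.Ioo (0 : ℝ) n).indicator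
      (fun q => ((n : ℝ) ^ (1 / α) * Q (q / n)) ^ (2 * k) * Real.exp (-2 * (n : ℝ) * W (q / n))) q
      = (n : ℝ) ^ (1 + 2 * (k : ℝ) / α) * profileMoment Q W k n := by
    filter_upwards [hev] with n hn
    have hn0 : 0 < n := by omega
    have hn' : (0 : ℝ) < n := by exact_mod_cast hn0
    rw [Real.rpow_add hn', Real.rpow_one, mul_comm (n : ℝ), mul_assoc,
      natCast_mul_profileMoment hn0, ← integral_const_mul]
    congr 1
    ext q
    by_cases hq : q ∈ Set.Ioo (0 : ℝ) n
    · simp only [Set.indicator_of_mem hq]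
      rw [mul_pow, rpow_one_div_pow hn'.le, mul_assoc]
    · simp [Set.indicator_of_notMem hq]
  refine Tendsto.congr' hrew ?_
  refine tendsto_integral_filter_of_dominated_convergence
    (fun q => C ^ (2 * k) * (q ^ (2 * (k : ℝ) / α) * Real.exp (-(2 * c / (2 * k + 1)) *
      q ^ (1 : ℝ)))) ?_ ?_ ?_ ?_
  · filter_upwards [hev] with n hn
    have hn' : (0 : ℝ) < n := by exact_mod_cast (show 0 < n by omega)
    have hmaps : ∀ q ∈ Set.Ioo (0 : ℝ) n, q / n ∈ Set.Ioo (0 : ℝ) 1 := fun q hq =>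
      ⟨div_pos hq.1 hn', (div_lt_one hn').mpr hq.2⟩
    have hQ : MonotoneOn (fun q => Q (q / n)) (Set.Ioo (0 : ℝ) n) := fun q hq r hr hqr =>
      h.monotoneOn_quantile (hmaps q hq) (hmaps r hr) (by gcongr)
    have hW : MonotoneOn (fun q => W (q / n)) (Set.Ioo (0 : ℝ) n) := fun q hq r hr hqr =>
      h.monotoneOn_potential (hmaps q hq) (hmaps r hr) (by gcongr)
    refine (AEMeasurable.aestronglyMeasurable ?_).restrict
    rw [aemeasurable_indicator_iff measurableSet_Ioo]
    exact (((aemeasurable_restrict_of_monotoneOn measurableSet_Ioo hQ).const_mul _).pow_const _).mul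
      (Real.measurable_exp.comp_aemeasurable
        ((aemeasurable_restrict_of_monotoneOn measurableSet_Ioo hW).const_mul _))
  · filter_upwards [hev] with n hn
    have hn' : (0 : ℝ) < n := by exact_mod_cast (show 0 < n by omega)
    refine (ae_restrict_iff' measurableSet_Ioi).mpr (Eventually.of_forall fun q hq0 => ?_)
    have hq0' : 0 < q := hq0
    by_cases hq : q ∈ Set.Ioo (0 : ℝ) n
    · have hp : q / n ∈ Set.Ioo (0 : ℝ) 1 := ⟨div_pos hq.1 hn', (div_lt_one hn').mpr hq.2⟩
      rw [Set.indicator_of_mem hq, Real.norm_of_nonneg (mul_nonneg (pow_nonneg (mul_nonneg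
        (by positivity) (h.quantile_pos hp).le) _) (Real.exp_pos _).le), mul_pow, mul_assoc]
      refine (mul_le_mul_of_nonneg_left (hle k n (by omega) _ hp) (by positivity)).trans ?_
      have e1 : ((n : ℝ) ^ (1 / α)) ^ (2 * k) * ((C * (q / n) ^ (1 / α)) ^ (2 * k) *
          Real.exp (-2 * c * (n - k) * (q / n)))
          = C ^ (2 * k) * (q ^ (2 * (k : ℝ) / α) * Real.exp (-2 * c * (n - k) * (q / n))) := by
        rw [Real.div_rpow hq0'.le hn'.le, mul_pow, div_pow, rpow_one_div_pow hn'.le,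
          rpow_one_div_pow hq0'.le]
        have := Real.rpow_pos_of_pos hn' (2 * (k : ℝ) / α)
        field_simp
      rw [e1, Real.rpow_one]
      refine mul_le_mul_of_nonneg_left (mul_le_mul_of_nonneg_left (Real.exp_le_exp.mpr ?_)
        (by positivity)) (by positivity)
      have hkn : (2 * k + 1 : ℝ) ≤ n := by exact_mod_cast hn
      have h3 : 1 / (2 * (k : ℝ) + 1) ≤ (n - k) / n := by
        rw [div_le_div_iff₀ (by positivity) hn']
        nlinarith [(Nat.cast_nonneg k : (0 : ℝ) ≤ k)]
      have h4 := mul_le_mul_of_nonneg_left h3 (show 0 ≤ 2 * c * q by positivity)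
      have e2 : -2 * c * (n - k) * (q / n) = -(2 * c * q * ((n - k) / n)) := by ring
      have e3 : -(2 * c / (2 * (k : ℝ) + 1)) * q = -(2 * c * q * (1 / (2 * (k : ℝ) + 1))) := by
        ring
      rw [e2, e3]
      exact neg_le_neg h4
    · rw [Set.indicator_of_notMem hq, norm_zero]
      positivity
  · exact (integrableOn_rpow_mul_exp_neg_mul_rpow (lt_of_lt_of_le (by norm_num)
      (by positivity : (0 : ℝ) ≤ 2 * (k : ℝ) / α)) one_pos (by positivity)).const_mul _
  · refine (ae_restrict_iff' measurableSet_Ioi).mpr (Eventually.of_forall fun q hq0 => ?_)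
    have hq : 0 < q := hq0
    have hdiv : Tendsto (fun n : ℕ => q / (n : ℝ)) atTop (𝓝[>] 0) := by
      refine tendsto_nhdsWithin_iff.mpr ⟨tendsto_const_div_atTop_nhds_zero_nat q, ?_⟩
      filter_upwards [eventually_gt_atTop 0] with n hn
      have : (0 : ℝ) < n := by exact_mod_cast hn
      exact div_pos hq this
    have h1 := (((h.tendsto_quantile.comp hdiv).mul_const (q ^ (1 / α))).pow (2 * k)).mul
      ((Real.continuous_exp.tendsto _).comp
        (((h.tendsto_potential.comp hdiv).const_mul (-2 * q))))
    have h2 : -2 * q * (1 / α) = -(2 / α * q) := by ring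
    rw [h2] at h1
    refine h1.congr' ?_
    filter_upwards [eventually_gt_atTop 0,
      tendsto_natCast_atTop_atTop.eventually_gt_atTop q] with n hn hnq
    have hn' : (0 : ℝ) < n := by exact_mod_cast hn
    rw [Set.indicator_of_mem (show q ∈ Set.Ioo (0 : ℝ) n from ⟨hq, hnq⟩)]
    simp only [Function.comp_apply]
    rw [Real.div_rpow hq.le hn'.le]
    have a1 := Real.rpow_pos_of_pos hn' (1 / α)
    have a2 := Real.rpow_pos_of_pos hq (1 / α)
    congr 2
    · field_simp
    · field_simp

/-- Keep only the window `A/n < p < 2A/n`. There `Q ≥ R n^(-1/α)` while `nW` is bounded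
independently of `k`, so a single `δ` serves for all `k ≤ n`. As `R` is arbitrary, the inverse norms
decay faster than any geometric sequence. -/
theorem IsRadialProfile.exists_profileMoment_ge (h : IsRadialProfile Q W α lam) (hα : 0 < α)
    {R : ℝ} (hR : 0 < R) :
    ∃ δ > 0, ∀ᶠ n : ℕ in atTop, ∀ k ≤ n,
      δ * R ^ (2 * k) ≤ (n : ℝ) ^ (1 + 2 * (k : ℝ) / α) * profileMoment Q W k n := by
  obtain ⟨c, hc, hlow⟩ := h.quantile_lower
  obtain ⟨p₀, hp₀, hup⟩ : ∃ p₀ > 0, ∀ p ∈ Set.Ioo (0 : ℝ) p₀, W p ≤ (1 / α + 1) * p := by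
    have := h.tendsto_potential.eventually (gt_mem_nhds (show 1 / α < 1 / α + 1 by linarith))
    obtain ⟨p₀, hp₀, h1⟩ := mem_nhdsGT_iff_exists_Ioo_subset.mp this
    exact ⟨p₀, hp₀, fun p hp => ((div_lt_iff₀ hp.1).mp (h1 hp)).le⟩
  -- Solves `c A^(1/α) = R`, matching the lower bound `Q(p) ≥ c p^(1/α)` at `p = A/n`.
  set A := (R / c) ^ α with hA
  have hA0 : 0 < A := by positivity
  have hAr : c * A ^ (1 / α) = R := by
    rw [hA, ← Real.rpow_mul (by positivity), mul_one_div_cancel hα.ne', Real.rpow_one]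
    field_simp
  refine ⟨A * Real.exp (-4 * A * (1 / α + 1)), by positivity, ?_⟩
  have hbig : ∀ᶠ n : ℕ in atTop, 2 * A / min p₀ 1 < n :=
    tendsto_natCast_atTop_atTop.eventually_gt_atTop _
  filter_upwards [hbig, eventually_gt_atTop 0] with n hn hn0 k hkn
  have hn' : (0 : ℝ) < n := by exact_mod_cast hn0
  have hmin : 0 < min p₀ 1 := by positivity
  have h2A : 2 * A / n < min p₀ 1 := by
    rw [div_lt_iff₀ hmin] at hn
    rw [div_lt_iff₀ hn']; linarith
  have hsub : Set.Ioo (A / n) (2 * A / n) ⊆ Set.Ioo (0 : ℝ) 1 := fun p hp =>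
    ⟨lt_trans (by positivity) hp.1, hp.2.trans (h2A.trans_le (min_le_right _ _))⟩
  have hint := h.integrableOn_integrand hα hkn
  have hnr := Real.rpow_pos_of_pos hn' (1 / α)
  have hptw : ∀ p ∈ Set.Ioo (A / n) (2 * A / n),
      (R / (n : ℝ) ^ (1 / α)) ^ (2 * k) * Real.exp (-4 * A * (1 / α + 1))
        ≤ Q p ^ (2 * k) * Real.exp (-2 * (n : ℝ) * W p) := by
    intro p hp
    have hp1 := hsub hp
    have b1 : R / (n : ℝ) ^ (1 / α) ≤ Q p := by
      refine le_trans ?_ (hlow p hp1)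
      rw [← hAr, mul_div_assoc, ← Real.div_rpow hA0.le hn'.le]
      gcongr
      exact hp.1.le
    have b2 : n * W p ≤ 2 * A * (1 / α + 1) := by
      have h1 := hup p ⟨hp1.1, hp.2.trans (h2A.trans_le (min_le_left _ _))⟩
      have h2 : p * n < 2 * A := (lt_div_iff₀ hn').mp hp.2
      calc n * W p ≤ n * ((1 / α + 1) * p) := by gcongr
        _ = (1 / α + 1) * (p * n) := by ring
        _ ≤ (1 / α + 1) * (2 * A) := by gcongr
        _ = _ := by ring
    refine mul_le_mul (pow_le_pow_left₀ (by positivity) b1 _) (Real.exp_le_exp.mpr (by linarith))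
      (Real.exp_pos _).le (pow_nonneg (h.quantile_pos hp1).le _)
  have hge : (A / n) * ((R / (n : ℝ) ^ (1 / α)) ^ (2 * k) * Real.exp (-4 * A * (1 / α + 1)))
      ≤ profileMoment Q W k n := by
    calc _ = ∫ _ in Set.Ioo (A / n) (2 * A / n),
          (R / (n : ℝ) ^ (1 / α)) ^ (2 * k) * Real.exp (-4 * A * (1 / α + 1)) := by
          rw [setIntegral_const, measureReal_def, Real.volume_Ioo, smul_eq_mul,
            ENNReal.toReal_ofReal (by rw [← sub_div]; apply div_nonneg <;> linarith)]
          congr 1; ring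
      _ ≤ ∫ p in Set.Ioo (A / n) (2 * A / n), Q p ^ (2 * k) * Real.exp (-2 * (n : ℝ) * W p) :=
          setIntegral_mono_on (integrableOn_const (by simp)) (hint.mono_set hsub) measurableSet_Ioo hptw
      _ ≤ profileMoment Q W k n := setIntegral_mono_set hint
          ((ae_restrict_iff' measurableSet_Ioo).mpr (Eventually.of_forall fun p hp =>
            mul_nonneg (pow_nonneg (h.quantile_pos hp).le _) (Real.exp_pos _).le))
          hsub.eventuallyLE
  refine le_trans (le_of_eq ?_) (mul_le_mul_of_nonneg_left hge (by positivity))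
  rw [Real.rpow_add hn', Real.rpow_one, div_pow, rpow_one_div_pow hn'.le]
  have := Real.rpow_pos_of_pos hn' (2 * (k : ℝ) / α)
  field_simp

end Profile


/-! ### The potential of a rotationally invariant measure -/

section Background

variable {ν : Measure ℂ}

theorem IsAdmissibleBackground.logPotential_mul (hν : IsAdmissibleBackground ν) {c : ℂ}
    (hc : ‖c‖ = 1) (z : ℂ) : logPotential ν (c * z) = logPotential ν z := by
  have hm : Measurable fun w : ℂ => Real.log ‖c * z - w‖ := by fun_prop
  rw [logPotential, logPotential]
  conv_lhs => rw [← hν.rotation_invariant c hc]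
  rw [integral_map (by fun_prop) hm.aestronglyMeasurable]
  simp_rw [← mul_sub, norm_mul, hc, one_mul]

theorem IsAdmissibleBackground.ae_ne_zero (hν : IsAdmissibleBackground ν) : ∀ᵐ w ∂ν, w ≠ 0 := by
  filter_upwards [compl_mem_ae_iff.mpr hν.no_atom_zero] with w hw
  simpa using hw

variable [IsProbabilityMeasure ν]

/-- Both sides equal `max (log r) (log s)`. -/
theorem log_add_posLog_inv_mul {r s : ℝ} (hr : 0 < r) (hs : 0 < s) :
    Real.log r + Real.posLog (r⁻¹ * s) = Real.log s + Real.posLog (r / s) := by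
  have h := Real.posLog_sub_posLog_inv (x := r / s)
  rw [inv_div, Real.log_div hr.ne' hs.ne'] at h
  rw [inv_mul_eq_div]
  linarith

theorem abs_log_eq (x : ℝ) : |Real.log x| = 2 * Real.posLog x - Real.log x := by
  rw [Real.posLog_apply]
  rcases le_total 0 (Real.log x) with h | h
  · rw [max_eq_right h, abs_of_nonneg h]; ring
  · rw [max_eq_left h, abs_of_nonpos h]; ring

theorem integral_circle_log (r : ℝ) (hr : 0 < r) (w : ℂ) :
    ∫ θ in (0 : ℝ)..2 * Real.pi, Real.log ‖circleMap 0 r θ - w‖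
      = 2 * Real.pi * (Real.log r + Real.posLog (r⁻¹ * ‖w‖)) := by
  have h := circleAverage_log_norm_sub_const_eq_log_radius_add_posLog (c := 0) (a := w) hr.ne'
  rw [Real.circleAverage_def, smul_eq_mul, zero_sub, norm_neg] at h
  rw [← h]
  field_simp

/-- Write `|log x| = 2 log⁺ x - log x`. The triangle inequality bounds the first term and the circle
integral of the second is known exactly, so the logarithmic singularity needs no separate estimate.
-/
theorem IsAdmissibleBackground.integrable_circle_log (hν : IsAdmissibleBackground ν) {r : ℝ}
    (hr : 0 < r) : Integrable (Function.uncurry fun (θ : ℝ) (w : ℂ) =>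
      Real.log ‖circleMap 0 r θ - w‖)
      ((volume.restrict (Set.Ioc 0 (2 * Real.pi))).prod ν) := by
  have hpi : (0 : ℝ) ≤ 2 * Real.pi := by positivity
  have hmeas : Measurable (Function.uncurry fun (θ : ℝ) (w : ℂ) =>
      Real.log ‖circleMap 0 r θ - w‖) := by
    have : Measurable fun θ : ℝ => circleMap 0 r θ := (continuous_circleMap 0 r).measurable
    exact Real.measurable_log.comp
      (((this.comp measurable_fst).sub measurable_snd).norm)
  have hint : ∀ w : ℂ, IntervalIntegrable (fun θ : ℝ => Real.log ‖circleMap 0 r θ - w‖) volume 0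
      (2 * Real.pi) := fun w => circleIntegrable_log_norm_sub_const r
  rw [integrable_prod_iff' hmeas.aestronglyMeasurable]
  refine ⟨Eventually.of_forall fun w => (hint w).1, ?_⟩
  have hposlog : Integrable (fun w : ℂ => Real.posLog ‖w‖) ν := by
    refine hν.integrable_log.abs.mono'
      (Real.continuous_posLog.measurable.comp measurable_norm).aestronglyMeasurable
      (Eventually.of_forall fun w => ?_)
    rw [Real.norm_of_nonneg Real.posLog_nonneg, Real.posLog_apply]
    exact max_le (abs_nonneg _) (le_abs_self _)
  have hg : Integrable (fun w : ℂ => 4 * Real.pi * (Real.log 2 + Real.posLog r + Real.posLog ‖w‖)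
      + 2 * Real.pi * |Real.log r|) ν :=
    (((integrable_const _).add hposlog).const_mul _).add (integrable_const _)
  refine hg.mono' hmeas.stronglyMeasurable.norm.integral_prod_left'.aestronglyMeasurable
    (Eventually.of_forall fun w => ?_)
  rw [Real.norm_of_nonneg (integral_nonneg fun _ => norm_nonneg _)]
  have h1 : ∀ θ : ℝ, ‖Real.log ‖circleMap 0 r θ - w‖‖
      ≤ 2 * (Real.log 2 + Real.posLog r + Real.posLog ‖w‖) - Real.log ‖circleMap 0 r θ - w‖ := by
    intro θ
    rw [Real.norm_eq_abs, abs_log_eq]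
    have h2 : ‖circleMap 0 r θ - w‖ ≤ r + ‖w‖ := by
      refine (norm_sub_le _ _).trans ?_
      rw [norm_circleMap_zero, abs_of_pos hr]
    have h3 := (Real.posLog_le_posLog (norm_nonneg _) h2).trans
      (Real.posLog_add (x := r) (y := ‖w‖))
    linarith
  have h4 : ∫ θ in Set.Ioc 0 (2 * Real.pi), ‖Real.log ‖circleMap 0 r θ - w‖‖
      ≤ ∫ θ in Set.Ioc 0 (2 * Real.pi), (2 * (Real.log 2 + Real.posLog r + Real.posLog ‖w‖)
        - Real.log ‖circleMap 0 r θ - w‖) :=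
    integral_mono (hint w).1.norm ((integrable_const _).sub (hint w).1) h1
  refine h4.trans ?_
  rw [integral_sub (integrable_const _) (hint w).1, ← intervalIntegral.integral_of_le (f := fun θ =>
    Real.log ‖circleMap 0 r θ - w‖) hpi, integral_circle_log r hr, integral_const, smul_eq_mul, measureReal_restrict_apply_univ,
    Real.volume_real_Ioc_of_le hpi, sub_zero]
  have h5 := neg_abs_le (Real.log r)
  have h6 : 0 ≤ Real.posLog (r⁻¹ * ‖w‖) := Real.posLog_nonneg
  nlinarith [Real.pi_pos]

/-- The law of the modulus. -/
def modulusLaw (ν : Measure ℂ) : Measure ℝ := ν.map fun z => ‖z‖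

theorem IsAdmissibleBackground.isRadialLaw (hν : IsAdmissibleBackground ν) :
    IsRadialLaw (modulusLaw ν) where
  isProbabilityMeasure := Measure.isProbabilityMeasure_map (by fun_prop)
  Iic_zero := by
    rw [modulusLaw, Measure.map_apply (by fun_prop) measurableSet_Iic, ← hν.no_atom_zero]
    congr 1
    ext z; simp
  integrable_log := by
    rw [modulusLaw, integrable_map_measure Real.measurable_log.aestronglyMeasurable
      (by fun_prop)]
    exact hν.integrable_log

theorem integral_modulusLaw (ν : Measure ℂ) {g : ℝ → ℝ} (hg : Measurable g) :
    ∫ r, g r ∂(modulusLaw ν) = ∫ z, g ‖z‖ ∂ν :=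
  integral_map (by fun_prop) hg.aestronglyMeasurable

/-- The potential is constant on circles, hence equal to its circular mean. Exchanging integrals
leaves the mean of `log |ζ - w|` over `|ζ| = r`, which is `max (log r) (log |w|)`. -/
theorem IsAdmissibleBackground.logPotential_eq (hν : IsAdmissibleBackground ν) (z : ℂ) :
    logPotential ν z = radialPotential (modulusLaw ν) ‖z‖ + ∫ s, Real.log s ∂(modulusLaw ν) := by
  have hposmeas : ∀ r : ℝ, Measurable fun s : ℝ => Real.posLog (r / s) := fun r =>
    Real.continuous_posLog.measurable.comp (measurable_const.div measurable_id)
  rw [radialPotential, integral_modulusLaw ν (hposmeas _),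
    integral_modulusLaw ν Real.measurable_log]
  rcases eq_or_ne z 0 with rfl | hz
  · simp [logPotential]
  have hr : 0 < ‖z‖ := norm_pos_iff.mpr hz
  have hpi : (0 : ℝ) ≤ 2 * Real.pi := by positivity
  have hconst : ∀ θ : ℝ, logPotential ν (circleMap 0 ‖z‖ θ) = logPotential ν z := by
    intro θ
    have h1 : circleMap 0 ‖z‖ θ = (circleMap 0 ‖z‖ θ / z) * z := by field_simp
    rw [h1, hν.logPotential_mul]
    rw [norm_div, norm_circleMap_zero, abs_of_pos hr, div_self hr.ne']
  have hswap := integral_integral_swap (hν.integrable_circle_log hr)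
  have hleft : ∫ θ in Set.Ioc (0 : ℝ) (2 * Real.pi), ∫ w, Real.log ‖circleMap 0 ‖z‖ θ - w‖ ∂ν
      = 2 * Real.pi * logPotential ν z := by
    change ∫ θ in Set.Ioc (0 : ℝ) (2 * Real.pi), logPotential ν (circleMap 0 ‖z‖ θ) = _
    simp_rw [hconst]
    rw [integral_const, smul_eq_mul, measureReal_restrict_apply_univ,
      Real.volume_real_Ioc_of_le hpi, sub_zero]
  have hright : ∫ w, (∫ θ in Set.Ioc (0 : ℝ) (2 * Real.pi), Real.log ‖circleMap 0 ‖z‖ θ - w‖) ∂ν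
      = 2 * Real.pi * (∫ w, Real.posLog (‖z‖ / ‖w‖) ∂ν + ∫ w, Real.log ‖w‖ ∂ν) := by
    have hi : Integrable (fun w : ℂ => Real.posLog (‖z‖ / ‖w‖)) ν := by
      have := hν.isRadialLaw.integrable_posLog hr
      rwa [modulusLaw, integrable_map_measure (hposmeas _).aestronglyMeasurable
        (by fun_prop)] at this
    rw [← integral_add hi hν.integrable_log, ← integral_const_mul]
    refine integral_congr_ae ?_
    filter_upwards [hν.ae_ne_zero] with w hw
    rw [← intervalIntegral.integral_of_le hpi, integral_circle_log _ hr,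
      log_add_posLog_inv_mul hr (norm_pos_iff.mpr hw), add_comm]
  rw [hleft, hright] at hswap
  exact mul_left_cancel₀ (by positivity) hswap

theorem IsAdmissibleBackground.weightedInner_eq (hν : IsAdmissibleBackground ν) (n k : ℕ) :
    (weightedInner ν n (Polynomial.X ^ k) (Polynomial.X ^ k)).re
      = Real.exp (-2 * (n : ℝ) * ∫ s, Real.log s ∂(modulusLaw ν))
        * radialMoment (modulusLaw ν) k n := by
  rw [radialMoment, integral_modulusLaw ν (hν.isRadialLaw.measurable_moment_integrand k n),
    ← integral_const_mul, weightedInner]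
  have h : ∀ z : ℂ, (Polynomial.X ^ k : Polynomial ℂ).eval z
      * (starRingEnd ℂ) ((Polynomial.X ^ k : Polynomial ℂ).eval z)
      * (Real.exp (-2 * (n : ℝ) * logPotential ν z) : ℂ)
      = ((Real.exp (-2 * (n : ℝ) * ∫ s, Real.log s ∂(modulusLaw ν)) *
        (‖z‖ ^ (2 * k) * Real.exp (-2 * (n : ℝ) * radialPotential (modulusLaw ν) ‖z‖)) : ℝ) : ℂ) := by
    intro z
    rw [Complex.mul_conj', hν.logPotential_eq, Polynomial.eval_pow, Polynomial.eval_X, norm_pow,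
      ← Complex.ofReal_pow, ← Complex.ofReal_mul, ← pow_mul, mul_comm k 2, mul_add, Real.exp_add]
    congr 1
    ring
  simp_rw [h]
  rw [integral_complex_ofReal, Complex.ofReal_re]

/-! ### Inversion of the radial law -/

theorem IsRadialLaw.inv {m : Measure ℝ} (hm : IsRadialLaw m) : IsRadialLaw (m.map fun r => r⁻¹) := by
  have := hm.isProbabilityMeasure
  refine ⟨Measure.isProbabilityMeasure_map (by fun_prop), ?_, ?_⟩
  · rw [Measure.map_apply (by fun_prop) measurableSet_Iic, ← hm.Iic_zero]
    congr 1
    ext r; simp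
  · rw [integrable_map_measure Real.measurable_log.aestronglyMeasurable (by fun_prop)]
    refine hm.integrable_log.neg.congr (Eventually.of_forall fun r => ?_)
    simp [Real.log_inv]

/-- This integrates `log⁺(s/r) = log⁺(r/s) - log r + log s`. -/
theorem IsRadialLaw.radialPotential_inv {m : Measure ℝ} (hm : IsRadialLaw m) {r : ℝ}
    (hr : 0 < r) : radialPotential (m.map fun r => r⁻¹) r⁻¹
      = radialPotential m r - Real.log r + ∫ s, Real.log s ∂m := by
  have := hm.isProbabilityMeasure
  have hmeas : Measurable fun s : ℝ => Real.posLog (r⁻¹ / s) :=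
    Real.continuous_posLog.measurable.comp (measurable_const.div measurable_id)
  rw [radialPotential, integral_map (by fun_prop) hmeas.aestronglyMeasurable]
  have h : ∀ᵐ s ∂m, Real.posLog (r⁻¹ / s⁻¹)
      = Real.posLog (r / s) - Real.log r + Real.log s := by
    filter_upwards [hm.ae_pos] with s hs
    have := log_add_posLog_inv_mul hr hs
    rw [div_inv_eq_mul]
    linarith
  rw [integral_congr_ae h, integral_add (f := fun s => Real.posLog (r / s) - Real.log r) ((hm.integrable_posLog hr).sub (integrable_const _))
    hm.integrable_log, integral_sub (hm.integrable_posLog hr) (integrable_const _), radialPotential]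
  simp

/-- The term `-log r` in the potential of the inverted law produces `r^(2n)`, which turns `r^(-2j)`
into `r^(2(n-j))`. The prefactor does not involve `j`, so it is harmless for zeros. -/
theorem IsRadialLaw.radialMoment_inv {m : Measure ℝ} (hm : IsRadialLaw m) {j n : ℕ}
    (hj : j ≤ n) : radialMoment m (n - j) n
      = Real.exp (2 * (n : ℝ) * ∫ s, Real.log s ∂m) * radialMoment (m.map fun r => r⁻¹) j n := by
  rw [radialMoment, radialMoment, integral_map (by fun_prop)
    (hm.inv.measurable_moment_integrand j n).aestronglyMeasurable, ← integral_const_mul]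
  refine integral_congr_ae ?_
  filter_upwards [hm.ae_pos] with r hr
  rw [hm.radialPotential_inv hr]
  have h1 : r ^ (2 * (n - j)) = r⁻¹ ^ (2 * j) * Real.exp (2 * (n : ℝ) * Real.log r) := by
    have h2 : Real.exp (2 * (n : ℝ) * Real.log r) = r ^ (2 * n) := by
      rw [mul_comm, Real.exp_mul, Real.exp_log hr, ← Real.rpow_natCast]
      push_cast; rfl
    rw [h2, inv_pow, show 2 * n = 2 * j + 2 * (n - j) by omega, pow_add]
    have := pow_pos hr (2 * j)
    field_simp
  rw [h1, mul_assoc, ← Real.exp_add, mul_left_comm (Real.exp _), ← Real.exp_add]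
  congr 2
  ring

theorem IsRadialLaw.radialMoment_eq_profileMoment {m : Measure ℝ} (hm : IsRadialLaw m) (k n : ℕ) :
    radialMoment m k n
      = profileMoment (quantile m) (fun p => radialPotential m (quantile m p)) k n :=
  hm.radialMoment_eq k n

/-! ### Behaviour of the distribution function -/

/-- The distribution function measures closed disks and the hypothesis open ones. The closed disk of
radius `r` lies between the open disks of radii `r` and `r + r²`, and `(1 + r)^α → 1`. -/
theorem tendsto_cdf_modulusLaw {α lam : ℝ}
    (h : Tendsto (fun r : ℝ => ν.real (Metric.ball 0 r) / r ^ α) (𝓝[>] 0) (𝓝 lam)) :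
    Tendsto (fun r : ℝ => cdf (modulusLaw ν) r / r ^ α) (𝓝[>] 0) (𝓝 lam) := by
  have : IsProbabilityMeasure (modulusLaw ν) := Measure.isProbabilityMeasure_map (by fun_prop)
  have hcdf : ∀ r : ℝ, cdf (modulusLaw ν) r = ν.real (Metric.closedBall 0 r) := by
    intro r
    rw [cdf_eq_real, modulusLaw, map_measureReal_apply (by fun_prop) measurableSet_Iic]
    congr 1
    ext z; simp
  have hsq : Tendsto (fun r : ℝ => r + r ^ 2) (𝓝[>] 0) (𝓝[>] 0) := by
    refine tendsto_nhdsWithin_iff.mpr ⟨?_, ?_⟩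
    · have : Continuous fun r : ℝ => r + r ^ 2 := by fun_prop
      have h0 := this.tendsto 0
      simp only [ne_eq, OfNat.ofNat_ne_zero, not_false_eq_true, zero_pow, add_zero] at h0
      exact h0.mono_left nhdsWithin_le_nhds
    · filter_upwards [self_mem_nhdsWithin] with r hr
      have : (0 : ℝ) < r := hr
      exact Set.mem_Ioi.mpr (by positivity)
  have hone : Tendsto (fun r : ℝ => (1 + r) ^ α) (𝓝[>] 0) (𝓝 1) := by
    have h1 : ContinuousAt (fun r : ℝ => (1 + r) ^ α) 0 :=
      (continuousAt_const.add continuousAt_id).rpow_const (Or.inl (by simp))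
    have h2 := h1.tendsto
    simp only [add_zero, Real.one_rpow] at h2
    exact h2.mono_left nhdsWithin_le_nhds
  have hup := (h.comp hsq).mul hone
  rw [mul_one] at hup
  refine tendsto_of_tendsto_of_tendsto_of_le_of_le' h hup ?_ ?_
  · filter_upwards [self_mem_nhdsWithin] with r hr
    have : (0 : ℝ) < r := hr
    rw [hcdf]
    exact div_le_div_of_nonneg_right (measureReal_mono Metric.ball_subset_closedBall)
      (by positivity)
  · filter_upwards [self_mem_nhdsWithin] with r hr
    have hr' : (0 : ℝ) < r := hr
    rw [hcdf]
    simp only [Function.comp_apply]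
    have e : (r + r ^ 2) ^ α = r ^ α * (1 + r) ^ α := by
      rw [← Real.mul_rpow hr'.le (by positivity)]; congr 1; ring
    have p1 := Real.rpow_pos_of_pos hr' α
    have p2 := Real.rpow_pos_of_pos (show 0 < 1 + r by positivity) α
    have e2 : ν.real (Metric.ball 0 (r + r ^ 2)) / (r ^ α * (1 + r) ^ α) * (1 + r) ^ α
        = ν.real (Metric.ball 0 (r + r ^ 2)) / r ^ α := by field_simp
    rw [e, e2]
    refine div_le_div_of_nonneg_right (measureReal_mono (Metric.closedBall_subset_ball ?_)) p1.le
    nlinarith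

/-- The exterior `|w| ≥ 1/r` is the set `|w|⁻¹ ≤ r` except at the origin, where `0⁻¹ = 0`; the
origin is null. -/
theorem IsAdmissibleBackground.tendsto_cdf_inv (hν : IsAdmissibleBackground ν) {α lam : ℝ}
    (h : Tendsto (fun r : ℝ => r ^ α * ν.real (Metric.ball 0 r)ᶜ) atTop (𝓝 lam)) :
    Tendsto (fun r : ℝ => cdf ((modulusLaw ν).map fun r => r⁻¹) r / r ^ α) (𝓝[>] 0) (𝓝 lam) := by
  have := hν.isRadialLaw.inv.isProbabilityMeasure
  refine (h.comp tendsto_inv_nhdsGT_zero).congr' ?_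
  filter_upwards [self_mem_nhdsWithin] with r hr
  have hr' : (0 : ℝ) < r := hr
  rw [cdf_eq_real, map_measureReal_apply (by fun_prop) measurableSet_Iic, modulusLaw,
    map_measureReal_apply (by fun_prop) (measurable_inv measurableSet_Iic), Function.comp_apply,
    Real.inv_rpow hr'.le, div_eq_inv_mul]
  congr 1
  refine measureReal_congr ?_
  filter_upwards [hν.ae_ne_zero] with w hw
  refine propext ?_
  have hw' : 0 < ‖w‖ := norm_pos_iff.mpr hw
  change w ∈ (Metric.ball 0 r⁻¹)ᶜ ↔ ‖w‖⁻¹ ≤ r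
  simp only [Set.mem_compl_iff, Metric.mem_ball, dist_zero_right, not_lt]
  exact inv_le_comm₀ hr' hw'

end Background


/-! ### Random series with deterministic weights -/

theorem tendstoOnDisks_of_norm_le {ι : Type*} {F : ι → ℂ → ℂ} {f : ℂ → ℂ} {l : Filter ι}
    (E : ℝ → ι → ℝ) (hE : ∀ R, 0 ≤ R → Tendsto (E R) l (𝓝 0))
    (hle : ∀ R, 0 ≤ R → ∀ᶠ n in l, ∀ z, ‖z‖ ≤ R → ‖F n z - f z‖ ≤ E R n) :
    TendstoOnDisks F f l := by
  intro R
  refine TendstoUniformlyOn.mono (s := Metric.closedBall 0 (max R 0)) ?_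
    (Metric.closedBall_subset_closedBall (le_max_left _ _))
  rw [Metric.tendstoUniformlyOn_iff]
  intro ε hε
  filter_upwards [hle _ (le_max_right R 0),
    (hE _ (le_max_right R 0)).eventually (gt_mem_nhds hε)] with n h1 h2 z hz
  rw [dist_comm, dist_eq_norm]
  exact (h1 z (by simpa using hz)).trans_lt h2

theorem TendstoOnDisks.differentiable {F : ℕ → ℂ → ℂ} {f : ℂ → ℂ}
    (h : TendstoOnDisks F f atTop) (hF : ∀ n, Differentiable ℂ (F n)) : Differentiable ℂ f := by
  have h1 : TendstoLocallyUniformlyOn F f atTop Set.univ := by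
    rw [tendstoLocallyUniformlyOn_iff_forall_isCompact isOpen_univ]
    intro K _ hK
    obtain ⟨R, hR⟩ := hK.isBounded.subset_closedBall (0 : ℂ)
    exact (h R).mono hR
  exact differentiableOn_univ.mp (h1.differentiableOn
    (Eventually.of_forall fun n => (hF n).differentiableOn) isOpen_univ)

/-- A triangular array of positive weights with superexponentially small limits. -/
structure IsWeightArray (d : ℕ → ℕ → ℝ) (c : ℕ → ℝ) : Prop where
  pos : ∀ k n, 0 < n → k ≤ n → 0 < d k n
  tendsto : ∀ k, Tendsto (d k) atTop (𝓝 (c k))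
  bound : ∀ R, 0 < R → ∃ C, ∀ᶠ n in atTop, ∀ k ≤ n, d k n ≤ C / R ^ k

/-- Polynomials with weighted coefficients. -/
def weightedPoly (d : ℕ → ℕ → ℝ) (n : ℕ) (a : ℕ → ℂ) (z : ℂ) : ℂ :=
  ∑ k ∈ Finset.range (n + 1), a k * (d k n : ℂ) * z ^ k

/-- Power series with weighted coefficients. -/
def weightedSeries (c : ℕ → ℝ) (a : ℕ → ℂ) (z : ℂ) : ℂ := ∑' k, a k * (c k : ℂ) * z ^ k

theorem differentiable_weightedPoly (d : ℕ → ℕ → ℝ) (n : ℕ) (a : ℕ → ℂ) :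
    Differentiable ℂ (weightedPoly d n a) := by
  unfold weightedPoly
  fun_prop

theorem weightedPoly_zero (d : ℕ → ℕ → ℝ) (n : ℕ) (a : ℕ → ℂ) :
    weightedPoly d n a 0 = a 0 * (d 0 n : ℂ) := by
  rw [weightedPoly, Finset.sum_eq_single 0]
  · simp
  · intro k _ hk; simp [hk]
  · simp

/-- Continuity in the coefficients, for the product topology; it yields measurability of the zeros
as functions of the random sequence. -/
theorem tendstoOnDisks_weightedPoly_coeff (d : ℕ → ℕ → ℝ) (n : ℕ) (a : ℕ → ℂ) :
    TendstoOnDisks (fun v : ℕ → ℂ => weightedPoly d n v) (weightedPoly d n a) (𝓝 a) := by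
  refine tendstoOnDisks_of_norm_le
    (fun R v => ∑ k ∈ Finset.range (n + 1), ‖v k - a k‖ * |d k n| * R ^ k) (fun R _ => ?_)
    (fun R _ => Eventually.of_forall fun v z hz => ?_)
  · have hc : Continuous fun v : ℕ → ℂ =>
        ∑ k ∈ Finset.range (n + 1), ‖v k - a k‖ * |d k n| * R ^ k := by fun_prop
    simpa using hc.tendsto a
  · rw [weightedPoly, weightedPoly, ← Finset.sum_sub_distrib]
    refine (norm_sum_le _ _).trans (Finset.sum_le_sum fun k _ => ?_)
    rw [← sub_mul, ← sub_mul, norm_mul, norm_mul, norm_pow, Complex.norm_real, Real.norm_eq_abs]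
    gcongr

/-- At most exponential growth of a sequence. -/
def HasExpGrowth (a : ℕ → ℂ) : Prop := ∃ C, ∀ k : ℕ, ‖a k‖ ≤ C * Real.exp 1 ^ k

section Series

variable {d : ℕ → ℕ → ℝ} {c : ℕ → ℝ} {a : ℕ → ℂ}

theorem IsWeightArray.limit_nonneg (h : IsWeightArray d c) (k : ℕ) : 0 ≤ c k :=
  ge_of_tendsto (h.tendsto k) (by
    filter_upwards [eventually_ge_atTop (max k 1)] with n hn
    exact (h.pos k n (by omega) (by omega)).le)

theorem IsWeightArray.limit_bound (h : IsWeightArray d c) {R : ℝ} (hR : 0 < R) :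
    ∃ C, ∀ k, c k ≤ C / R ^ k := by
  obtain ⟨C, hC⟩ := h.bound R hR
  refine ⟨C, fun k => le_of_tendsto (h.tendsto k) ?_⟩
  filter_upwards [hC, eventually_ge_atTop k] with n h1 h2 using h1 k h2

/-- A weight bound at radius `2e(R+1)` absorbs the growth `e^k` of the coefficients and the factor
`R^k`, and still leaves `2^(-k)`. Using `R + 1` keeps that radius positive at `R = 0`. -/
theorem norm_weighted_term_le {R C C' : ℝ} (hR : 0 ≤ R)
    (hC' : ∀ k : ℕ, ‖a k‖ ≤ C' * Real.exp 1 ^ k) {k : ℕ} {x : ℝ} (hx0 : 0 ≤ x)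
    (hx : x ≤ C / (2 * Real.exp 1 * (R + 1)) ^ k) :
    x * (‖a k‖ * R ^ k) ≤ C * C' * (1 / 2) ^ k := by
  have h1 : R ^ k ≤ (R + 1) ^ k := pow_le_pow_left₀ hR (by linarith) k
  have hC'0 : 0 ≤ C' := by
    have := (norm_nonneg _).trans (hC' 0)
    simpa using this
  calc x * (‖a k‖ * R ^ k)
      ≤ C / (2 * Real.exp 1 * (R + 1)) ^ k * (C' * Real.exp 1 ^ k * (R + 1) ^ k) := by
        refine mul_le_mul hx (mul_le_mul (hC' k) h1 (by positivity) (by positivity))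
          (by positivity) (hx0.trans hx)
    _ = C * C' * (1 / 2) ^ k := by
        rw [mul_pow, mul_pow, one_div, inv_pow]
        have := Real.exp_pos 1
        field_simp

theorem summable_weighted (hc0 : ∀ k, 0 ≤ c k) (hc : ∀ R, 0 < R → ∃ C, ∀ k, c k ≤ C / R ^ k)
    (ha : HasExpGrowth a) (z : ℂ) : Summable fun k => a k * (c k : ℂ) * z ^ k := by
  obtain ⟨C', hC'⟩ := ha
  obtain ⟨C, hC⟩ := hc (2 * Real.exp 1 * (‖z‖ + 1)) (by positivity)
  refine Summable.of_norm_bounded (g := fun k => C * C' * (1 / 2 : ℝ) ^ k)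
    ((summable_geometric_of_lt_one (by norm_num) (by norm_num)).mul_left _) fun k => ?_
  rw [norm_mul, norm_mul, norm_pow, Complex.norm_real, Real.norm_of_nonneg (hc0 k), mul_comm ‖a k‖,
    mul_assoc]
  exact norm_weighted_term_le (norm_nonneg z) hC' (hc0 k) (hC k)

/-- Dominated convergence for series: `∑ |d k n - c k| |a k| R^k → 0`, with rows extended by zero
beyond `n`, bounds the difference on the whole disk. -/
theorem IsWeightArray.tendstoOnDisks (h : IsWeightArray d c) (ha : HasExpGrowth a) :
    TendstoOnDisks (fun n => weightedPoly d n a) (weightedSeries c a) atTop := by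
  have hsum : ∀ z, Summable fun k => a k * (c k : ℂ) * z ^ k :=
    summable_weighted h.limit_nonneg (fun R hR => h.limit_bound hR) ha
  obtain ⟨C', hC'⟩ := ha
  have hsum' : ∀ n z, Summable fun k =>
      (Finset.range (n + 1) : Set ℕ).indicator (fun k => a k * (d k n : ℂ) * z ^ k) k := fun n z =>
    summable_of_ne_finset_zero (s := Finset.range (n + 1)) fun k hk => by
      rw [Set.indicator_of_notMem]; exact_mod_cast hk
  have hpoly : ∀ n z, weightedPoly d n a z = ∑' k,
      (Finset.range (n + 1) : Set ℕ).indicator (fun k => a k * (d k n : ℂ) * z ^ k) k := fun n z => by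
    rw [weightedPoly, sum_eq_tsum_indicator]
  set e : ℕ → ℕ → ℝ := fun n k =>
    |(Finset.range (n + 1) : Set ℕ).indicator (fun k => d k n) k - c k| with he
  have hdom : ∀ R, 0 ≤ R → ∃ K, ∀ᶠ n in atTop, ∀ k, e n k * (‖a k‖ * R ^ k) ≤ K * (1 / 2) ^ k := by
    intro R hR
    obtain ⟨C₁, hC₁⟩ := h.bound (2 * Real.exp 1 * (R + 1)) (by positivity)
    obtain ⟨C₂, hC₂⟩ := h.limit_bound (R := 2 * Real.exp 1 * (R + 1)) (by positivity)
    refine ⟨(|C₁| + |C₂|) * C', ?_⟩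
    filter_upwards [hC₁, eventually_gt_atTop 0] with n hn hn0 k
    refine norm_weighted_term_le hR hC' (abs_nonneg _) ?_
    have hP : 0 < (2 * Real.exp 1 * (R + 1)) ^ k := by positivity
    have i1 : |(Finset.range (n + 1) : Set ℕ).indicator (fun k => d k n) k|
        ≤ |C₁| / (2 * Real.exp 1 * (R + 1)) ^ k := by
      by_cases hk : k ∈ (Finset.range (n + 1) : Set ℕ)
      · rw [Set.indicator_of_mem hk]
        have hk' : k ≤ n := by simpa [Nat.lt_succ_iff] using hk
        rw [abs_of_pos (h.pos k n hn0 hk')]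
        exact (hn k hk').trans (by gcongr; exact le_abs_self _)
      · rw [Set.indicator_of_notMem hk, abs_zero]; positivity
    have i2 : |c k| ≤ |C₂| / (2 * Real.exp 1 * (R + 1)) ^ k := by
      rw [abs_of_nonneg (h.limit_nonneg k)]
      exact (hC₂ k).trans (by gcongr; exact le_abs_self _)
    rw [add_div]
    exact (abs_sub _ _).trans (add_le_add i1 i2)
  have hsummable : ∀ R, 0 ≤ R → ∀ᶠ n in atTop, Summable fun k => e n k * (‖a k‖ * R ^ k) := by
    intro R hR
    obtain ⟨K, hK⟩ := hdom R hR
    filter_upwards [hK] with n hn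
    exact Summable.of_nonneg_of_le (fun k => by positivity) hn
      ((summable_geometric_of_lt_one (by norm_num) (by norm_num)).mul_left _)
  refine tendstoOnDisks_of_norm_le (fun R n => ∑' k, e n k * (‖a k‖ * R ^ k)) (fun R hR => ?_)
    (fun R hR => ?_)
  · obtain ⟨K, hK⟩ := hdom R hR
    have := tendsto_tsum_of_dominated_convergence (𝓕 := atTop)
      (f := fun n k => e n k * (‖a k‖ * R ^ k)) (g := fun _ => (0 : ℝ))
      (bound := fun k => K * (1 / 2 : ℝ) ^ k)
      ((summable_geometric_of_lt_one (by norm_num) (by norm_num)).mul_left _) (fun k => ?_) ?_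
    · simpa using this
    · have h1 : Tendsto (fun n => e n k) atTop (𝓝 0) := by
        have h2 : Tendsto (fun n => |d k n - c k|) atTop (𝓝 0) := by
          simpa using ((h.tendsto k).sub_const (c k)).abs
        refine h2.congr' ?_
        filter_upwards [eventually_ge_atTop k] with n hn
        rw [he]
        simp only
        rw [Set.indicator_of_mem (by simpa [Nat.lt_succ_iff] using hn)]
      simpa using h1.mul_const (‖a k‖ * R ^ k)
    · filter_upwards [hK] with n hn k
      rw [Real.norm_of_nonneg (by positivity)]
      exact hn k
  · filter_upwards [hsummable R hR] with n hn z hz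
    rw [hpoly, weightedSeries, ← (hsum' n z).tsum_sub (hsum z)]
    have hterm : ∀ k, ‖(Finset.range (n + 1) : Set ℕ).indicator
        (fun k => a k * (d k n : ℂ) * z ^ k) k - a k * (c k : ℂ) * z ^ k‖
        ≤ e n k * (‖a k‖ * R ^ k) := by
      intro k
      have e1 : (Finset.range (n + 1) : Set ℕ).indicator
        (fun k => a k * (d k n : ℂ) * z ^ k) k - a k * (c k : ℂ) * z ^ k
        = (((Finset.range (n + 1) : Set ℕ).indicator (fun k => d k n) k - c k : ℝ) : ℂ)
          * (a k * z ^ k) := by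
        by_cases hk : k ∈ (Finset.range (n + 1) : Set ℕ)
        · rw [Set.indicator_of_mem hk, Set.indicator_of_mem hk]; push_cast; ring
        · rw [Set.indicator_of_notMem hk, Set.indicator_of_notMem hk]; push_cast; ring
      rw [e1, norm_mul, norm_mul, norm_pow, Complex.norm_real, Real.norm_eq_abs]
      gcongr
    exact tsum_of_norm_bounded hn.hasSum hterm

theorem IsWeightArray.differentiable_weightedSeries (h : IsWeightArray d c) (ha : HasExpGrowth a) :
    Differentiable ℂ (weightedSeries c a) :=
  (h.tendstoOnDisks ha).differentiable fun n => differentiable_weightedPoly d n a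

theorem weightedSeries_zero (c : ℕ → ℝ) (a : ℕ → ℂ) : weightedSeries c a 0 = a 0 * (c 0 : ℂ) := by
  rw [weightedSeries, tsum_eq_single 0]
  · simp
  · intro k hk; simp [hk]

end Series

/-! ### Mittag-Leffler weights -/

/-- The weights of the Mittag-Leffler random function. -/
def mittagLefflerWeight (α lam : ℝ) (k : ℕ) : ℝ :=
  (2 * lam / α) ^ ((k : ℝ) / α) / Real.sqrt (Real.Gamma (1 + 2 * (k : ℝ) / α))

section MittagLeffler

variable {α lam : ℝ}

theorem mittagLefflerTerm_eq (α lam : ℝ) (a : ℕ → ℂ) (z : ℂ) (k : ℕ) :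
    mittagLefflerTerm α lam a z k = a k * (mittagLefflerWeight α lam k : ℂ) * z ^ k := by
  rw [mittagLefflerTerm, mittagLefflerWeight]
  push_cast
  ring

theorem mittagLefflerFun_eq (α lam : ℝ) (a : ℕ → ℂ) :
    mittagLefflerFun α lam a = weightedSeries (mittagLefflerWeight α lam) a := by
  ext z
  simp only [mittagLefflerFun, weightedSeries, mittagLefflerTerm_eq]

/-- Keep only `t > T` in the Gamma integral, where `t^x ≥ T^x`. -/
theorem rpow_mul_exp_neg_le_Gamma {x T : ℝ} (hx : 0 ≤ x) (hT : 0 < T) :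
    T ^ x * Real.exp (-T) ≤ Real.Gamma (1 + x) := by
  have hint := Real.GammaIntegral_convergent (s := 1 + x) (by linarith)
  rw [Real.Gamma_eq_integral (by linarith)]
  calc T ^ x * Real.exp (-T) = ∫ t in Set.Ioi T, T ^ x * Real.exp (-t) := by
        rw [integral_const_mul, integral_exp_neg_Ioi]
    _ ≤ ∫ t in Set.Ioi T, Real.exp (-t) * t ^ (1 + x - 1) := by
        refine setIntegral_mono_on ((integrableOn_exp_neg_Ioi T).const_mul _)
          (hint.mono_set (Set.Ioi_subset_Ioi hT.le)) measurableSet_Ioi fun t ht => ?_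
        rw [mul_comm, add_sub_cancel_left]
        have : T ≤ t := le_of_lt ht
        gcongr
    _ ≤ _ := setIntegral_mono_set hint ((ae_restrict_iff' measurableSet_Ioi).mpr
        (Eventually.of_forall fun t ht => by
          have : (0 : ℝ) < t := ht
          exact mul_nonneg (Real.exp_pos _).le (Real.rpow_nonneg this.le _)))
        (Set.Ioi_subset_Ioi hT.le).eventuallyLE

theorem Gamma_weight_pos (hα : 0 < α) (k : ℕ) : 0 < Real.Gamma (1 + 2 * (k : ℝ) / α) :=
  Real.Gamma_pos_of_pos (by positivity)

theorem mittagLefflerWeight_pos (hα : 0 < α) (hlam : 0 < lam) (k : ℕ) :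
    0 < mittagLefflerWeight α lam k :=
  div_pos (by positivity) (Real.sqrt_pos.mpr (Gamma_weight_pos hα k))

/-- The choice `T = (A R)^α` makes `T^(2k/α) = (A R)^(2k)`. The constant is explicit in `R`, which
later shows that the random function has finite order. -/
theorem mittagLefflerWeight_le (hα : 0 < α) (hlam : 0 < lam) {R : ℝ} (hR : 0 < R) (k : ℕ) :
    mittagLefflerWeight α lam k ≤ Real.exp (((2 * lam / α) ^ (1 / α) * R) ^ α / 2) / R ^ k := by
  have hX : 0 < 2 * lam / α := by positivity
  set A := (2 * lam / α) ^ (1 / α) with hA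
  have hA0 : 0 < A := by positivity
  set T := (A * R) ^ α with hT
  have hT0 : 0 < T := by positivity
  have hXk : (2 * lam / α) ^ ((k : ℝ) / α) = A ^ k := by
    rw [hA, ← Real.rpow_natCast, ← Real.rpow_mul hX.le]; congr 1; ring
  have hTk : T ^ (2 * (k : ℝ) / α) = ((A * R) ^ k) ^ 2 := by
    rw [hT, ← Real.rpow_mul (by positivity), ← pow_mul, ← Real.rpow_natCast]
    congr 1
    push_cast
    field_simp
  have h1 := rpow_mul_exp_neg_le_Gamma (x := 2 * (k : ℝ) / α) (by positivity) hT0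
  rw [hTk] at h1
  have h2 : (A * R) ^ k * Real.exp (-T / 2) ≤ Real.sqrt (Real.Gamma (1 + 2 * (k : ℝ) / α)) := by
    apply Real.le_sqrt_of_sq_le
    refine le_trans (le_of_eq ?_) h1
    rw [mul_pow, ← Real.exp_nat_mul]
    congr 2
    push_cast; ring
  rw [mittagLefflerWeight, hXk, div_le_div_iff₀ (Real.sqrt_pos.mpr (Gamma_weight_pos hα k))
    (by positivity)]
  calc A ^ k * R ^ k = Real.exp (T / 2) * ((A * R) ^ k * Real.exp (-T / 2)) := by
        rw [mul_left_comm, ← Real.exp_add, mul_pow]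
        have : T / 2 + -T / 2 = 0 := by ring
        rw [this, Real.exp_zero, mul_one]
    _ ≤ _ := by gcongr

theorem summable_mittagLefflerTerm (hα : 0 < α) (hlam : 0 < lam) {a : ℕ → ℂ}
    (ha : HasExpGrowth a) (z : ℂ) : Summable (mittagLefflerTerm α lam a z) := by
  rw [show mittagLefflerTerm α lam a z
    = fun k => a k * (mittagLefflerWeight α lam k : ℂ) * z ^ k from
    funext (mittagLefflerTerm_eq α lam a z)]
  exact summable_weighted (fun k => (mittagLefflerWeight_pos hα hlam k).le)
    (fun R hR => ⟨_, mittagLefflerWeight_le hα hlam hR⟩) ha z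

/-- Finite order of the Mittag-Leffler function. -/
theorem norm_mittagLefflerFun_le (hα : 0 < α) (hlam : 0 < lam) {a : ℕ → ℂ}
    (ha : HasExpGrowth a) : ∃ C > 0, ∃ D > 0, ∀ R : ℝ, 1 ≤ R → ∀ z, ‖z‖ ≤ R →
      ‖mittagLefflerFun α lam a z‖ ≤ C * Real.exp (D * R ^ α) := by
  obtain ⟨C', hC'⟩ := ha
  set A := (2 * lam / α) ^ (1 / α) with hA
  have hA0 : 0 < A := by positivity
  have hC'0 : 0 ≤ C' := by
    have := (norm_nonneg _).trans (hC' 0)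
    simpa using this
  have he := Real.exp_pos 1
  -- For `R ≥ 1` the radius `2e(R+1)` is at most `4eR`, whence the exponent; the factor `2` is the
  -- sum of the geometric series, and `C' + 1` is positive even if `C' = 0`.
  refine ⟨2 * (C' + 1), by positivity, (A * (4 * Real.exp 1)) ^ α / 2, by positivity,
    fun R hR z hz => ?_⟩
  rw [mittagLefflerFun_eq, weightedSeries]
  have hR0 : 0 < R := by linarith
  have hterm : ∀ k, ‖a k * (mittagLefflerWeight α lam k : ℂ) * z ^ k‖
      ≤ Real.exp ((A * (4 * Real.exp 1)) ^ α / 2 * R ^ α) * (C' + 1) * (1 / 2) ^ k := by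
    intro k
    have h0 := (mittagLefflerWeight_pos hα hlam k).le
    rw [norm_mul, norm_mul, norm_pow, Complex.norm_real, Real.norm_of_nonneg h0,
      mul_comm ‖a k‖, mul_assoc]
    have h1 : mittagLefflerWeight α lam k
        ≤ Real.exp ((A * (4 * Real.exp 1)) ^ α / 2 * R ^ α) /
          (2 * Real.exp 1 * (R + 1)) ^ k := by
      refine (mittagLefflerWeight_le hα hlam
        (show 0 < 2 * Real.exp 1 * (R + 1) by positivity) k).trans ?_
      gcongr
      rw [← hA, div_mul_eq_mul_div, ← Real.mul_rpow (by positivity) hR0.le]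
      gcongr ?_ / 2
      refine Real.rpow_le_rpow (by positivity) ?_ hα.le
      have : A * Real.exp 1 * (2 * (R + 1)) ≤ A * Real.exp 1 * (4 * R) :=
        mul_le_mul_of_nonneg_left (by linarith) (by positivity)
      linarith
    refine (mul_le_mul_of_nonneg_left (mul_le_mul_of_nonneg_left
      (pow_le_pow_left₀ (norm_nonneg z) hz k) (norm_nonneg _)) h0).trans ?_
    exact norm_weighted_term_le hR0.le (fun k => (hC' k).trans (by gcongr; linarith)) h0 h1
  have hgeo := (hasSum_geometric_of_lt_one (r := (1 / 2 : ℝ)) (by norm_num) (by norm_num)).mul_left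
    (Real.exp ((A * (4 * Real.exp 1)) ^ α / 2 * R ^ α) * (C' + 1))
  refine (tsum_of_norm_bounded hgeo hterm).trans (le_of_eq ?_)
  norm_num
  ring

end MittagLeffler


/-! ### Weights of the random polynomials -/

/-- The rescaled inverse norms of the monomials. -/
def rescaledWeight (m : Measure ℝ) (α : ℝ) (k n : ℕ) : ℝ :=
  Real.sqrt (α / 2 / ((n : ℝ) ^ (1 + 2 * (k : ℝ) / α) * radialMoment m k n))

section Weights

variable {m : Measure ℝ} {α lam : ℝ}

/-- The factor `α/2` in `rescaledWeight` cancels the one in `momentLimit`, so that the limit is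
exactly the Mittag-Leffler weight. -/
theorem sqrt_div_momentLimit (hα : 0 < α) (hlam : 0 < lam) (k : ℕ) :
    Real.sqrt (α / 2 / momentLimit α lam k) = mittagLefflerWeight α lam k := by
  have hX : 0 < 2 * lam / α := by positivity
  have h1 : α / 2 / momentLimit α lam k
      = (2 * lam / α) ^ (2 * (k : ℝ) / α) / Real.Gamma (1 + 2 * (k : ℝ) / α) := by
    rw [momentLimit]
    have := Real.rpow_pos_of_pos hX (2 * (k : ℝ) / α)
    have := Gamma_weight_pos hα k
    field_simp
  rw [h1, Real.sqrt_div (by positivity), mittagLefflerWeight]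
  congr 1
  rw [Real.sqrt_eq_rpow, ← Real.rpow_mul hX.le]
  congr 1
  ring

theorem IsRadialLaw.radialMoment_pos (hm : IsRadialLaw m) (hα : 0 < α) (hlam : 0 < lam)
    (hF : Tendsto (fun r : ℝ => cdf m r / r ^ α) (𝓝[>] 0) (𝓝 lam)) {k n : ℕ} (hkn : k ≤ n) :
    0 < radialMoment m k n := by
  rw [hm.radialMoment_eq_profileMoment]
  exact (hm.isRadialProfile hα hlam hF).profileMoment_pos hα hkn

theorem IsRadialLaw.isWeightArray (hm : IsRadialLaw m) (hα : 0 < α) (hlam : 0 < lam)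
    (hF : Tendsto (fun r : ℝ => cdf m r / r ^ α) (𝓝[>] 0) (𝓝 lam)) :
    IsWeightArray (rescaledWeight m α) (mittagLefflerWeight α lam) := by
  have hp := hm.isRadialProfile hα hlam hF
  refine ⟨fun k n hn hkn => ?_, fun k => ?_, fun R hR => ?_⟩
  · have hn' : (0 : ℝ) < n := by exact_mod_cast hn
    have := hm.radialMoment_pos hα hlam hF hkn
    exact Real.sqrt_pos.mpr (by positivity)
  · rw [← sqrt_div_momentLimit hα hlam]
    refine (Real.continuous_sqrt.tendsto _).comp ?_
    refine tendsto_const_nhds.div ?_ ?_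
    · simp_rw [hm.radialMoment_eq_profileMoment]
      exact hp.tendsto_profileMoment hα hlam k
    · have hX : 0 < 2 * lam / α := by positivity
      have := Gamma_weight_pos hα k
      have := Real.rpow_pos_of_pos hX (2 * (k : ℝ) / α)
      rw [momentLimit]
      positivity
  · obtain ⟨δ, hδ, h⟩ := hp.exists_profileMoment_ge hα hR
    refine ⟨Real.sqrt (α / 2 / δ), ?_⟩
    filter_upwards [h] with n hn k hkn
    have h1 := hn k hkn
    rw [← hm.radialMoment_eq_profileMoment] at h1
    calc rescaledWeight m α k n ≤ Real.sqrt (α / 2 / (δ * R ^ (2 * k))) := by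
          apply Real.sqrt_le_sqrt
          gcongr
      _ = Real.sqrt (α / 2 / δ) / R ^ k := by
          rw [← div_div, Real.sqrt_div (by positivity), mul_comm 2 k, pow_mul,
            Real.sqrt_sq (by positivity)]

/-- The inverse norm factors into a constant independent of `k`, invisible to zeros, a `k`-th power,
which is the zoom of the variable, and the rescaled weight. -/
theorem inv_sqrt_moment (hα : 0 < α) {n k : ℕ} (hn : 0 < n) {J : ℝ} (hJ : 0 < J) :
    (Real.sqrt J)⁻¹ = Real.sqrt ((n : ℝ) / (α / 2)) * ((n : ℝ) ^ (1 / α)) ^ k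
      * Real.sqrt (α / 2 / ((n : ℝ) ^ (1 + 2 * (k : ℝ) / α) * J)) := by
  have hn' : (0 : ℝ) < n := by exact_mod_cast hn
  have h1 : ((n : ℝ) ^ (1 / α)) ^ k = Real.sqrt ((n : ℝ) ^ (2 * (k : ℝ) / α)) := by
    rw [← rpow_one_div_pow hn'.le, mul_comm 2 k, pow_mul, Real.sqrt_sq (by positivity)]
  have := Real.rpow_pos_of_pos hn' (2 * (k : ℝ) / α)
  rw [h1, ← Real.sqrt_mul (by positivity), ← Real.sqrt_mul (by positivity), ← Real.sqrt_inv,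
    Real.rpow_add hn', Real.rpow_one]
  congr 1
  field_simp

end Weights

/-! ### Products of linear factors -/

theorem Polynomial.eval_eq_prod (P : Polynomial ℂ) (z : ℂ) :
    P.eval z = P.leadingCoeff * (P.roots.map fun w => z - w).prod :=
  (IsAlgClosed.splits P).eval_eq_prod_roots z

theorem exists_eq_prod_of_eval {P : Polynomial ℂ} (hP : P ≠ 0) {c κ : ℂ} (hc : c ≠ 0)
    (hκ : κ ≠ 0) {G : ℂ → ℂ} (hG : ∀ z, κ * G z = P.eval (c⁻¹ * z)) :
    ∃ K, K ≠ 0 ∧ G = fun z => K * ((P.roots.map fun w => c * w).map fun w => z - w).prod := by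
  refine ⟨κ⁻¹ * P.leadingCoeff * (P.roots.map fun _ => c⁻¹).prod, ?_, ?_⟩
  · refine mul_ne_zero (mul_ne_zero (inv_ne_zero hκ) (Polynomial.leadingCoeff_ne_zero.mpr hP)) ?_
    simp [hc]
  · ext z
    have h := hG z
    rw [Polynomial.eval_eq_prod] at h
    have h2 : (P.roots.map fun w => c⁻¹ * z - w).prod
        = (P.roots.map fun _ => c⁻¹).prod * (P.roots.map fun w => z - c * w).prod := by
      rw [← Multiset.prod_map_mul]
      congr 1
      refine Multiset.map_congr rfl fun w _ => ?_
      field_simp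
    rw [h2] at h
    rw [Multiset.map_map]
    simp only [Function.comp_def]
    rw [mul_assoc, mul_assoc, ← h, inv_mul_cancel_left₀ hκ]

/-- The roots of a reversed polynomial are the inverses of the original ones; exact degree `n` and a
nonzero constant term prevent roots from escaping to `0` or `∞`. The identity is checked off the
origin and extended by continuity. -/
theorem exists_eq_prod_of_reverse {P : Polynomial ℂ} {n : ℕ} (hdeg : P.natDegree = n)
    (hP0 : P.eval 0 ≠ 0) {c κ : ℂ} (hc : c ≠ 0) (hκ : κ ≠ 0) {G : ℂ → ℂ} (hGc : Continuous G)
    (hG : ∀ z, z ≠ 0 → κ * G z = z ^ n * P.eval ((c * z)⁻¹)) :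
    ∃ K, K ≠ 0 ∧ G = fun z => K * ((P.roots.map fun w => (c * w)⁻¹).map fun w => z - w).prod := by
  have hP : P ≠ 0 := by rintro rfl; simp at hP0
  have hroot : ∀ w ∈ P.roots, w ≠ 0 := by
    rintro w hw rfl
    exact hP0 ((Polynomial.mem_roots hP).mp hw)
  have hcard : P.roots.card = n := by
    rw [← (IsAlgClosed.splits P).natDegree_eq_card_roots, hdeg]
  refine ⟨κ⁻¹ * P.leadingCoeff * (P.roots.map fun w => -w).prod, ?_, ?_⟩
  · refine mul_ne_zero (mul_ne_zero (inv_ne_zero hκ) (Polynomial.leadingCoeff_ne_zero.mpr hP)) ?_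
    rw [Ne, Multiset.prod_eq_zero_iff, Multiset.mem_map]
    rintro ⟨w, hw, h0⟩
    exact hroot w hw (neg_eq_zero.mp h0)
  · refine Continuous.ext_on (dense_compl_singleton (0 : ℂ)) hGc ?_ fun z hz => ?_
    · refine continuous_const.mul ?_
      refine continuous_multiset_prod _ fun w _ => ?_
      fun_prop
    · have hz0 : z ≠ 0 := hz
      have h := hG z hz0
      rw [Polynomial.eval_eq_prod] at h
      have hpow : z ^ n = (P.roots.map fun _ => z).prod := by simp [hcard]
      have h2 : z ^ n * (P.roots.map fun w => (c * z)⁻¹ - w).prod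
          = (P.roots.map fun w => -w).prod * (P.roots.map fun w => z - (c * w)⁻¹).prod := by
        rw [hpow, ← Multiset.prod_map_mul, ← Multiset.prod_map_mul]
        congr 1
        refine Multiset.map_congr rfl fun w hw => ?_
        have := hroot w hw
        field_simp
        ring
      rw [mul_left_comm, h2] at h
      rw [Multiset.map_map]
      simp only [Function.comp_def]
      rw [mul_assoc, mul_assoc, ← h, inv_mul_cancel_left₀ hκ]

theorem zeros_eq_ofMultiset {G : ℂ → ℂ} (hG : Differentiable ℂ G) {s : Multiset ℂ} {K : ℂ}
    (hK : K ≠ 0) (h : G = fun z => K * (s.map fun w => z - w).prod) :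
    PointConfig.zeros G = PointConfig.ofMultiset s := by
  apply PointConfig.ext
  simp only [PointConfig.zeros, hG, dif_pos, PointConfig.ofMultiset]
  rw [h, zeroMeasure_multiset_prod s hK]

/-! ### Finite configurations, inversion and extremal moduli -/

theorem multisetMeasure_apply (s : Multiset ℂ) {A : Set ℂ} (hA : MeasurableSet A) :
    multisetMeasure s A = (s.map fun w => A.indicator (1 : ℂ → ENNReal) w).sum := by
  induction s using Multiset.induction with
  | empty => simp [multisetMeasure]
  | cons a s ih =>
    have h : multisetMeasure (a ::ₘ s) = Measure.dirac a + multisetMeasure s := by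
      simp [multisetMeasure]
    rw [h, Measure.add_apply, ih, Measure.dirac_apply' _ hA, Multiset.map_cons, Multiset.sum_cons]

theorem ofMultiset_inv_punctured_inverted {s : Multiset ℂ} (hs : ∀ w ∈ s, w ≠ 0) :
    (PointConfig.ofMultiset (s.map fun w => w⁻¹)).punctured.inverted
      = (PointConfig.ofMultiset s).punctured := by
  have he : MeasurableEmbedding (Subtype.val : PuncturedPlane → ℂ) :=
    MeasurableEmbedding.subtype_coe (measurableSet_singleton (0 : ℂ)).compl
  have hm : Measurable PuncturedPlane.inversion := PuncturedPlane.inversion.continuous.measurable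
  apply PointConfig.ext
  ext A hA
  change ((multisetMeasure (s.map fun w => w⁻¹)).comap Subtype.val).map PuncturedPlane.inversion A
    = (multisetMeasure s).comap Subtype.val A
  rw [Measure.map_apply hm hA, he.comap_apply, he.comap_apply,
    multisetMeasure_apply _ (he.measurableSet_image.mpr (hm hA)),
    multisetMeasure_apply _ (he.measurableSet_image.mpr hA), Multiset.map_map]
  congr 1
  refine Multiset.map_congr rfl fun w hw => ?_
  have hw0 := hs w hw
  have hiff : w⁻¹ ∈ Subtype.val '' (PuncturedPlane.inversion ⁻¹' A)
      ↔ w ∈ (Subtype.val : PuncturedPlane → ℂ) '' A := by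
    constructor
    · rintro ⟨x, hx, hxw⟩
      refine ⟨PuncturedPlane.inversion x, hx, ?_⟩
      change x.1⁻¹ = w
      rw [hxw, inv_inv]
    · rintro ⟨x, hx, rfl⟩
      refine ⟨PuncturedPlane.inversion x, ?_, rfl⟩
      change PuncturedPlane.inversion (PuncturedPlane.inversion x) ∈ A
      have : PuncturedPlane.inversion (PuncturedPlane.inversion x) = x :=
        PuncturedPlane.inversion.left_inv x
      rwa [this]
  by_cases hA' : w ∈ (Subtype.val : PuncturedPlane → ℂ) '' A
  · rw [Function.comp_apply, Set.indicator_of_mem hA', Set.indicator_of_mem (hiff.mpr hA')]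
    rfl
  · rw [Function.comp_apply, Set.indicator_of_notMem hA',
      Set.indicator_of_notMem fun h => hA' (hiff.mp h)]

theorem mul_maxModulus_eq {G : ℂ → ℂ} (hGc : Continuous G) {s : Multiset ℂ} {K : ℂ} {c : ℝ}
    (hc : 0 < c) (hs0 : s ≠ 0) (hs : ∀ w ∈ s, w ≠ 0) (hK : K ≠ 0)
    (h : G = fun z => K * ((s.map fun w => ((c : ℂ) * w)⁻¹).map fun w => z - w).prod) :
    c * maxModulus s = (minZeroModulus G)⁻¹ := by
  have hzero : ∀ z, G z = 0 ↔ ∃ w ∈ s, ((c : ℂ) * w)⁻¹ = z := by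
    intro z
    rw [h]
    simp only [mul_eq_zero, hK, false_or, Multiset.prod_eq_zero_iff, Multiset.mem_map]
    constructor
    · rintro ⟨_, ⟨w, hw, rfl⟩, h1⟩
      exact ⟨w, hw, (sub_eq_zero.mp h1).symm⟩
    · rintro ⟨w, hw, rfl⟩
      exact ⟨_, ⟨w, hw, rfl⟩, sub_self _⟩
  obtain ⟨w₁, hw₁⟩ := Multiset.exists_mem_of_ne_zero hs0
  obtain ⟨z, hz, hmin⟩ := exists_minZeroModulus_eq hGc ⟨_, (hzero _).mpr ⟨w₁, hw₁, rfl⟩⟩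
  obtain ⟨w, hw, rfl⟩ := (hzero z).mp hz
  have hnorm : ∀ w : ℂ, ‖((c : ℂ) * w)⁻¹‖ = (c * ‖w‖)⁻¹ := fun w => by
    rw [norm_inv, norm_mul, Complex.norm_real, Real.norm_of_nonneg hc.le]
  have hmax : IsGreatest ((fun z : ℂ => ‖z‖) '' {z | z ∈ s}) ‖w‖ := by
    refine ⟨⟨w, hw, rfl⟩, ?_⟩
    rintro _ ⟨v, hv, rfl⟩
    have h1 := minZeroModulus_le ((hzero _).mpr ⟨v, hv, rfl⟩)
    have hw0 : 0 < ‖w‖ := norm_pos_iff.mpr (hs w hw)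
    have hv0 : 0 < ‖v‖ := norm_pos_iff.mpr (hs v hv)
    rw [hmin, hnorm, hnorm, inv_le_inv₀ (by positivity) (by positivity)] at h1
    exact le_of_mul_le_mul_left h1 hc
  rw [hmin, hnorm, inv_inv, maxModulus, hmax.csSup_eq]

theorem isGreatest_invZeroModuli {f : ℂ → ℂ} (hf : Continuous f) (hz : ∃ z, f z = 0)
    (h0 : f 0 ≠ 0) : IsGreatest (invZeroModuli f) (minZeroModulus f)⁻¹ := by
  obtain ⟨z, hz0, hmin⟩ := exists_minZeroModulus_eq hf hz
  have hne : z ≠ 0 := by rintro rfl; exact h0 hz0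
  have hpos := minZeroModulus_pos hf hz h0
  refine ⟨⟨z⁻¹, ⟨inv_ne_zero hne, by rwa [inv_inv]⟩, ?_⟩, ?_⟩
  · simp only [norm_inv, hmin]
  · rintro _ ⟨w, ⟨hw, hfw⟩, rfl⟩
    have h1 := minZeroModulus_le hfw
    rw [norm_inv] at h1
    exact (le_inv_comm₀ (norm_pos_iff.mpr hw) hpos).mpr h1

/-! ### The random polynomials in terms of weights -/

section RandomPoly

variable {ν : Measure ℂ} [IsProbabilityMeasure ν] {α lam : ℝ}

theorem eval_randomPoly (ν : Measure ℂ) (a : ℕ → ℂ) (n : ℕ) (z : ℂ) :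
    (randomPoly ν a n).eval z = ∑ k ∈ Finset.range (n + 1), a k *
      (((Real.sqrt (weightedInner ν n (Polynomial.X ^ k) (Polynomial.X ^ k)).re)⁻¹ : ℝ) : ℂ)
        * z ^ k := by
  simp [randomPoly, normalizedMonomial, Polynomial.eval_finsetSum, mul_assoc]

theorem coeff_randomPoly (ν : Measure ℂ) (a : ℕ → ℂ) (n k : ℕ) :
    (randomPoly ν a n).coeff k = if k ≤ n then a k *
      (((Real.sqrt (weightedInner ν n (Polynomial.X ^ k) (Polynomial.X ^ k)).re)⁻¹ : ℝ) : ℂ)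
      else 0 := by
  simp [randomPoly, normalizedMonomial, Polynomial.finsetSum_coeff, Polynomial.coeff_X_pow]

theorem natDegree_randomPoly_le (ν : Measure ℂ) (a : ℕ → ℂ) (n : ℕ) :
    (randomPoly ν a n).natDegree ≤ n := by
  rw [Polynomial.natDegree_le_iff_coeff_eq_zero]
  intro k hk
  rw [coeff_randomPoly, if_neg (by omega)]

/-- The constant `κ` collects every factor independent of `k`. -/
theorem IsAdmissibleBackground.randomPoly_eval_scaled (hν : IsAdmissibleBackground ν)
    (hα : 0 < α) (hlam : 0 < lam)
    (hF : Tendsto (fun r : ℝ => cdf (modulusLaw ν) r / r ^ α) (𝓝[>] 0) (𝓝 lam))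
    {n : ℕ} (hn : 0 < n) :
    ∃ κ : ℂ, κ ≠ 0 ∧ ∀ a z, κ * weightedPoly (rescaledWeight (modulusLaw ν) α) n a z
      = (randomPoly ν a n).eval ((((n : ℝ) ^ (1 / α) : ℝ) : ℂ)⁻¹ * z) := by
  have hn' : (0 : ℝ) < n := by exact_mod_cast hn
  set L := Real.exp (-2 * (n : ℝ) * ∫ s, Real.log s ∂(modulusLaw ν)) with hL
  have hL0 : 0 < L := Real.exp_pos _
  have hc := Real.rpow_pos_of_pos hn' (1 / α)
  refine ⟨(((Real.sqrt L)⁻¹ * Real.sqrt ((n : ℝ) / (α / 2)) : ℝ) : ℂ), ?_, fun a z => ?_⟩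
  · exact_mod_cast (mul_pos (inv_pos.mpr (Real.sqrt_pos.mpr hL0))
      (Real.sqrt_pos.mpr (by positivity))).ne'
  · rw [eval_randomPoly, weightedPoly, Finset.mul_sum]
    refine Finset.sum_congr rfl fun k hk => ?_
    have hkn : k ≤ n := by simpa [Nat.lt_succ_iff] using hk
    rw [hν.weightedInner_eq, Real.sqrt_mul hL0.le, mul_inv,
      inv_sqrt_moment (k := k) hα hn (hν.isRadialLaw.radialMoment_pos hα hlam hF hkn), rescaledWeight,
      mul_pow, inv_pow]
    have hcc : (((n : ℝ) ^ (1 / α) : ℝ) : ℂ) ≠ 0 := by exact_mod_cast hc.ne'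
    push_cast
    field_simp

/-- Reversal of the first `n + 1` terms of a sequence. -/
def reverseIndex (n k : ℕ) : ℕ := if k ≤ n then n - k else k

/-- Fixing the indices beyond `n` makes the reversal a permutation of all of `ℕ`, so it acts on the
whole random sequence. -/
theorem reverseIndex_involutive (n : ℕ) : Function.Involutive (reverseIndex n) := by
  intro k
  unfold reverseIndex
  split_ifs <;> omega

theorem IsAdmissibleBackground.weightedInner_eq_radialMoment_inv (hν : IsAdmissibleBackground ν)
    {n k : ℕ} (hkn : k ≤ n) : (weightedInner ν n (Polynomial.X ^ k) (Polynomial.X ^ k)).re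
      = radialMoment ((modulusLaw ν).map fun r => r⁻¹) (n - k) n := by
  have h1 := hν.isRadialLaw.radialMoment_inv (j := n - k) (n := n) (by omega)
  rw [show n - (n - k) = k by omega] at h1
  rw [hν.weightedInner_eq, h1, ← mul_assoc, ← Real.exp_add]
  have : -2 * (n : ℝ) * ∫ s, Real.log s ∂(modulusLaw ν)
    + 2 * (n : ℝ) * ∫ s, Real.log s ∂(modulusLaw ν) = 0 := by ring
  rw [this, Real.exp_zero, one_mul]

theorem IsAdmissibleBackground.randomPoly_eval_inv (hν : IsAdmissibleBackground ν)
    (hα : 0 < α) (hlam : 0 < lam)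
    (hF : Tendsto (fun r : ℝ => cdf ((modulusLaw ν).map fun r => r⁻¹) r / r ^ α) (𝓝[>] 0) (𝓝 lam))
    {n : ℕ} (hn : 0 < n) :
    ∃ κ : ℂ, κ ≠ 0 ∧ ∀ a z, z ≠ 0 →
      κ * weightedPoly (rescaledWeight ((modulusLaw ν).map fun r => r⁻¹) α) n
          (a ∘ reverseIndex n) z
        = z ^ n * (randomPoly ν a n).eval (((((n : ℝ) ^ (-(1 / α)) : ℝ) : ℂ) * z)⁻¹) := by
  have hn' : (0 : ℝ) < n := by exact_mod_cast hn
  have hc := Real.rpow_pos_of_pos hn' (1 / α)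
  have hcc : (((n : ℝ) ^ (1 / α) : ℝ) : ℂ) ≠ 0 := by exact_mod_cast hc.ne'
  refine ⟨((Real.sqrt ((n : ℝ) / (α / 2)) : ℝ) : ℂ) * (((n : ℝ) ^ (1 / α) : ℝ) : ℂ) ^ n,
    mul_ne_zero ?_ (pow_ne_zero _ hcc), fun a z hz => ?_⟩
  · exact_mod_cast (Real.sqrt_pos.mpr (show 0 < (n : ℝ) / (α / 2) by positivity)).ne'
  · rw [eval_randomPoly, weightedPoly, Finset.mul_sum, Finset.mul_sum,
      ← Finset.sum_range_reflect]
    refine Finset.sum_congr rfl fun k hk => ?_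
    have hkn : k ≤ n := by simpa [Nat.lt_succ_iff] using hk
    rw [show n + 1 - 1 - k = n - k by omega]
    have hrev : (a ∘ reverseIndex n) (n - k) = a k := by
      simp only [Function.comp_apply, reverseIndex]
      rw [if_pos (by omega)]
      congr 1; omega
    have hJ := hν.isRadialLaw.inv.radialMoment_pos hα hlam hF (show n - k ≤ n by omega)
    rw [hrev, hν.weightedInner_eq_radialMoment_inv hkn, inv_sqrt_moment (k := n - k) hα hn hJ, rescaledWeight, Real.rpow_neg hn'.le]
    have hz1 : z ^ n = z ^ (n - k) * z ^ k := by rw [← pow_add]; congr 1; omega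
    have hn1 : (((n : ℝ) ^ (1 / α) : ℝ) : ℂ) ^ n = (((n : ℝ) ^ (1 / α) : ℝ) : ℂ) ^ (n - k)
      * (((n : ℝ) ^ (1 / α) : ℝ) : ℂ) ^ k := by rw [← pow_add]; congr 1; omega
    rw [hz1, hn1, Complex.ofReal_inv, mul_inv, inv_inv, mul_pow, inv_pow]
    push_cast
    field_simp

end RandomPoly

/-! ### Growth of the coefficients -/

/-- Borel–Cantelli: by equality in law, `∑ P(log(1+|a_j|) > j) = ∑ P(log(1+|a_0|) > j)`, which is
finite because the mean is. -/
theorem IsAdmissibleCoefficients.ae_hasExpGrowth {Ω : Type*} [MeasurableSpace Ω] {μ : Measure Ω}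
    [IsProbabilityMeasure μ] {a : ℕ → Ω → ℂ} (ha : IsAdmissibleCoefficients μ a) :
    ∀ᵐ ω ∂μ, HasExpGrowth fun k => a k ω := by
  let _ : MeasureSpace Ω := ⟨μ⟩
  have : IsProbabilityMeasure (volume : Measure Ω) := ‹IsProbabilityMeasure μ›
  have h1 := tsum_prob_mem_Ioi_lt_top (X := fun ω => Real.log (1 + ‖a 0 ω‖)) ha.integrable_log
    (fun ω => Real.log_nonneg (by simp))
  have h2 : ∀ j : ℕ, μ {ω | Real.log (1 + ‖a j ω‖) ∈ Set.Ioi (j : ℝ)}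
      = μ {ω | Real.log (1 + ‖a 0 ω‖) ∈ Set.Ioi (j : ℝ)} := fun j =>
    ((ha.identDistrib j).comp (u := fun z : ℂ => Real.log (1 + ‖z‖)) (by fun_prop)).measure_mem_eq
      measurableSet_Ioi
  have h3 : ∑' j : ℕ, μ {ω | Real.log (1 + ‖a j ω‖) ∈ Set.Ioi (j : ℝ)} ≠ ⊤ := by
    simp_rw [h2]
    exact h1.ne
  filter_upwards [ae_eventually_notMem h3] with ω hω
  obtain ⟨N, hN⟩ := eventually_atTop.mp hω
  refine ⟨1 + ∑ k ∈ Finset.range N, ‖a k ω‖, fun k => ?_⟩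
  have hS : 0 ≤ ∑ k ∈ Finset.range N, ‖a k ω‖ := Finset.sum_nonneg fun _ _ => norm_nonneg _
  have he : 1 ≤ Real.exp 1 ^ k := one_le_pow₀ (Real.one_le_exp zero_le_one)
  rcases le_or_gt N k with hk | hk
  · have h4 := hN k hk
    simp only [Set.mem_Ioi, not_lt] at h4
    rw [Real.log_le_iff_le_exp (by positivity)] at h4
    have h5 : Real.exp (k : ℝ) = Real.exp 1 ^ k := by rw [← Real.exp_nat_mul, mul_one]
    rw [h5] at h4
    nlinarith
  · have h4 : ‖a k ω‖ ≤ ∑ k ∈ Finset.range N, ‖a k ω‖ :=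
      Finset.single_le_sum (f := fun k => ‖a k ω‖) (fun _ _ => norm_nonneg _)
        (Finset.mem_range.mpr hk)
    nlinarith


/-! ### Zero-free entire functions of finite order -/

/-- Borel–Carathéodory turns the bound on the real part into one on `|g|` over the circle of radius
`R/2`; Cauchy's estimate then gives `O((1 + R^α)/R^k)`. -/
theorem iteratedDeriv_eq_zero_of_re_le {g : ℂ → ℂ} (hg : Differentiable ℂ g) {A D α : ℝ}
    (hA : 0 < A) (hD : 0 < D) (hb : ∀ R : ℝ, 1 ≤ R → ∀ z, ‖z‖ ≤ R → (g z).re ≤ A + D * R ^ α)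
    {k : ℕ} (hk : α < k) (hk0 : 0 < k) : iteratedDeriv k g 0 = 0 := by
  have hbound : ∀ R : ℝ, 1 ≤ R → ‖iteratedDeriv k g 0‖
      ≤ k.factorial * (2 * (A + D * R ^ α) + 3 * ‖g 0‖) / (R / 2) ^ k := by
    intro R hR
    have hR0 : 0 < R := by linarith
    have hM : 0 < A + D * R ^ α := by positivity
    refine Complex.norm_iteratedDeriv_le_of_forall_mem_sphere_norm_le k (by positivity)
      hg.diffContOnCl fun z hz => ?_
    have hz' : ‖z‖ = R / 2 := by simpa using hz
    have h := Complex.borelCaratheodory (f := g) (R := R) (z := z) hM hg.differentiableOn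
      (fun w hw => hb R hR w (mem_ball_zero_iff.mp hw).le) hR0
      (mem_ball_zero_iff.mpr (by rw [hz']; linarith))
    rw [hz'] at h
    refine h.trans (le_of_eq ?_)
    field_simp
    ring
  have hlim : Tendsto (fun R : ℝ => k.factorial * (2 * (A + D * R ^ α) + 3 * ‖g 0‖) / (R / 2) ^ k)
      atTop (𝓝 0) := by
    have h1 : Tendsto (fun R : ℝ => R ^ (-((k : ℝ) - α))) atTop (𝓝 0) :=
      tendsto_rpow_neg_atTop (by linarith)
    have h2 : Tendsto (fun R : ℝ => R ^ (-(k : ℝ))) atTop (𝓝 0) :=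
      tendsto_rpow_neg_atTop (by exact_mod_cast hk0)
    have h3 := ((h2.const_mul (2 * A + 3 * ‖g 0‖)).add (h1.const_mul (2 * D))).const_mul
      (k.factorial * 2 ^ k : ℝ)
    simp only [mul_zero, add_zero] at h3
    refine h3.congr' ?_
    filter_upwards [eventually_gt_atTop 0] with R hR
    have h4 : R ^ (-((k : ℝ) - α)) = R ^ α * (R ^ k)⁻¹ := by
      rw [neg_sub, Real.rpow_sub hR, Real.rpow_natCast, div_eq_mul_inv]
    rw [h4, Real.rpow_neg hR.le, Real.rpow_natCast, div_pow]
    field_simp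
    ring
  have h0 : ‖iteratedDeriv k g 0‖ ≤ 0 :=
    ge_of_tendsto hlim ((eventually_ge_atTop 1).mono hbound)
  exact norm_le_zero_iff.mp h0

/-- A primitive `g` of `f'/f` is a logarithm of `f`, and `Re g = log |f|` grows at most like `R^α`,
so high derivatives of `g` vanish at the origin. The function provided is `h = g'`. -/
theorem exists_deriv_eq_mul_of_ne_zero {f : ℂ → ℂ} (hf : Differentiable ℂ f) (h0 : ∀ z, f z ≠ 0)
    {C D α : ℝ} (hC : 0 < C) (hD : 0 < D)
    (hb : ∀ R : ℝ, 1 ≤ R → ∀ z, ‖z‖ ≤ R → ‖f z‖ ≤ C * Real.exp (D * R ^ α)) :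
    ∃ h : ℂ → ℂ, Differentiable ℂ h ∧ deriv f = h * f ∧
      ∀ k : ℕ, α < k → iteratedDeriv k h 0 = 0 := by
  have hf' : Differentiable ℂ (deriv f) :=
    (hf.contDiff (n := 2)).differentiable_deriv_two
  have hh : Differentiable ℂ fun z => deriv f z / f z := hf'.div hf h0
  obtain ⟨g, hg0, hg⟩ := hh.isExactOn_univ.with_val_at 0 (Complex.log (f 0))
  have hgd : ∀ z, HasDerivAt g (deriv f z / f z) z := fun z => hg z (Set.mem_univ _)
  have hg' : Differentiable ℂ g := fun z => (hgd z).differentiableAt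
  have hfg : ∀ z, f z = Complex.exp (g z) := by
    have hd : ∀ z, HasDerivAt (fun z => f z * Complex.exp (-g z)) 0 z := by
      intro z
      have h1 : HasDerivAt (fun z => f z * Complex.exp (-g z)) (deriv f z * Complex.exp (-g z)
          + f z * (Complex.exp (-g z) * -(deriv f z / f z))) z :=
        (hf z).hasDerivAt.mul ((hgd z).neg.cexp)
      refine h1.congr_deriv ?_
      have h2 : f z * (deriv f z / f z) = deriv f z := mul_div_cancel₀ _ (h0 z)
      linear_combination -Complex.exp (-g z) * h2
    intro z
    have h1 : f z * Complex.exp (-g z) = f 0 * Complex.exp (-g 0) :=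
      is_const_of_deriv_eq_zero (fun z => (hd z).differentiableAt) (fun z => (hd z).deriv) z 0
    rw [hg0, Complex.exp_neg, Complex.exp_neg, Complex.exp_log (h0 0), mul_inv_cancel₀ (h0 0)] at h1
    rw [← div_eq_mul_inv, div_eq_one_iff_eq (Complex.exp_ne_zero _)] at h1
    exact h1
  refine ⟨deriv g, (hg'.contDiff (n := 2)).differentiable_deriv_two, ?_, fun k hk => ?_⟩
  · ext z
    rw [Pi.mul_apply, (hgd z).deriv, div_mul_cancel₀ _ (h0 z)]
  · rw [← iteratedDeriv_succ']
    refine iteratedDeriv_eq_zero_of_re_le hg' (A := |Real.log C| + 1) (by positivity) hD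
      (α := α) (fun R hR z hz => ?_) (by push_cast; linarith) (Nat.succ_pos _)
    have h1 := hb R hR z hz
    rw [hfg, Complex.norm_exp, ← Real.le_log_iff_exp_le (by positivity),
      Real.log_mul hC.ne' (Real.exp_pos _).ne', Real.log_exp] at h1
    linarith [le_abs_self (Real.log C)]

/-! ### Taylor coefficients of the logarithmic derivative -/

/-- The derivatives at `0` of `f' / f`, in terms of those of `f`. -/
def logDerivCoeff (b : ℕ → ℂ) (k : ℕ) : ℂ :=
  (b (k + 1) - ∑ i : Fin k, (k.choose i : ℂ) * logDerivCoeff b i * b (k - i)) / b 0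
termination_by k
decreasing_by exact i.2

/-- Dependence on finitely many entries only; this is what makes independence usable one index at a
time. -/
theorem logDerivCoeff_congr {b b' : ℕ → ℂ} (k : ℕ) (h : ∀ i ≤ k + 1, b i = b' i) :
    logDerivCoeff b k = logDerivCoeff b' k := by
  induction k using Nat.strong_induction_on with
  | _ k ih =>
    rw [logDerivCoeff, logDerivCoeff, h (k + 1) le_rfl, h 0 (by omega)]
    congr 2
    refine Finset.sum_congr rfl fun i _ => ?_
    have hi := i.2
    rw [ih i hi fun j hj => h j (by omega), h (k - i) (by omega)]

theorem measurable_logDerivCoeff (k : ℕ) : Measurable fun b => logDerivCoeff b k := by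
  induction k using Nat.strong_induction_on with
  | _ k ih =>
    have : (fun b => logDerivCoeff b k) = fun b : ℕ → ℂ =>
        (b (k + 1) - ∑ i : Fin k, (k.choose i : ℂ) * logDerivCoeff b i * b (k - i)) / b 0 := by
      ext b
      rw [logDerivCoeff]
    rw [this]
    refine Measurable.div (Measurable.sub (measurable_pi_apply _) ?_) (measurable_pi_apply _)
    refine Finset.measurable_fun_sum _ fun i _ => ?_
    exact ((ih i i.2).const_mul _).mul (measurable_pi_apply _)

/-- Leibniz's rule for `f' = h f`, solved for the highest derivative of `h`. -/
theorem iteratedDeriv_eq_logDerivCoeff {f h : ℂ → ℂ} (hf : Differentiable ℂ f)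
    (hh : Differentiable ℂ h) (h0 : f 0 ≠ 0) (heq : deriv f = h * f) (k : ℕ) :
    iteratedDeriv k h 0 = logDerivCoeff (fun j => iteratedDeriv j f 0) k := by
  induction k using Nat.strong_induction_on with
  | _ k ih =>
    rw [logDerivCoeff, eq_div_iff (by simpa using h0), iteratedDeriv_succ', heq,
      iteratedDeriv_mul hh.contDiff.contDiffAt hf.contDiff.contDiffAt, Finset.sum_range_succ,
      ← Fin.sum_univ_eq_sum_range
        (fun i => (k.choose i : ℂ) * iteratedDeriv i h 0 * iteratedDeriv (k - i) f 0)]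
    have : ∑ i : Fin k, (k.choose i : ℂ) * logDerivCoeff (fun j => iteratedDeriv j f 0) i
        * iteratedDeriv (k - i) f 0
        = ∑ i : Fin k, (k.choose i : ℂ) * iteratedDeriv i h 0 * iteratedDeriv (k - i) f 0 :=
      Finset.sum_congr rfl fun i _ => by rw [ih i i.2]
    rw [this]
    simp

theorem iteratedDeriv_eq_of_hasSum {f : ℂ → ℂ} {b : ℕ → ℂ}
    (h : ∀ z, HasSum (fun k => b k * z ^ k) (f z)) (k : ℕ) :
    iteratedDeriv k f 0 = k.factorial * b k := by
  have h1 : HasFPowerSeriesAt f (FormalMultilinearSeries.ofScalars ℂ b) 0 := by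
    rw [hasFPowerSeriesAt_iff]
    refine Eventually.of_forall fun z => ?_
    simpa [FormalMultilinearSeries.coeff_ofScalars, mul_comm] using h z
  have h2 := h1.eq_formalMultilinearSeries (h1.analyticAt.hasFPowerSeriesAt)
  have h3 := congrArg (fun p => FormalMultilinearSeries.coeff p k) h2
  simp only [FormalMultilinearSeries.coeff_ofScalars] at h3
  rw [h3, mul_div_cancel₀ _ (by exact_mod_cast k.factorial_ne_zero)]

/-! ### A random series is not the exponential of a polynomial -/

/-- By Fubini: once `W` is frozen, `X` must hit one prescribed value. -/
theorem measure_eq_and_mem_le {Ω E : Type*} [MeasurableSpace Ω] [MeasurableSpace E]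
    {μ : Measure Ω} [IsProbabilityMeasure μ] {X : Ω → ℂ} {W : Ω → E} (hX : Measurable X)
    (hW : Measurable W) (hind : IndepFun W X μ) {p : ENNReal} (hp : ∀ c, μ {ω | X ω = c} ≤ p)
    {S : Set E} (hS : MeasurableSet S) {φ : E → ℂ} (hφ : Measurable φ) :
    μ {ω | W ω ∈ S ∧ X ω = φ (W ω)} ≤ p * μ {ω | W ω ∈ S} := by
  have hT : MeasurableSet {q : E × ℂ | q.1 ∈ S ∧ q.2 = φ q.1} :=
    (measurable_fst hS).inter (measurableSet_eq_fun measurable_snd (hφ.comp measurable_fst))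
  have h1 : μ {ω | W ω ∈ S ∧ X ω = φ (W ω)}
      = (μ.map fun ω => (W ω, X ω)) {q : E × ℂ | q.1 ∈ S ∧ q.2 = φ q.1} := by
    rw [Measure.map_apply (hW.prodMk hX) hT]
    rfl
  rw [h1, (indepFun_iff_map_prod_eq_prod_map_map hW.aemeasurable hX.aemeasurable).mp hind]
  have : IsProbabilityMeasure (μ.map X) := Measure.isProbabilityMeasure_map hX.aemeasurable
  rw [Measure.prod_apply hT]
  have h2 : ∀ x : E, (μ.map X) (Prod.mk x ⁻¹' {q : E × ℂ | q.1 ∈ S ∧ q.2 = φ q.1})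
      ≤ S.indicator (fun _ => p) x := by
    intro x
    by_cases hx : x ∈ S
    · rw [Set.indicator_of_mem hx]
      have : Prod.mk x ⁻¹' {q : E × ℂ | q.1 ∈ S ∧ q.2 = φ q.1} = {φ x} := by
        ext y; simp [hx]
      rw [this, Measure.map_apply hX (measurableSet_singleton _)]
      exact hp _
    · have : Prod.mk x ⁻¹' {q : E × ℂ | q.1 ∈ S ∧ q.2 = φ q.1} = ∅ := by
        ext y; simp [hx]
      rw [this]
      simp
  refine (lintegral_mono h2).trans ?_
  rw [lintegral_indicator_const hS, Measure.map_apply hW hS]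
  rfl

/-- If some atom exceeds `1/2`, all others are below `1/2`, so the largest mass is attained and is
less than `1`; otherwise `1/2` works. -/
theorem exists_lt_one_measure_eq_le {Ω : Type*} [MeasurableSpace Ω] {μ : Measure Ω}
    [IsProbabilityMeasure μ] {X : Ω → ℂ} (hX : Measurable X)
    (h : ¬ ∃ c : ℂ, ∀ᵐ ω ∂μ, X ω = c) :
    ∃ p < (1 : ENNReal), ∀ c, μ {ω | X ω = c} ≤ p := by
  have hmeas : ∀ c, MeasurableSet {ω | X ω = c} := fun c => hX (measurableSet_singleton c)
  have hlt : ∀ c, μ {ω | X ω = c} < 1 := by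
    intro c
    refine lt_of_le_of_ne prob_le_one fun h1 => h ⟨c, ?_⟩
    exact (mem_ae_iff_prob_eq_one (hmeas c)).mpr h1
  by_cases hbig : ∃ c, (1 / 2 : ENNReal) < μ {ω | X ω = c}
  · obtain ⟨c, hc⟩ := hbig
    refine ⟨_, hlt c, fun c' => ?_⟩
    by_cases hcc : c' = c
    · rw [hcc]
    · have hdisj : {ω | X ω = c'} ⊆ {ω | X ω = c}ᶜ := fun ω hω hω' =>
        hcc ((show X ω = c' from hω).symm.trans hω')
      refine (measure_mono hdisj).trans ?_
      rw [prob_compl_eq_one_sub (hmeas c)]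
      refine le_trans ?_ hc.le
      rw [tsub_le_iff_right]
      calc (1 : ENNReal) = 1 / 2 + 1 / 2 := (ENNReal.add_halves 1).symm
        _ ≤ _ := by gcongr
  · push Not at hbig
    exact ⟨1 / 2, by simp, hbig⟩

/-- The equation of index `k` is affine in `a_(k+1)` with nonzero slope, so it prescribes `a_(k+1)`
in terms of earlier coefficients. By independence each further equation costs a factor `p < 1`. -/
theorem measure_forall_logDerivCoeff_eq_zero {Ω : Type*} [MeasurableSpace Ω] {μ : Measure Ω}
    [IsProbabilityMeasure μ] {a : ℕ → Ω → ℂ} (ha : IsAdmissibleCoefficients μ a) {c : ℕ → ℂ}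
    (hc : ∀ k, c k ≠ 0) (d : ℕ) :
    μ {ω | a 0 ω ≠ 0 ∧ ∀ k, d ≤ k → logDerivCoeff (fun j => c j * a j ω) k = 0} = 0 := by
  obtain ⟨p, hp1, hp⟩ := exists_lt_one_measure_eq_le (ha.measurable 0) ha.not_deterministic
  have hpk : ∀ k x, μ {ω | a k ω = x} ≤ p := fun k x =>
    ((ha.identDistrib k).measure_mem_eq (measurableSet_singleton x)).trans_le (hp x)
  set E : ℕ → Set Ω := fun K => {ω | a 0 ω ≠ 0 ∧
    ∀ k, d ≤ k → k < d + K → logDerivCoeff (fun j => c j * a j ω) k = 0} with hE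
  have hstep : ∀ K, μ (E (K + 1)) ≤ p * μ (E K) := by
    intro K
    set N := d + K with hN
    -- the first `N + 1` coefficients
    let ext' : (Finset.range (N + 1) → ℂ) → ℕ → ℂ := fun w j =>
      if hj : j ∈ Finset.range (N + 1) then c j * w ⟨j, hj⟩ else 0
    have hext : Measurable ext' := by
      refine measurable_pi_lambda _ fun j => ?_
      by_cases hj : j ∈ Finset.range (N + 1)
      · simp only [ext', hj, dif_pos]
        exact (measurable_pi_apply _).const_mul _
      · simp only [ext', hj, dif_neg, not_false_iff]
        exact measurable_const
    let W : Ω → (Finset.range (N + 1) → ℂ) := fun ω i => a i ω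
    have hW : Measurable W := measurable_pi_lambda _ fun i => ha.measurable i
    have hind : IndepFun W (a (N + 1)) μ := by
      have h := ha.indep.indepFun_finset (Finset.range (N + 1)) {N + 1} (by simp) ha.measurable
      exact h.comp (φ := id) (ψ := fun v => v ⟨N + 1, Finset.mem_singleton_self _⟩) measurable_id
        (measurable_pi_apply (⟨N + 1, Finset.mem_singleton_self _⟩ : ({N + 1} : Finset ℕ)))
    have hextW : ∀ ω, ∀ j ≤ N, ext' (W ω) j = c j * a j ω := by
      intro ω j hj
      have : j ∈ Finset.range (N + 1) := by simp; omega
      simp only [ext', this, dif_pos, W]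
    let S : Set (Finset.range (N + 1) → ℂ) := {w | ext' w 0 ≠ 0 ∧
      ∀ k, d ≤ k → k < N → logDerivCoeff (ext' w) k = 0}
    have hS : MeasurableSet S := by
      have h1 : MeasurableSet {w | ext' w 0 ≠ 0} :=
        ((measurable_pi_apply 0).comp hext) (measurableSet_singleton (0 : ℂ)).compl
      have h2 : MeasurableSet {w | ∀ k, d ≤ k → k < N → logDerivCoeff (ext' w) k = 0} := by
        have : {w | ∀ k, d ≤ k → k < N → logDerivCoeff (ext' w) k = 0}
            = ⋂ k, ⋂ (_ : d ≤ k), ⋂ (_ : k < N), {w | logDerivCoeff (ext' w) k = 0} := by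
          ext w; simp
        rw [this]
        exact MeasurableSet.iInter fun k => MeasurableSet.iInter fun _ => MeasurableSet.iInter
          fun _ => ((measurable_logDerivCoeff k).comp hext) (measurableSet_singleton (0 : ℂ))
      exact h1.inter h2
    -- The value of `a (N + 1)` forced by the vanishing of the coefficient of index `N`.
    let φ : (Finset.range (N + 1) → ℂ) → ℂ := fun w =>
      (c (N + 1))⁻¹ * ∑ i : Fin N, (N.choose i : ℂ) * logDerivCoeff (ext' w) i * ext' w (N - i)
    have hφ : Measurable φ := by
      refine Measurable.const_mul ?_ _
      refine Finset.measurable_fun_sum _ fun i _ => ?_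
      exact (((measurable_logDerivCoeff i).comp hext).const_mul _).mul
        (measurable_pi_iff.mp hext _)
    have hSE : {ω | W ω ∈ S} ⊆ E K := by
      rintro ω ⟨h1, h2⟩
      refine ⟨?_, fun k hk hkN => ?_⟩
      · rw [hextW ω 0 (Nat.zero_le _)] at h1
        exact right_ne_zero_of_mul h1
      · rw [← h2 k hk hkN]
        exact logDerivCoeff_congr k fun j hj => (hextW ω j (by omega)).symm
    have hsub : E (K + 1) ⊆ {ω | W ω ∈ S ∧ a (N + 1) ω = φ (W ω)} := by
      rintro ω ⟨h1, h2⟩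
      refine ⟨⟨?_, fun k hk hkN => ?_⟩, ?_⟩
      · rw [hextW ω 0 (Nat.zero_le _)]
        exact mul_ne_zero (hc 0) h1
      · rw [← h2 k hk (by omega)]
        exact logDerivCoeff_congr k fun j hj => hextW ω j (by omega)
      · have h3 := h2 N (by omega) (by omega)
        rw [logDerivCoeff, div_eq_zero_iff, or_iff_left (mul_ne_zero (hc 0) h1),
          sub_eq_zero] at h3
        have h4 : ∑ i : Fin N, (N.choose i : ℂ) * logDerivCoeff (ext' (W ω)) i
            * ext' (W ω) (N - i) = c (N + 1) * a (N + 1) ω := by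
          rw [h3]
          refine Finset.sum_congr rfl fun i _ => ?_
          have hi := i.2
          rw [hextW ω (N - i) (by omega),
            logDerivCoeff_congr i fun j hj => hextW ω j (by omega)]
        simp only [φ]
        rw [h4, inv_mul_cancel_left₀ (hc _)]
    calc μ (E (K + 1)) ≤ _ := measure_mono hsub
      _ ≤ p * μ {ω | W ω ∈ S} :=
        measure_eq_and_mem_le (ha.measurable _) hW hind (hpk _) hS hφ
      _ ≤ p * μ (E K) := by gcongr
  have hpow : ∀ K, μ (E K) ≤ p ^ K := by
    intro K
    induction K with
    | zero => simpa using prob_le_one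
    | succ K ih => rw [pow_succ']; exact (hstep K).trans (by gcongr)
  have hlim : Tendsto (fun K => p ^ K) atTop (𝓝 0) :=
    ENNReal.tendsto_pow_atTop_nhds_zero_of_lt_one hp1
  refine le_antisymm (ge_of_tendsto' hlim fun K => ?_) bot_le
  refine (measure_mono ?_).trans (hpow K)
  rintro ω ⟨h1, h2⟩
  exact ⟨h1, fun k hk _ => h2 k hk⟩

/-- The array constant in `n` makes partial sums of the limiting series an instance of the general
convergence theorem; entireness and measurability follow from it. -/
theorem isWeightArray_mittagLefflerWeight {α lam : ℝ} (hα : 0 < α) (hlam : 0 < lam) :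
    IsWeightArray (fun k _ => mittagLefflerWeight α lam k) (mittagLefflerWeight α lam) :=
  ⟨fun k _ _ _ => mittagLefflerWeight_pos hα hlam k, fun _ => tendsto_const_nhds,
    fun _ hR => ⟨_, Eventually.of_forall fun _ k _ => mittagLefflerWeight_le hα hlam hR k⟩⟩

theorem differentiable_mittagLefflerFun {α lam : ℝ} (hα : 0 < α) (hlam : 0 < lam) {a : ℕ → ℂ}
    (ha : HasExpGrowth a) : Differentiable ℂ (mittagLefflerFun α lam a) := by
  rw [mittagLefflerFun_eq]
  exact (isWeightArray_mittagLefflerWeight hα hlam).differentiable_weightedSeries ha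

theorem ae_exists_mittagLefflerFun_eq_zero {Ω : Type*} [MeasurableSpace Ω] {μ : Measure Ω}
    [IsProbabilityMeasure μ] {a : ℕ → Ω → ℂ} (ha : IsAdmissibleCoefficients μ a) {α lam : ℝ}
    (hα : 0 < α) (hlam : 0 < lam) :
    ∀ᵐ ω ∂μ, ∃ z, mittagLefflerFun α lam (fun k => a k ω) z = 0 := by
  obtain ⟨d, hd⟩ := exists_nat_gt α
  have hw : ∀ k : ℕ, (k.factorial : ℂ) * (mittagLefflerWeight α lam k : ℂ) ≠ 0 := fun k =>
    mul_ne_zero (by exact_mod_cast k.factorial_ne_zero)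
      (by exact_mod_cast (mittagLefflerWeight_pos hα hlam k).ne')
  have hnull := measure_forall_logDerivCoeff_eq_zero ha hw d
  filter_upwards [ha.ae_hasExpGrowth, ha.ne_zero, measure_eq_zero_iff_ae_notMem.mp hnull]
    with ω hω h0 hn
  by_contra! hz
  refine hn ⟨h0, fun k hk => ?_⟩
  have hf := differentiable_mittagLefflerFun hα hlam hω
  obtain ⟨C, hC, D, hD, hb⟩ := norm_mittagLefflerFun_le hα hlam hω
  obtain ⟨h, hh, heq, hzero⟩ := exists_deriv_eq_mul_of_ne_zero hf hz hC hD hb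
  rw [← hzero k (hd.trans_le (by exact_mod_cast hk)),
    iteratedDeriv_eq_logDerivCoeff hf hh (hz 0) heq]
  congr 1
  ext j
  rw [iteratedDeriv_eq_of_hasSum
    (b := fun j => (mittagLefflerWeight α lam j : ℂ) * a j ω) (fun z => ?_), mul_assoc]
  have h1 := (summable_mittagLefflerTerm hα hlam hω z).hasSum
  have h2 : mittagLefflerTerm α lam (fun k => a k ω) z
      = fun k => (mittagLefflerWeight α lam k : ℂ) * a k ω * z ^ k := by
    ext k
    rw [mittagLefflerTerm_eq]
    ring
  rw [h2] at h1
  rw [mittagLefflerFun, h2]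
  exact h1


/-! ### Measurability and reversal of the coefficients -/

section Coefficients

variable {Ω : Type*} [MeasurableSpace Ω] {μ : Measure Ω} {a : ℕ → Ω → ℂ}

theorem IsAdmissibleCoefficients.measurable_seq (ha : IsAdmissibleCoefficients μ a) :
    Measurable fun ω k => a k ω :=
  measurable_pi_lambda _ ha.measurable

theorem IsAdmissibleCoefficients.ae_ne_zero (ha : IsAdmissibleCoefficients μ a) (k : ℕ) :
    ∀ᵐ ω ∂μ, a k ω ≠ 0 :=
  ((ha.identDistrib k).symm).ae_snd (measurableSet_singleton (0 : ℂ)).compl ha.ne_zero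

/-- Both laws are the infinite product of the same marginals. -/
theorem IsAdmissibleCoefficients.map_comp_reverseIndex (ha : IsAdmissibleCoefficients μ a)
    (n : ℕ) : μ.map (fun ω => (fun k => a k ω) ∘ reverseIndex n) = μ.map fun ω k => a k ω := by
  have h1 := (ha.indep.precomp (reverseIndex_involutive n).injective).map_fun_eq_infinitePi_map
    fun k => ha.measurable _
  have h2 := ha.indep.map_fun_eq_infinitePi_map ha.measurable
  have h3 : (fun k => μ.map (a (reverseIndex n k))) = fun k => μ.map (a k) := by
    ext1 k
    rw [(ha.identDistrib _).map_eq, (ha.identDistrib k).map_eq]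
  rw [h2, ← h3, ← h1]
  rfl

/-- Zeros depend continuously on the coefficients only where the relevant end coefficients are
nonzero; that set has full measure. Taking `n = 0` leaves only the condition on `v 0`. -/
theorem IsAdmissibleCoefficients.aemeasurable_of_continuousOn (ha : IsAdmissibleCoefficients μ a)
    {E : Type*} [TopologicalSpace E] [MeasurableSpace E] [BorelSpace E] {T : (ℕ → ℂ) → E} {n : ℕ}
    (hT : ContinuousOn T {v | v 0 ≠ 0 ∧ v n ≠ 0}) :
    AEMeasurable T (μ.map fun ω k => a k ω) := by
  have hS : MeasurableSet {v : ℕ → ℂ | v 0 ≠ 0 ∧ v n ≠ 0} :=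
    (measurableSet_eq_fun (measurable_pi_apply 0) measurable_const).compl.inter
      (measurableSet_eq_fun (measurable_pi_apply n) measurable_const).compl
  have h := hT.aemeasurable (μ := μ.map fun ω k => a k ω) hS
  rwa [Measure.restrict_eq_self_of_ae_mem] at h
  refine (ae_map_iff ha.measurable_seq.aemeasurable hS).mpr ?_
  filter_upwards [ha.ae_ne_zero 0, ha.ae_ne_zero n] with ω h1 h2 using ⟨h1, h2⟩

theorem IsAdmissibleCoefficients.aemeasurable_comp_reverse (ha : IsAdmissibleCoefficients μ a)
    {E : Type*} [MeasurableSpace E] {T : (ℕ → ℂ) → E}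
    (hT : AEMeasurable T (μ.map fun ω k => a k ω)) (n : ℕ) :
    AEMeasurable (fun ω => T ((fun k => a k ω) ∘ reverseIndex n)) μ := by
  rw [← ha.map_comp_reverseIndex n] at hT
  exact hT.comp_measurable (measurable_pi_lambda _ fun k => ha.measurable _)

/-- For each `n` the statistic has the same law on the sequence and on its reversal, so almost sure
convergence along the reversals gives convergence in law for the original. -/
theorem IsAdmissibleCoefficients.tendstoInDistribution_of_reverse
    [IsProbabilityMeasure μ] (ha : IsAdmissibleCoefficients μ a) {E : Type*} [TopologicalSpace E]
    [MeasurableSpace E] [BorelSpace E] {T : ℕ → (ℕ → ℂ) → E}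
    (hT : ∀ n, AEMeasurable (T n) (μ.map fun ω k => a k ω)) {Z : Ω → E} (hZ : AEMeasurable Z μ)
    (h : ∀ᵐ ω ∂μ, Tendsto (fun n => T n ((fun k => a k ω) ∘ reverseIndex n)) atTop (𝓝 (Z ω))) :
    TendstoInDistribution (fun n ω => T n fun k => a k ω) atTop Z (fun _ => μ) μ := by
  have h1 := tendstoInDistribution_of_ae_tendsto
    (fun n => ha.aemeasurable_comp_reverse (hT n) n) hZ h
  refine ⟨fun n => (hT n).comp_measurable ha.measurable_seq, hZ, ?_⟩
  refine h1.tendsto.congr fun n => Subtype.ext ?_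
  have e1 := AEMeasurable.map_map_of_aemeasurable (hT n) ha.measurable_seq.aemeasurable
  have hT' := hT n
  rw [← ha.map_comp_reverseIndex n] at hT'
  have e2 := AEMeasurable.map_map_of_aemeasurable hT'
    (measurable_pi_lambda _ fun k => ha.measurable (reverseIndex n k)).aemeasurable
  rw [ha.map_comp_reverseIndex n] at e2
  exact e2.symm.trans e1

end Coefficients

/-! ### Zeros of weighted polynomials -/

section Weighted

variable {d : ℕ → ℕ → ℝ} {c : ℕ → ℝ}

theorem continuousAt_zeros_weightedPoly {n : ℕ} (hd : d 0 n ≠ 0) {v : ℕ → ℂ} (hv : v 0 ≠ 0) :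
    ContinuousAt (fun v => PointConfig.zeros (weightedPoly d n v)) v := by
  refine (tendstoOnDisks_weightedPoly_coeff d n v).tendsto_zeros
    (differentiable_weightedPoly d n) (differentiable_weightedPoly d n v) fun h => ?_
  have h1 := congrFun h 0
  rw [weightedPoly_zero] at h1
  exact mul_ne_zero hv (by exact_mod_cast hd) h1

theorem continuousAt_inv_minZeroModulus_weightedPoly {n : ℕ} (hd : d 0 n ≠ 0) {v : ℕ → ℂ}
    (hv : v 0 ≠ 0) (hz : ∃ z, weightedPoly d n v z = 0) :
    ContinuousAt (fun v => (minZeroModulus (weightedPoly d n v))⁻¹) v := by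
  have h0 : weightedPoly d n v 0 ≠ 0 := by
    rw [weightedPoly_zero]
    exact mul_ne_zero hv (by exact_mod_cast hd)
  have h1 := (tendstoOnDisks_weightedPoly_coeff d n v).tendsto_minZeroModulus
    (differentiable_weightedPoly d n) (differentiable_weightedPoly d n v)
    (fun h => h0 (congrFun h 0)) hz
  exact h1.inv₀ (minZeroModulus_pos (differentiable_weightedPoly d n v).continuous hz h0).ne'

theorem IsWeightArray.tendsto_zeros (h : IsWeightArray d c) (hc : c 0 ≠ 0) {a : ℕ → ℂ}
    (ha : HasExpGrowth a) (h0 : a 0 ≠ 0) :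
    Tendsto (fun n => PointConfig.zeros (weightedPoly d n a)) atTop
      (𝓝 (PointConfig.zeros (weightedSeries c a))) := by
  refine (h.tendstoOnDisks ha).tendsto_zeros (fun n => differentiable_weightedPoly d n a)
    (h.differentiable_weightedSeries ha) fun hz => ?_
  have h1 := congrFun hz 0
  rw [weightedSeries_zero] at h1
  exact mul_ne_zero h0 (by exact_mod_cast hc) h1

theorem IsWeightArray.tendsto_inv_minZeroModulus (h : IsWeightArray d c) (hc : c 0 ≠ 0)
    {a : ℕ → ℂ} (ha : HasExpGrowth a) (h0 : a 0 ≠ 0) (hz : ∃ z, weightedSeries c a z = 0) :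
    Tendsto (fun n => (minZeroModulus (weightedPoly d n a))⁻¹) atTop
      (𝓝 (minZeroModulus (weightedSeries c a))⁻¹) := by
  have h1 : weightedSeries c a 0 ≠ 0 := by
    rw [weightedSeries_zero]
    exact mul_ne_zero h0 (by exact_mod_cast hc)
  have hd := h.differentiable_weightedSeries ha
  exact ((h.tendstoOnDisks ha).tendsto_minZeroModulus (fun n => differentiable_weightedPoly d n a)
    hd (fun h => h1 (congrFun h 0)) hz).inv₀ (minZeroModulus_pos hd.continuous hz h1).ne'

end Weighted

/-! ### Convergence at the origin -/

theorem roots_randomPoly_zero (ν : Measure ℂ) (a : ℕ → ℂ) : (randomPoly ν a 0).roots = 0 := by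
  rw [Polynomial.eq_C_of_natDegree_le_zero (natDegree_randomPoly_le ν a 0), Polynomial.roots_C]

section Limits

variable {Ω : Type*} [MeasurableSpace Ω] {μ : Measure Ω} {a : ℕ → Ω → ℂ} {ν : Measure ℂ} [IsProbabilityMeasure ν] {α lam : ℝ}

/-- An almost sure limit of the zeros of the partial sums. -/
theorem IsAdmissibleCoefficients.aemeasurable_zeros_mittagLefflerFun
    [IsProbabilityMeasure μ] (ha : IsAdmissibleCoefficients μ a) (hα : 0 < α) (hlam : 0 < lam) :
    AEMeasurable (fun ω => PointConfig.zeros (mittagLefflerFun α lam fun k => a k ω)) μ := by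
  have hpos := mittagLefflerWeight_pos hα hlam
  refine aemeasurable_of_tendsto_metrizable_ae atTop (f := fun n ω => PointConfig.zeros
    (weightedPoly (fun k _ => mittagLefflerWeight α lam k) n fun k => a k ω)) (fun n => ?_) ?_
  · refine AEMeasurable.comp_measurable (g := fun v => PointConfig.zeros
      (weightedPoly (fun k _ => mittagLefflerWeight α lam k) n v)) ?_ ha.measurable_seq
    refine ha.aemeasurable_of_continuousOn (n := 0) fun v hv => ?_
    exact (continuousAt_zeros_weightedPoly (hpos 0).ne' hv.1).continuousWithinAt
  · filter_upwards [ha.ae_hasExpGrowth, ha.ne_zero] with ω h1 h2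
    rw [mittagLefflerFun_eq]
    exact (isWeightArray_mittagLefflerWeight hα hlam).tendsto_zeros (hpos 0).ne' h1 h2

theorem IsAdmissibleBackground.ofMultiset_scaled_roots (hν : IsAdmissibleBackground ν)
    (hα : 0 < α) (hlam : 0 < lam)
    (hF : Tendsto (fun r : ℝ => cdf (modulusLaw ν) r / r ^ α) (𝓝[>] 0) (𝓝 lam))
    {n : ℕ} (hn : 0 < n) {v : ℕ → ℂ} (hv : v 0 ≠ 0) :
    PointConfig.ofMultiset ((randomPoly ν v n).roots.map
        fun z => (((n : ℝ) ^ (1 / α) : ℝ) : ℂ) * z)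
      = PointConfig.zeros (weightedPoly (rescaledWeight (modulusLaw ν) α) n v) := by
  have hn' : (0 : ℝ) < n := by exact_mod_cast hn
  obtain ⟨κ, hκ, h⟩ := hν.randomPoly_eval_scaled hα hlam hF hn
  have hd := (hν.isRadialLaw.isWeightArray hα hlam hF).pos 0 n hn (Nat.zero_le _)
  have hP : randomPoly ν v n ≠ 0 := by
    intro h0
    have h1 := h v 0
    rw [h0, Polynomial.eval_zero, weightedPoly_zero] at h1
    exact mul_ne_zero hκ (mul_ne_zero hv (by exact_mod_cast hd.ne')) h1
  obtain ⟨K, hK, hprod⟩ := exists_eq_prod_of_eval hP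
    (by exact_mod_cast (Real.rpow_pos_of_pos hn' (1 / α)).ne') hκ (h v)
  exact (zeros_eq_ofMultiset (differentiable_weightedPoly _ n v) hK hprod).symm

theorem aemeasurable_ofMultiset_scaled_roots (hν : IsAdmissibleBackground ν)
    (ha : IsAdmissibleCoefficients μ a) (hα : 0 < α) (hlam : 0 < lam)
    (hF : Tendsto (fun r : ℝ => cdf (modulusLaw ν) r / r ^ α) (𝓝[>] 0) (𝓝 lam)) (n : ℕ) :
    AEMeasurable (fun ω => PointConfig.ofMultiset ((randomPoly ν (fun k => a k ω) n).roots.map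
      fun z => (((n : ℝ) ^ (1 / α) : ℝ) : ℂ) * z)) μ := by
  rcases Nat.eq_zero_or_pos n with rfl | hn
  · simp only [roots_randomPoly_zero]
    exact aemeasurable_const
  · refine AEMeasurable.comp_measurable (g := fun v => PointConfig.ofMultiset
      ((randomPoly ν v n).roots.map fun z => (((n : ℝ) ^ (1 / α) : ℝ) : ℂ) * z)) ?_
      ha.measurable_seq
    refine ha.aemeasurable_of_continuousOn (n := 0) ?_
    have hd := (hν.isRadialLaw.isWeightArray hα hlam hF).pos 0 n hn (Nat.zero_le _)
    refine ContinuousOn.congr (f := fun v => PointConfig.zeros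
      (weightedPoly (rescaledWeight (modulusLaw ν) α) n v)) (fun v hv => ?_) fun v hv => ?_
    · exact (continuousAt_zeros_weightedPoly hd.ne' hv.1).continuousWithinAt
    · exact hν.ofMultiset_scaled_roots hα hlam hF hn hv.1

theorem tendsto_ofMultiset_scaled_roots (hν : IsAdmissibleBackground ν) (hα : 0 < α)
    (hlam : 0 < lam)
    (hF : Tendsto (fun r : ℝ => cdf (modulusLaw ν) r / r ^ α) (𝓝[>] 0) (𝓝 lam)) {v : ℕ → ℂ}
    (hv : HasExpGrowth v) (h0 : v 0 ≠ 0) :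
    Tendsto (fun n : ℕ => PointConfig.ofMultiset ((randomPoly ν v n).roots.map
        fun z => (((n : ℝ) ^ (1 / α) : ℝ) : ℂ) * z)) atTop
      (𝓝 (PointConfig.zeros (mittagLefflerFun α lam v))) := by
  rw [mittagLefflerFun_eq]
  refine ((hν.isRadialLaw.isWeightArray hα hlam hF).tendsto_zeros
    (mittagLefflerWeight_pos hα hlam 0).ne' hv h0).congr' ?_
  filter_upwards [eventually_gt_atTop 0] with n hn
  exact (hν.ofMultiset_scaled_roots hα hlam hF hn h0).symm

/-! ### Convergence at infinity -/

/-- The leading coefficient `v n ≠ 0` fixes the degree, and `v 0 ≠ 0` keeps the roots off the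
origin, so inverting them loses nothing. -/
theorem IsAdmissibleBackground.weightedPoly_reverse_eq_prod (hν : IsAdmissibleBackground ν)
    (hα : 0 < α) (hlam : 0 < lam)
    (hF : Tendsto (fun r : ℝ => cdf ((modulusLaw ν).map fun r => r⁻¹) r / r ^ α) (𝓝[>] 0) (𝓝 lam))
    {n : ℕ} (hn : 0 < n) {v : ℕ → ℂ} (hv : v 0 ≠ 0) (hvn : v n ≠ 0) :
    (randomPoly ν v n).roots ≠ 0 ∧ (∀ w ∈ (randomPoly ν v n).roots, w ≠ 0) ∧
    ∃ K, K ≠ 0 ∧ weightedPoly (rescaledWeight ((modulusLaw ν).map fun r => r⁻¹) α) n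
        (v ∘ reverseIndex n)
      = fun z => K * (((randomPoly ν v n).roots.map
          fun w => ((((n : ℝ) ^ (-(1 / α)) : ℝ) : ℂ) * w)⁻¹).map fun w => z - w).prod := by
  have hn' : (0 : ℝ) < n := by exact_mod_cast hn
  obtain ⟨κ, hκ, h⟩ := hν.randomPoly_eval_inv hα hlam hF hn
  have hcoeff : ∀ k ≤ n, v k ≠ 0 → (randomPoly ν v n).coeff k ≠ 0 := by
    intro k hk hvk
    have hpos := hν.isRadialLaw.inv.radialMoment_pos hα hlam hF (show n - k ≤ n by omega)
    rw [coeff_randomPoly, if_pos hk, hν.weightedInner_eq_radialMoment_inv hk]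
    exact mul_ne_zero hvk (by exact_mod_cast (inv_pos.mpr (Real.sqrt_pos.mpr hpos)).ne')
  have hdeg : (randomPoly ν v n).natDegree = n :=
    le_antisymm (natDegree_randomPoly_le ν v n)
      (Polynomial.le_natDegree_of_ne_zero (hcoeff n le_rfl hvn))
  have hP0 : (randomPoly ν v n).eval 0 ≠ 0 := by
    rw [← Polynomial.coeff_zero_eq_eval_zero]
    exact hcoeff 0 (Nat.zero_le _) hv
  have hP : randomPoly ν v n ≠ 0 := by
    intro h0
    rw [h0, Polynomial.eval_zero] at hP0
    exact hP0 rfl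
  refine ⟨?_, ?_, ?_⟩
  · rw [← Multiset.card_pos, ← (IsAlgClosed.splits _).natDegree_eq_card_roots, hdeg]
    exact hn
  · rintro w hw rfl
    exact hP0 ((Polynomial.mem_roots hP).mp hw)
  · exact exists_eq_prod_of_reverse hdeg hP0
      (by exact_mod_cast (Real.rpow_pos_of_pos hn' (-(1 / α))).ne') hκ
      (differentiable_weightedPoly _ n _).continuous (h v)

theorem IsAdmissibleBackground.punctured_scaled_roots (hν : IsAdmissibleBackground ν)
    (hα : 0 < α) (hlam : 0 < lam)
    (hF : Tendsto (fun r : ℝ => cdf ((modulusLaw ν).map fun r => r⁻¹) r / r ^ α) (𝓝[>] 0) (𝓝 lam))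
    {n : ℕ} (hn : 0 < n) {v : ℕ → ℂ} (hv : v 0 ≠ 0) (hvn : v n ≠ 0) :
    (PointConfig.ofMultiset ((randomPoly ν v n).roots.map
        fun z => (((n : ℝ) ^ (-(1 / α)) : ℝ) : ℂ) * z)).punctured
      = (PointConfig.zeros (weightedPoly (rescaledWeight ((modulusLaw ν).map fun r => r⁻¹) α) n
          (v ∘ reverseIndex n))).punctured.inverted := by
  have hn' : (0 : ℝ) < n := by exact_mod_cast hn
  obtain ⟨-, hne, K, hK, hprod⟩ := hν.weightedPoly_reverse_eq_prod hα hlam hF hn hv hvn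
  rw [zeros_eq_ofMultiset (differentiable_weightedPoly _ n _) hK hprod,
    ← ofMultiset_inv_punctured_inverted (s := (randomPoly ν v n).roots.map
      fun z => (((n : ℝ) ^ (-(1 / α)) : ℝ) : ℂ) * z), Multiset.map_map]
  · rfl
  · intro w hw
    obtain ⟨z, hz, rfl⟩ := Multiset.mem_map.mp hw
    exact mul_ne_zero (by exact_mod_cast (Real.rpow_pos_of_pos hn' (-(1 / α))).ne') (hne z hz)

theorem IsAdmissibleBackground.scaled_maxModulus_roots (hν : IsAdmissibleBackground ν)
    (hα : 0 < α) (hlam : 0 < lam)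
    (hF : Tendsto (fun r : ℝ => cdf ((modulusLaw ν).map fun r => r⁻¹) r / r ^ α) (𝓝[>] 0) (𝓝 lam))
    {n : ℕ} (hn : 0 < n) {v : ℕ → ℂ} (hv : v 0 ≠ 0) (hvn : v n ≠ 0) :
    (n : ℝ) ^ (-(1 / α)) * maxModulus (randomPoly ν v n).roots
      = (minZeroModulus (weightedPoly (rescaledWeight ((modulusLaw ν).map fun r => r⁻¹) α) n
          (v ∘ reverseIndex n)))⁻¹ := by
  have hn' : (0 : ℝ) < n := by exact_mod_cast hn
  obtain ⟨hs0, hne, K, hK, hprod⟩ := hν.weightedPoly_reverse_eq_prod hα hlam hF hn hv hvn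
  exact mul_maxModulus_eq (differentiable_weightedPoly _ n _).continuous
    (Real.rpow_pos_of_pos hn' _) hs0 hne hK hprod

theorem reverseIndex_zero (n : ℕ) : reverseIndex n 0 = n := by simp [reverseIndex]

theorem continuous_comp_reverseIndex (n : ℕ) :
    Continuous fun v : ℕ → ℂ => v ∘ reverseIndex n :=
  continuous_pi fun _ => continuous_apply _

theorem tendstoInDistribution_punctured_scaled_roots
    [IsProbabilityMeasure μ] (hν : IsAdmissibleBackground ν)
    (ha : IsAdmissibleCoefficients μ a) (hα : 0 < α) (hlam : 0 < lam)
    (hF : Tendsto (fun r : ℝ => cdf ((modulusLaw ν).map fun r => r⁻¹) r / r ^ α) (𝓝[>] 0)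
      (𝓝 lam)) :
    TendstoInDistribution
      (fun (n : ℕ) ω => (PointConfig.ofMultiset ((randomPoly ν (fun k => a k ω) n).roots.map
        fun z => (((n : ℝ) ^ (-(1 / α)) : ℝ) : ℂ) * z)).punctured) atTop
      (fun ω => (PointConfig.zeros (mittagLefflerFun α lam fun k => a k ω)).punctured.inverted)
      (fun _ => μ) μ := by
  have hw := hν.isRadialLaw.inv.isWeightArray hα hlam hF
  have hcont : Continuous fun P : PointConfig ℂ => P.punctured.inverted :=
    PointConfig.continuous_inverted.comp PointConfig.continuous_punctured
  refine ha.tendstoInDistribution_of_reverse (T := fun n v => (PointConfig.ofMultiset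
    ((randomPoly ν v n).roots.map fun z => (((n : ℝ) ^ (-(1 / α)) : ℝ) : ℂ) * z)).punctured)
    (fun n => ?_)
    (hcont.measurable.comp_aemeasurable (ha.aemeasurable_zeros_mittagLefflerFun hα hlam)) ?_
  · rcases Nat.eq_zero_or_pos n with rfl | hn
    · simp only [roots_randomPoly_zero]
      exact aemeasurable_const
    · refine ha.aemeasurable_of_continuousOn (n := n) ?_
      refine ContinuousOn.congr (f := fun v => (PointConfig.zeros (weightedPoly
        (rescaledWeight ((modulusLaw ν).map fun r => r⁻¹) α) n
          (v ∘ reverseIndex n))).punctured.inverted) (fun v hv => ?_) fun v hv =>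
        hν.punctured_scaled_roots hα hlam hF hn hv.1 hv.2
      refine ContinuousAt.continuousWithinAt ?_
      refine hcont.continuousAt.comp (f := fun v => PointConfig.zeros (weightedPoly
        (rescaledWeight ((modulusLaw ν).map fun r => r⁻¹) α) n (v ∘ reverseIndex n))) ?_
      refine ContinuousAt.comp (f := fun v : ℕ → ℂ => v ∘ reverseIndex n)
        (g := fun v => PointConfig.zeros (weightedPoly
          (rescaledWeight ((modulusLaw ν).map fun r => r⁻¹) α) n v)) ?_
        (continuous_comp_reverseIndex n).continuousAt
      refine continuousAt_zeros_weightedPoly (hw.pos 0 n hn (Nat.zero_le _)).ne' ?_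
      rw [Function.comp_apply, reverseIndex_zero]
      exact hv.2
  · filter_upwards [ha.ae_hasExpGrowth, ae_all_iff.mpr ha.ae_ne_zero] with ω h1 h2
    have h3 := (hcont.tendsto _).comp
      (hw.tendsto_zeros (mittagLefflerWeight_pos hα hlam 0).ne' h1 (h2 0))
    rw [← mittagLefflerFun_eq] at h3
    refine h3.congr' ?_
    filter_upwards [eventually_gt_atTop 0] with n hn
    -- Evaluated on the reversed sequence, the second reversal undoes the first and the polynomials
    -- with the original coefficients reappear.
    rw [hν.punctured_scaled_roots hα hlam hF hn (h2 _) (h2 _), Function.comp_assoc,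
      (reverseIndex_involutive n).comp_self, Function.comp_id]
    rfl

/-! ### Convergence of the maximum modulus -/

theorem IsAdmissibleCoefficients.ae_isGreatest_invZeroModuli
    [IsProbabilityMeasure μ] (ha : IsAdmissibleCoefficients μ a)
    (hα : 0 < α) (hlam : 0 < lam) :
    ∀ᵐ ω ∂μ, IsGreatest (invZeroModuli (mittagLefflerFun α lam fun k => a k ω))
      (minZeroModulus (mittagLefflerFun α lam fun k => a k ω))⁻¹ := by
  filter_upwards [ha.ae_hasExpGrowth, ha.ne_zero, ae_exists_mittagLefflerFun_eq_zero ha hα hlam]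
    with ω h1 h2 h3
  refine isGreatest_invZeroModuli (differentiable_mittagLefflerFun hα hlam h1).continuous h3 ?_
  rw [mittagLefflerFun_eq, weightedSeries_zero]
  exact mul_ne_zero h2 (by exact_mod_cast (mittagLefflerWeight_pos hα hlam 0).ne')

theorem tendstoInDistribution_scaled_maxModulus
    [IsProbabilityMeasure μ] (hν : IsAdmissibleBackground ν)
    (ha : IsAdmissibleCoefficients μ a) (hα : 0 < α) (hlam : 0 < lam)
    (hF : Tendsto (fun r : ℝ => cdf ((modulusLaw ν).map fun r => r⁻¹) r / r ^ α) (𝓝[>] 0)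
      (𝓝 lam)) :
    TendstoInDistribution
      (fun (n : ℕ) ω =>
        (n : ℝ) ^ (-(1 / α)) * maxModulus (randomPoly ν (fun k => a k ω) n).roots) atTop
      (fun ω => sSup (invZeroModuli (mittagLefflerFun α lam fun k => a k ω)))
      (fun _ => μ) μ := by
  have hw := hν.isRadialLaw.inv.isWeightArray hα hlam hF
  have hT : ∀ n : ℕ, AEMeasurable
      (fun v => (n : ℝ) ^ (-(1 / α)) * maxModulus (randomPoly ν v n).roots)
      (μ.map fun ω k => a k ω) := by
    intro n
    rcases Nat.eq_zero_or_pos n with rfl | hn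
    · simp only [roots_randomPoly_zero]
      exact aemeasurable_const
    · refine ha.aemeasurable_of_continuousOn (n := n) ?_
      refine ContinuousOn.congr (f := fun v => (minZeroModulus (weightedPoly
        (rescaledWeight ((modulusLaw ν).map fun r => r⁻¹) α) n
          (v ∘ reverseIndex n)))⁻¹) (fun v hv => ?_) fun v hv =>
        hν.scaled_maxModulus_roots hα hlam hF hn hv.1 hv.2
      refine ContinuousAt.continuousWithinAt ?_
      refine ContinuousAt.comp (f := fun v : ℕ → ℂ => v ∘ reverseIndex n)
        (g := fun v => (minZeroModulus (weightedPoly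
          (rescaledWeight ((modulusLaw ν).map fun r => r⁻¹) α) n v))⁻¹) ?_
        (continuous_comp_reverseIndex n).continuousAt
      refine continuousAt_inv_minZeroModulus_weightedPoly
        (hw.pos 0 n hn (Nat.zero_le _)).ne' ?_ ?_
      · rw [Function.comp_apply, reverseIndex_zero]
        exact hv.2
      · obtain ⟨hs0, -, K, -, hprod⟩ :=
          hν.weightedPoly_reverse_eq_prod hα hlam hF hn hv.1 hv.2
        obtain ⟨w, hwr⟩ := Multiset.exists_mem_of_ne_zero hs0
        refine ⟨((((n : ℝ) ^ (-(1 / α)) : ℝ) : ℂ) * w)⁻¹, ?_⟩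
        rw [hprod]
        refine mul_eq_zero_of_right _ (Multiset.prod_eq_zero ?_)
        exact Multiset.mem_map.mpr ⟨_, Multiset.mem_map_of_mem _ hwr, sub_self _⟩
  -- The almost sure existence of a zero of the limit is indispensable here: it gives the smallest
  -- zero modulus a continuous dependence, and a nonzero value that may be inverted.
  have hlim : ∀ᵐ ω ∂μ, Tendsto (fun n : ℕ => (n : ℝ) ^ (-(1 / α)) * maxModulus
      (randomPoly ν ((fun k => a k ω) ∘ reverseIndex n) n).roots) atTop
      (𝓝 (sSup (invZeroModuli (mittagLefflerFun α lam fun k => a k ω)))) := by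
    filter_upwards [ha.ae_hasExpGrowth, ae_all_iff.mpr ha.ae_ne_zero,
      ae_exists_mittagLefflerFun_eq_zero ha hα hlam, ha.ae_isGreatest_invZeroModuli hα hlam]
      with ω h1 h2 h3 h4
    rw [h4.csSup_eq]
    rw [mittagLefflerFun_eq] at h3 ⊢
    refine (hw.tendsto_inv_minZeroModulus (mittagLefflerWeight_pos hα hlam 0).ne' h1 (h2 0)
      h3).congr' ?_
    filter_upwards [eventually_gt_atTop 0] with n hn
    rw [hν.scaled_maxModulus_roots hα hlam hF hn (h2 _) (h2 _), Function.comp_assoc,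
      (reverseIndex_involutive n).comp_self, Function.comp_id]
  refine ha.tendstoInDistribution_of_reverse
    (T := fun n v => (n : ℝ) ^ (-(1 / α)) * maxModulus (randomPoly ν v n).roots) hT ?_ hlim
  -- The limiting maximum is measurable as an almost sure limit.
  exact aemeasurable_of_tendsto_metrizable_ae atTop
    (fun n => ha.aemeasurable_comp_reverse (hT n) n) hlim

end Limits

end

/-! ### The limit theorems at the origin, at infinity and for the maximum -/

theorem theorem4 {Ω : Type*} [MeasurableSpace Ω] (μ : Measure Ω) [IsProbabilityMeasure μ]
    (ν : Measure ℂ) [IsProbabilityMeasure ν] (hν : IsAdmissibleBackground ν)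
    (a : ℕ → Ω → ℂ) (ha : IsAdmissibleCoefficients μ a)
    (α lam : ℝ) (hα : 0 < α) (hlam : 0 < lam) :
    -- the limiting random series is almost surely entire
    (∀ᵐ ω ∂μ, ∀ z : ℂ, Summable (mittagLefflerTerm α lam (fun k => a k ω) z)) ∧
    -- at the origin
    (Tendsto (fun r : ℝ => ν.real (Metric.ball 0 r) / r ^ α) (𝓝[>] 0) (𝓝 lam) →
      (∀ n : ℕ, AEMeasurable (fun ω => PointConfig.ofMultiset
        ((randomPoly ν (fun k => a k ω) n).roots.map
          (fun z => (((n : ℝ) ^ (1 / α) : ℝ) : ℂ) * z))) μ) ∧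
      AEMeasurable
        (fun ω => PointConfig.zeros (mittagLefflerFun α lam (fun k => a k ω))) μ ∧
      ∀ᵐ ω ∂μ, Tendsto
        (fun n : ℕ => PointConfig.ofMultiset
          ((randomPoly ν (fun k => a k ω) n).roots.map
            (fun z => (((n : ℝ) ^ (1 / α) : ℝ) : ℂ) * z)))
        atTop
        (𝓝 (PointConfig.zeros (mittagLefflerFun α lam (fun k => a k ω))))) ∧
    -- at infinity
    (Tendsto (fun r : ℝ => r ^ α * ν.real (Metric.ball 0 r)ᶜ) atTop (𝓝 lam) →
      TendstoInDistribution
        (fun (n : ℕ) ω => (PointConfig.ofMultiset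
          ((randomPoly ν (fun k => a k ω) n).roots.map
            (fun z => (((n : ℝ) ^ (-(1 / α)) : ℝ) : ℂ) * z))).punctured)
        atTop
        (fun ω =>
          (PointConfig.zeros (mittagLefflerFun α lam (fun k => a k ω))).punctured.inverted)
        (fun _ => μ) μ ∧
      -- convergence of the maximum
      (∀ᵐ ω ∂μ,
        IsGreatest (invZeroModuli (mittagLefflerFun α lam (fun k => a k ω)))
          (sSup (invZeroModuli (mittagLefflerFun α lam (fun k => a k ω))))) ∧
      TendstoInDistribution
        (fun (n : ℕ) ω =>
          (n : ℝ) ^ (-(1 / α)) * maxModulus (randomPoly ν (fun k => a k ω) n).roots)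
        atTop
        (fun ω => sSup (invZeroModuli (mittagLefflerFun α lam (fun k => a k ω))))
        (fun _ => μ) μ) := by
  refine ⟨?_, fun h => ⟨?_, ha.aemeasurable_zeros_mittagLefflerFun hα hlam, ?_⟩,
    fun h => ⟨?_, ?_, ?_⟩⟩
  · filter_upwards [ha.ae_hasExpGrowth] with ω hω z using
      summable_mittagLefflerTerm hα hlam hω z
  · exact aemeasurable_ofMultiset_scaled_roots hν ha hα hlam (tendsto_cdf_modulusLaw h)
  · filter_upwards [ha.ae_hasExpGrowth, ha.ne_zero] with ω h1 h2
    exact tendsto_ofMultiset_scaled_roots hν hα hlam (tendsto_cdf_modulusLaw h) h1 h2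
  · exact tendstoInDistribution_punctured_scaled_roots hν ha hα hlam (hν.tendsto_cdf_inv h)
  · filter_upwards [ha.ae_isGreatest_invZeroModuli hα hlam] with ω hω
    rwa [hω.csSup_eq]
  · exact tendstoInDistribution_scaled_maxModulus hν ha hα hlam (hν.tendsto_cdf_inv h)
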